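/- Let $\mathbb{B}=\{z_1+jz_2: z_1,z_2\in\mathbb{C}\}$, $j^2=-1$, be the commutative algebra of bicomplex numbers, with idempotents $p^{\pm}=\frac12(1\pm ji)$, so that each $w=z_1+jz_2\in\mathbb{B}$ is uniquely $w=p^+w^++p^-w^-$ with $w^{\pm}=z_1\mp iz_2\in\mathbb{C}$; let $\|w\|_{\mathbb B}=\sqrt{(|w^+|^2+|w^-|^2)/2}$, $e^w=p^+e^{w^+}+p^-e^{w^-}$ and $\bar\partial=\frac12\left(\frac{\partial}{\partial x}+j\frac{\partial}{\partial y}\right)$. Let $Q(x,y)=ax^2+bxy+cy^2+dx+ey+f$ with real coefficients define a non-degenerate conic (its symmetric $3\times3$ matrix is invertible) that is not a circumference (i.e. not both $a=c$ and $b=0$), and let $\Gamma=\{(x,y)\in\mathbb{R}^2: Q(x,y)=0\}\subset\mathbb{C}$. Let $D$ be the region enclosed by $\Gamma$, that is, the union of the bounded connected components of $\mathbb{C}\setminus\Gamma$, and assume that $\Gamma$ does enclose a region, i.e. $D\neq\emptyset$. Let $P$ be a polynomial in $x$ and $y$ with coefficients in $\mathbb{B}$, let $2<q<\infty$, and let $A\in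 W^{1,q}(D,\mathbb{B})$. For $z\in\mathbb{C}$ put \[ T_D^{\mathbb B}[A](z)=p^+\left(-\frac1\pi\iint_D\frac{A^+(\zeta)}{\bar\zeta-\bar z}\,d\xi\,d\eta\right)+p^-\left(-\frac1\pi\iint_D\frac{A^-(\zeta)}{\zeta-z}\,d\xi\,d\eta\right),\qquad \zeta=\xi+i\eta, \] where the bars in $\bar\zeta-\bar z$ denote complex conjugation. Then the Dirichlet problem \[ \begin{cases}(\bar\partial-A)^2w=0 & \text{in } D,\\ w=e^{T_D^{\mathbb B}[A]}P & \text{on }\Gamma,\end{cases} \] has exactly one solution $w: D\cup\Gamma\to\mathbb{B}$. Here a solution is a function that is continuous on $D\cup\Gamma$, takes the given values on $\Gamma$, and satisfies the equation in the sense that, for some locally integrable $v: D\to\mathbb{B}$, $\bar\partial w-Aw=v$ and $\bar\partial v-Av=0$ in $D$ in the sense of distributions (all the functions involved being locally integrable). -/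

import Mathlib

open MeasureTheory
open scoped ContDiff

noncomputable section

/-- The bicomplex numbers `z₁ + j z₂` with `z₁ z₂ : ℂ` and `j² = -1`; the field `re` is the
scalar part `z₁` and the field `im` is the vector part `z₂`. -/
abbrev Bicomplex : Type := QuadraticAlgebra ℂ (-1) 0

namespace Bicomplex

/-- The bicomplex unit `j`. -/
def j : Bicomplex := ⟨0, 1⟩

/-- The complex number `z`, seen as a bicomplex number (scalar part `z`, vector part `0`). -/
def ofComplex (z : ℂ) : Bicomplex := algebraMap ℂ Bicomplex z

/-- The idempotent `p⁺ = (1 + j i) / 2`. -/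
def pPlus : Bicomplex := ofComplex (1 / 2) * (1 + j * ofComplex Complex.I)

/-- The idempotent `p⁻ = (1 - j i) / 2`. -/
def pMinus : Bicomplex := ofComplex (1 / 2) * (1 - j * ofComplex Complex.I)

/-- The component `w⁺ = Sc w - i Vec w` of `w = p⁺ w⁺ + p⁻ w⁻`. -/
def plus (w : Bicomplex) : ℂ := w.re - Complex.I * w.im

/-- The component `w⁻ = Sc w + i Vec w` of `w = p⁺ w⁺ + p⁻ w⁻`. -/
def minus (w : Bicomplex) : ℂ := w.re + Complex.I * w.im

/-- The bicomplex exponential `e^w = p⁺ e^{w⁺} + p⁻ e^{w⁻}`. -/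
def exp (w : Bicomplex) : Bicomplex :=
  pPlus * ofComplex (Complex.exp w.plus) + pMinus * ofComplex (Complex.exp w.minus)

theorem eq_pPlus_mul_add_pMinus_mul (w : Bicomplex) :
    w = pPlus * ofComplex w.plus + pMinus * ofComplex w.minus := by
  have h1 : (1 : Bicomplex).re = 1 := rfl
  have h2 : (1 : Bicomplex).im = 0 := rfl
  ext
  · simp [pPlus, pMinus, plus, minus, ofComplex, j, h1, h2]
    ring
  · simp [pPlus, pMinus, plus, minus, ofComplex, j, h1, h2]
    linear_combination w.im * Complex.I_sq

/-- The components scaled by `1/√2`, as a vector of `ℂ²` with its Euclidean norm. -/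
def toEuclidean : Bicomplex →ₗ[ℝ] EuclideanSpace ℂ (Fin 2) where
  toFun w := (√2)⁻¹ • !₂[w.plus, w.minus]
  map_add' v w := by
    ext k; fin_cases k <;> simp [plus, minus] <;> ring
  map_smul' r w := by
    ext k; fin_cases k <;> simp [plus, minus] <;> ring

/-- The bicomplex norm. -/
instance : Norm Bicomplex where
  norm w := √((‖w.plus‖ ^ 2 + ‖w.minus‖ ^ 2) / 2)

theorem norm_def (w : Bicomplex) : ‖w‖ = √((‖w.plus‖ ^ 2 + ‖w.minus‖ ^ 2) / 2) := rfl

theorem norm_eq_norm_toEuclidean (w : Bicomplex) : ‖w‖ = ‖toEuclidean w‖ := by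
  have h : ‖toEuclidean w‖ = ‖(√2)⁻¹ • !₂[w.plus, w.minus]‖ := rfl
  rw [h, norm_smul, EuclideanSpace.norm_eq, norm_def, Real.sqrt_div (by positivity)]
  simp [abs_of_nonneg, div_eq_inv_mul]

theorem eq_zero_of_norm_eq_zero (w : Bicomplex) (hw : ‖w‖ = 0) : w = 0 := by
  rw [norm_def, Real.sqrt_eq_zero (by positivity)] at hw
  have h1 : w.plus = 0 := by
    have : ‖w.plus‖ ^ 2 = 0 := by nlinarith [sq_nonneg ‖w.plus‖, sq_nonneg ‖w.minus‖]
    simpa using this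
  have h2 : w.minus = 0 := by
    have : ‖w.minus‖ ^ 2 = 0 := by nlinarith [sq_nonneg ‖w.plus‖, sq_nonneg ‖w.minus‖]
    simpa using this
  rw [eq_pPlus_mul_add_pMinus_mul w, h1, h2]
  simp [ofComplex]

instance : NormedAddCommGroup Bicomplex :=
  AddGroupNorm.toNormedAddCommGroup
    { toFun := fun w => ‖w‖
      map_zero' := by rw [norm_eq_norm_toEuclidean]; simp
      add_le' := fun v w => by
        simp only [norm_eq_norm_toEuclidean, map_add]; exact norm_add_le _ _
      neg' := fun w => by simp only [norm_eq_norm_toEuclidean, map_neg, norm_neg]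
      eq_zero_of_map_eq_zero' := eq_zero_of_norm_eq_zero }

instance : NormedSpace ℝ Bicomplex where
  norm_smul_le r w := by
    simp only [norm_eq_norm_toEuclidean, map_smul, norm_smul]; exact le_rfl

end Bicomplex

/-- `φ` is a real-valued test function on `D`: smooth, with compact support inside `D`. -/
structure IsTestFunction (D : Set ℂ) (φ : ℂ → ℝ) : Prop where
  contDiff : ContDiff ℝ ∞ φ
  hasCompactSupport : HasCompactSupport φ
  tsupport_subset : tsupport φ ⊆ D

/-- `g` is the weak derivative of `f` on `D` in the direction `u`
(`u = 1` gives `∂/∂x`, `u = i` gives `∂/∂y`). -/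
def HasWeakDirDeriv (D : Set ℂ) (u : ℂ) (f g : ℂ → Bicomplex) : Prop :=
  ∀ φ : ℂ → ℝ, IsTestFunction D φ →
    ∫ z in D, (fderiv ℝ φ z u) • f z = -∫ z in D, φ z • g z

/-- The bicomplex Sobolev space `W^{1,q}(D, 𝔹)`. -/
def MemSobolevOne (D : Set ℂ) (q : ℝ) (f : ℂ → Bicomplex) : Prop :=
  MemLp f (ENNReal.ofReal q) (volume.restrict D) ∧
  (∃ g, MemLp g (ENNReal.ofReal q) (volume.restrict D) ∧ HasWeakDirDeriv D 1 f g) ∧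
  (∃ g, MemLp g (ENNReal.ofReal q) (volume.restrict D) ∧ HasWeakDirDeriv D Complex.I f g)

/-- The real-valued `φ` differentiated by `∂̄ = (∂/∂x + j ∂/∂y) / 2`. -/
def dbarTest (φ : ℂ → ℝ) (z : ℂ) : Bicomplex :=
  (1 / 2 : ℝ) • ((fderiv ℝ φ z 1) • (1 : Bicomplex) + (fderiv ℝ φ z Complex.I) • Bicomplex.j)

/-- `∂̄ w = g` on `D` in the sense of distributions, for locally integrable `w` and `g`, where
`∂̄ = (∂/∂x + j ∂/∂y) / 2`. -/
def HasWeakDbar (D : Set ℂ) (w g : ℂ → Bicomplex) : Prop :=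
  LocallyIntegrableOn w D volume ∧ LocallyIntegrableOn g D volume ∧
  ∀ φ : ℂ → ℝ, IsTestFunction D φ →
    ∫ z in D, dbarTest φ z * w z = -∫ z in D, φ z • g z

/-- `(∂̄ - A)² w = 0` on `D`: the function `v = (∂̄ - A) w` exists in the weak sense, and
`(∂̄ - A) v = 0`. -/
def SolvesVekuaBitsadze (D : Set ℂ) (A w : ℂ → Bicomplex) : Prop :=
  ∃ v : ℂ → Bicomplex,
    HasWeakDbar D w (fun z => A z * w z + v z) ∧ HasWeakDbar D v (fun z => A z * v z)

/-- The bicomplex Vekua (Cauchy-Pompeiu-Teodorescu) operator `T_D^𝔹`. -/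
def vekuaOperator (D : Set ℂ) (f : ℂ → Bicomplex) (z : ℂ) : Bicomplex :=
  Bicomplex.pPlus * Bicomplex.ofComplex
    (-(1 / (Real.pi : ℂ)) *
      ∫ ζ in D, (f ζ).plus / ((starRingEnd ℂ) ζ - (starRingEnd ℂ) z)) +
  Bicomplex.pMinus * Bicomplex.ofComplex
    (-(1 / (Real.pi : ℂ)) * ∫ ζ in D, (f ζ).minus / (ζ - z))

/-- The conic `Q(x, y) = a x² + b x y + c y² + d x + e y + f = 0` with real coefficients. -/
structure Conic where
  a : ℝ
  b : ℝ
  c : ℝ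
  d : ℝ
  e : ℝ
  f : ℝ

namespace Conic

/-- The polynomial function `Q(x, y)`. -/
def eval (Q : Conic) (x y : ℝ) : ℝ :=
  Q.a * x ^ 2 + Q.b * x * y + Q.c * y ^ 2 + Q.d * x + Q.e * y + Q.f

/-- A conic is non-degenerate if its symmetric `3 × 3` matrix is invertible. -/
def NonDegenerate (Q : Conic) : Prop :=
  Matrix.det !![Q.a, Q.b / 2, Q.d / 2; Q.b / 2, Q.c, Q.e / 2; Q.d / 2, Q.e / 2, Q.f] ≠ 0

/-- The conic is a circumference: `a = c` and `b = 0`. -/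
def IsCircumference (Q : Conic) : Prop := Q.a = Q.c ∧ Q.b = 0

/-- The real locus `Γ = {Q = 0}`, in the plane `ℝ² = ℂ`. -/
def locus (Q : Conic) : Set ℂ := {z | Q.eval z.re z.im = 0}

end Conic

/-- The region enclosed by `Γ`: the union of the bounded connected components of the
complement of `Γ`. -/
def enclosedRegion (Γ : Set ℂ) : Set ℂ :=
  {z | z ∈ Γᶜ ∧ Bornology.IsBounded (connectedComponentIn Γᶜ z)}

/-- The value at `z = x + i y` of a polynomial in `x` and `y` with bicomplex coefficients. -/
def evalPoly (P : MvPolynomial (Fin 2) Bicomplex) (z : ℂ) : Bicomplex :=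
  MvPolynomial.eval ![Bicomplex.ofComplex z.re, Bicomplex.ofComplex z.im] P

/-- `w`, continuous on `D ∪ Γ`, solves the Dirichlet problem `(∂̄ - A)² w = 0` in `D`,
`w = g` on `Γ`. -/
structure SolvesDirichlet (D Γ : Set ℂ) (A g w : ℂ → Bicomplex) : Prop where
  continuousOn : ContinuousOn w (D ∪ Γ)
  equation : SolvesVekuaBitsadze D A w
  boundary : ∀ z ∈ Γ, w z = g z

end

noncomputable section

open Set Filter Topology Metric

/-! Reduction to complex functions. The components of `j` are -i (plus) and i (minus), so the
bicomplex `∂̄` acts on w⁻ as the complex `∂̄` and on w⁺ as its conjugate. Conjugating w⁺ gives two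
independent instances of one complex problem, with coefficient conj A⁺ or A⁻
(`Bicomplex.hasWeakDbar_iff`), and `vekuaOperator` becomes the Cauchy transform T of the coefficient
cut off to D.

Removing A. Formally `∂̄` TA = A, so (`∂̄` - A)²w = 0 should mean that exp(-TA) w is bianalytic,
that is z̄ f + g with f, g holomorphic. As A is only in L^q and the equation is weak, this is
derived from identities for T itself: antisymmetry of the pairing, T(`∂̄` ψ) = ψ, and the product
formula Tf · Tμ = T(f Tμ) + T(μ Tf), which sums to exp(Tf) = 1 + T(f exp(Tf)). The two directions
are `HasWeakComplexDbar.exists_bianalytic` and `hasWeakComplexDbar_exp_mul`. Since q > 2, TA is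
bounded and continuous, so the factor affects neither continuity nor the vanishing of boundary
values.

Uniqueness (`bianalytic_eq_zero`). The region is an ellipse with distinct foci m ± κ, covered by s ↦
m + κ cosh s on the strip |Re s| < s₀. On Re s = σ one has conj s = 2σ - s, so z̄ coincides there
with a holomorphic function of s, and z̄ f + g extends from that line to a holomorphic H_σ. These
are small on Re s = σ as σ → s₀ and bounded on Re s = 0; the three lines theorem gives H_{s₀} = 0.
Comparing s with -s, which give the same z, separates f from g. On a circle uniqueness fails: z z̄ -
1 is bianalytic and vanishes on |z| = 1.

Existence (`exists_bianalytic_polynomial`). With q₀ the quadratic polynomial of the conic, r ↦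
`∂̄`²(q₀ r) maps polynomials of degree at most n to themselves, and uniqueness makes it injective,
hence bijective. Solving `∂̄`²(q₀ r) = `∂̄`² p yields the bianalytic polynomial p - q₀ r, which
equals p on Γ. -/

/-- The Cauchy-Riemann operator `∂̄ = (∂/∂x + i ∂/∂y) / 2` on complex-valued functions. -/
def dbar (f : ℂ → ℂ) (z : ℂ) : ℂ :=
  (1 / 2) * (fderiv ℝ f z 1 + Complex.I * fderiv ℝ f z Complex.I)

/-! ### Cauchy-Pompeiu formula in polar coordinates -/

theorem hasCompactSupport_dbar {f : ℂ → ℂ} (hf : HasCompactSupport f) :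
    HasCompactSupport (dbar f) := by
  refine (hf.fderiv (𝕜 := ℝ)).mono fun z hz => ?_
  contrapose! hz
  simp only [Function.mem_support, not_not] at hz
  simp [dbar, hz]

theorem integrableOn_polar {G : ℝ × ℝ → ℂ} (hG : Continuous G) {R : ℝ}
    (hR : ∀ p : ℝ × ℝ, R < p.1 → G p = 0) :
    IntegrableOn G (Ioi (0 : ℝ) ×ˢ Ioo (-Real.pi) Real.pi) := by
  have h1 : IntegrableOn G (Icc 0 R ×ˢ Icc (-Real.pi) Real.pi) :=
    hG.continuousOn.integrableOn_compact (isCompact_Icc.prod isCompact_Icc)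
  refine IntegrableOn.of_forall_sdiff_eq_zero h1 (measurableSet_Ioi.prod measurableSet_Ioo) ?_
  rintro ⟨r, θ⟩ ⟨⟨h2, h3⟩, h4⟩
  refine hR _ ?_
  by_contra h5
  exact h4 ⟨⟨le_of_lt h2, not_lt.1 h5⟩, Ioo_subset_Icc_self h3⟩

/-- Polar form of `∂̄`: for c + is = exp(iθ) this reads exp(-iθ)(∂_x + i ∂_y) = ∂_r + (i/r) ∂_θ,
with L the derivative at the point. -/
theorem conj_mul_dbar_eq (L : ℂ →L[ℝ] ℂ) (c s : ℝ) :
    ((c : ℂ) - s * Complex.I) * (L 1 + Complex.I * L Complex.I) =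
      L (c + s * Complex.I) + Complex.I * L (Complex.I * (c + s * Complex.I)) := by
  have h1 : ((c : ℂ) + s * Complex.I) = c • (1 : ℂ) + s • Complex.I := by simp
  have h2 : Complex.I * ((c : ℂ) + s * Complex.I) = (-s) • (1 : ℂ) + c • Complex.I := by
    simp only [Complex.real_smul]
    push_cast
    linear_combination (s : ℂ) * Complex.I_sq
  rw [h2, h1, map_add, map_add, map_smul, map_smul, map_smul, map_smul]
  simp only [Complex.real_smul]
  push_cast
  linear_combination (-(s : ℂ) * L Complex.I) * Complex.I_sq

/-- The Cauchy-Pompeiu formula at the origin, for a compactly supported function. -/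
theorem integral_dbar_div {ψ : ℂ → ℂ} (hψ : ContDiff ℝ 1 ψ) (hc : HasCompactSupport ψ) :
    ∫ ζ, dbar ψ ζ / ζ = -Real.pi * ψ 0 := by
  obtain ⟨R, hR0, hR⟩ : ∃ R : ℝ, 0 < R ∧ ∀ z, R < ‖z‖ → z ∉ tsupport ψ := by
    obtain ⟨R, hR⟩ := hc.isBounded.subset_closedBall 0
    refine ⟨max R 1, by positivity, fun z hz hz' => ?_⟩
    have := hR hz'
    simp only [mem_closedBall, dist_zero_right] at this
    linarith [le_max_left R 1]
  have hψR : ∀ z, R < ‖z‖ → ψ z = 0 := fun z hz => image_eq_zero_of_notMem_tsupport (hR z hz)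
  have hdR : ∀ z, R < ‖z‖ → fderiv ℝ ψ z = 0 := fun z hz =>
    Function.notMem_support.1 fun h => hR z hz (support_fderiv_subset ℝ h)
  set e : ℝ → ℂ := fun θ => Real.cos θ + Real.sin θ * Complex.I with he
  have hec : Continuous e := by fun_prop
  have hen : ∀ r θ : ℝ, 0 ≤ r → ‖(r : ℂ) * e θ‖ = r := by
    intro r θ hr
    have : e θ = Complex.exp (θ * Complex.I) := by
      simp [he, Complex.exp_mul_I]
    rw [this, norm_mul, Complex.norm_exp_ofReal_mul_I]
    simp [abs_of_nonneg hr]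
  have hfc : Continuous fun p : ℝ × ℝ => fderiv ℝ ψ ((p.1 : ℂ) * e p.2) :=
    (hψ.continuous_fderiv one_ne_zero).comp (by fun_prop)
  set G1 : ℝ × ℝ → ℂ := fun p => fderiv ℝ ψ ((p.1 : ℂ) * e p.2) (e p.2) with hG1
  set G2 : ℝ × ℝ → ℂ := fun p => fderiv ℝ ψ ((p.1 : ℂ) * e p.2) (Complex.I * e p.2) with hG2
  have hG1c : Continuous G1 := by fun_prop
  have hG2c : Continuous G2 := by fun_prop
  have hz : ∀ p : ℝ × ℝ, R < p.1 → fderiv ℝ ψ ((p.1 : ℂ) * e p.2) = 0 := fun p hp => by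
    apply hdR
    rwa [hen _ _ (hR0.trans hp).le]
  have hi1 := integrableOn_polar hG1c (R := R) fun p hp => by simp [hG1, hz p hp]
  have hi2 := integrableOn_polar hG2c (R := R) fun p hp => by simp [hG2, hz p hp]
  have hdψ : ∀ z, HasFDerivAt ψ (fderiv ℝ ψ z) z := fun z =>
    (hψ.differentiable one_ne_zero z).hasFDerivAt
  have hI1 : ∫ p in Ioi (0 : ℝ) ×ˢ Ioo (-Real.pi) Real.pi, G1 p = -(2 * Real.pi) * ψ 0 := by
    -- `G1` is the radial derivative, so each ray contributes only its endpoint value at the origin.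
    have h1 : ∀ θ : ℝ, ∫ r in Ioi (0 : ℝ), G1 (r, θ) = -ψ 0 := by
      intro θ
      have hd : ∀ r : ℝ, HasDerivAt (fun r : ℝ => ψ ((r : ℂ) * e θ)) (G1 (r, θ)) r := by
        intro r
        have h2 : HasDerivAt (fun r : ℝ => (r : ℂ) * e θ) (e θ) r := by
          simpa using (Complex.ofRealCLM.hasDerivAt (x := r)).mul_const (e θ)
        exact (hdψ _).comp_hasDerivAt r h2
      have ht : Tendsto (fun r : ℝ => ψ ((r : ℂ) * e θ)) atTop (𝓝 0) := by
        refine tendsto_const_nhds.congr' ?_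
        filter_upwards [eventually_gt_atTop R] with r hr
        rw [hψR]
        rwa [hen _ _ (hR0.trans hr).le]
      have hint : IntegrableOn (fun r => G1 (r, θ)) (Ioi 0) := by
        have h3 : IntegrableOn (fun r => G1 (r, θ)) (Icc 0 R) :=
          (hG1c.comp
            (by fun_prop : Continuous fun r : ℝ => (r, θ))).continuousOn.integrableOn_compact
            isCompact_Icc
        refine h3.of_forall_sdiff_eq_zero measurableSet_Ioi ?_
        rintro r ⟨h4, h5⟩
        have : R < r := by
          by_contra h6
          exact h5 ⟨le_of_lt h4, not_lt.1 h6⟩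
        simp [hG1, hz (r, θ) this]
      have := integral_Ioi_of_hasDerivAt_of_tendsto' (fun r _ => hd r) hint ht
      simpa using this
    rw [Measure.volume_eq_prod, ← Measure.prod_restrict] at *
    rw [integral_prod_symm _ (by rw [Measure.prod_restrict]; exact hi1)]
    simp_rw [h1]
    simp [Real.pi_pos.le]
    ring_nf
    simp
  have hI2 : ∫ p in Ioi (0 : ℝ) ×ˢ Ioo (-Real.pi) Real.pi, G2 p = 0 := by
    -- r · `G2` is the angular derivative, whose integral over a full circle vanishes by
    -- periodicity.
    have h1 : ∀ r ∈ Ioi (0 : ℝ), ∫ θ in Ioo (-Real.pi) Real.pi, G2 (r, θ) = 0 := by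
      intro r hr
      have hd : ∀ θ : ℝ, HasDerivAt (fun θ : ℝ => ψ ((r : ℂ) * e θ)) (r • G2 (r, θ)) θ := by
        intro θ
        have h2 : HasDerivAt (fun θ : ℝ => (r : ℂ) * e θ) ((r : ℝ) • (Complex.I * e θ)) θ := by
          have h3 : HasDerivAt e (Complex.I * e θ) θ := by
            have h4 : HasDerivAt e (((-Real.sin θ : ℝ) : ℂ) + (Real.cos θ : ℝ) * Complex.I) θ :=
              ((Real.hasDerivAt_cos θ).ofReal_comp).add
                (((Real.hasDerivAt_sin θ).ofReal_comp).mul_const Complex.I)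
            convert! h4 using 1
            simp only [he]
            push_cast
            linear_combination (Complex.sin θ) * Complex.I_sq
          simpa using h3.const_mul (r : ℂ)
        have := (hdψ _).comp_hasDerivAt θ h2
        rwa [map_smul] at this
      have h5 := intervalIntegral.integral_eq_sub_of_hasDerivAt (a := -Real.pi) (b := Real.pi)
        (fun θ _ => hd θ) (Continuous.intervalIntegrable (by fun_prop) _ _)
      have h6 : e Real.pi = e (-Real.pi) := by simp [he]
      rw [h6, sub_self, intervalIntegral.integral_smul, smul_eq_zero] at h5
      rcases h5 with h5 | h5
      · exact absurd h5 (ne_of_gt hr)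
      · rwa [intervalIntegral.integral_of_le (by linarith [Real.pi_pos]),
          integral_Ioc_eq_integral_Ioo] at h5
    rw [Measure.volume_eq_prod, ← Measure.prod_restrict] at *
    rw [integral_prod _ (by rw [Measure.prod_restrict]; exact hi2)]
    rw [setIntegral_congr_fun measurableSet_Ioi h1]
    simp
  rw [← Complex.integral_comp_polarCoord_symm, polarCoord_target]
  -- The polar Jacobian r cancels the singularity of 1/ζ, leaving exp(-iθ) `∂̄` ψ.
  have hpt : ∀ p ∈ Ioi (0 : ℝ) ×ˢ Ioo (-Real.pi) Real.pi,
      p.1 • (dbar ψ (Complex.polarCoord.symm p) / Complex.polarCoord.symm p) =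
        (1 / 2) * G1 p + (1 / 2 * Complex.I) * G2 p := by
    rintro ⟨r, θ⟩ ⟨hr, -⟩
    have hr' : (r : ℂ) ≠ 0 := by exact_mod_cast (ne_of_gt hr : r ≠ 0)
    have hcs : e θ * ((Real.cos θ : ℂ) - Real.sin θ * Complex.I) = 1 := by
      simp only [he]
      have : ((Real.cos θ : ℂ)) ^ 2 + (Real.sin θ : ℂ) ^ 2 = 1 := by
        exact_mod_cast Real.cos_sq_add_sin_sq θ
      linear_combination this - (Real.sin θ : ℂ) ^ 2 * Complex.I_sq
    have he0 : e θ ≠ 0 := left_ne_zero_of_mul_eq_one hcs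
    have h3 := conj_mul_dbar_eq (fderiv ℝ ψ ((r : ℂ) * e θ)) (Real.cos θ) (Real.sin θ)
    rw [Complex.polarCoord_symm_apply]
    change r • (dbar ψ (r * e θ) / (r * e θ)) = _
    have h4 : (r : ℂ) • (dbar ψ (r * e θ) / (r * e θ)) =
        ((Real.cos θ : ℂ) - Real.sin θ * Complex.I) * dbar ψ (r * e θ) := by
      rw [smul_eq_mul]
      field_simp
      linear_combination (-dbar ψ (r * e θ)) * hcs
    rw [← Complex.coe_smul, h4]
    simp only [dbar, hG1, hG2]
    simp only [he] at h3 ⊢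
    linear_combination (1 / 2) * h3
  rw [setIntegral_congr_fun (measurableSet_Ioi.prod measurableSet_Ioo) hpt,
    integral_add (hi1.const_mul _) (hi2.const_mul _), integral_const_mul, integral_const_mul,
    hI1, hI2]
  ring

/-! ### Bounds for potentials of L^q densities -/

/-- `f` is measurable and its logarithmic-type potential `∫ |f(ζ)| / |ζ - z|` is bounded in `z`. -/
structure BoundedPotential (f : ℂ → ℂ) : Prop where
  aestronglyMeasurable : AEStronglyMeasurable f volume
  exists_bound : ∃ M : ℝ, ∀ z, Integrable (fun ζ => f ζ / (ζ - z)) ∧ ∫ ζ, ‖f ζ / (ζ - z)‖ ≤ M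

theorem integrableOn_norm_rpow_ball {r : ℝ} (hr : r < 2) (R : ℝ) :
    IntegrableOn (fun w : ℂ => ‖w‖ ^ (-r)) (ball 0 R) := by
  refine integrableOn_ball_of_norm_le_rpow (C := 1) (α := r) (by simp) (by simpa using hr) ?_ ?_
  · refine Eventually.of_forall fun x => ?_
    rw [Real.norm_of_nonneg (by positivity), one_mul]
  · exact (measurable_norm.pow_const _).aestronglyMeasurable

/-- The integral of `|ζ - z|⁻ʳ` over a set of finite measure is bounded uniformly in `z`. -/
theorem exists_setIntegral_norm_sub_rpow_le {D : Set ℂ}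
    (hD' : volume D ≠ ⊤) {r : ℝ} (hr0 : 0 ≤ r) (hr : r < 2) :
    ∃ M : ℝ, ∀ z, IntegrableOn (fun ζ => ‖ζ - z‖ ^ (-r)) D ∧
      ∫ ζ in D, ‖ζ - z‖ ^ (-r) ≤ M := by
  -- The singular part of the kernel has a translation-invariant integral and the rest is at most 1;
  -- hence a bound independent of z.
  set K : ℂ → ℝ := (ball 0 1).indicator fun w : ℂ => ‖w‖ ^ (-r) with hK
  have hKi : Integrable K :=
    (integrable_indicator_iff measurableSet_ball).2 (integrableOn_norm_rpow_ball hr 1)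
  have hKt : ∀ z, Integrable fun ζ => K (ζ - z) := fun z => hKi.comp_sub_right z
  have hle : ∀ z ζ, ‖ζ - z‖ ^ (-r) ≤ K (ζ - z) + 1 := by
    intro z ζ
    by_cases h : ζ - z ∈ ball (0 : ℂ) 1
    · rw [hK, indicator_of_mem h]
      linarith
    · rw [hK, indicator_of_notMem h, zero_add]
      refine Real.rpow_le_one_of_one_le_of_nonpos ?_ (by linarith)
      simpa using h
  have hint : ∀ z, IntegrableOn (fun ζ => K (ζ - z) + 1) D := fun z =>
    (hKt z).integrableOn.add (integrableOn_const hD')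
  have hint' : ∀ z, IntegrableOn (fun ζ => ‖ζ - z‖ ^ (-r)) D := fun z => by
    refine Integrable.mono' (hint z) ?_ ?_
    · exact ((measurable_norm.comp (measurable_id.sub_const z)).pow_const _).aestronglyMeasurable
    · refine Eventually.of_forall fun ζ => ?_
      rw [Real.norm_of_nonneg (by positivity)]
      exact hle z ζ
  refine ⟨(∫ w, K w) + volume.real D, fun z => ⟨hint' z, ?_⟩⟩
  calc ∫ ζ in D, ‖ζ - z‖ ^ (-r) ≤ ∫ ζ in D, (K (ζ - z) + 1) :=
        setIntegral_mono (hint' z) (hint z) (hle z)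
    _ = (∫ ζ in D, K (ζ - z)) + volume.real D := by
        rw [integral_add (hKt z).integrableOn (integrableOn_const hD')]
        simp
    _ ≤ (∫ ζ, K (ζ - z)) + volume.real D := by
        gcongr
        · refine Eventually.of_forall fun ζ => indicator_nonneg (fun w _ => by positivity) _
        · exact hKt z
        · exact Measure.restrict_le_self
    _ = (∫ w, K w) + volume.real D := by
        rw [integral_sub_right_eq_self K z]

/-- An `L^q` density, `q > 2`, on a set of finite measure has bounded potentials for kernels
slightly more singular than the Cauchy kernel. -/
theorem exists_integral_norm_mul_rpow_le {D : Set ℂ}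
    (hD' : volume D ≠ ⊤) {q : ℝ} (hq : 2 < q) {f : ℂ → ℂ}
    (hf : MemLp f (ENNReal.ofReal q) (volume.restrict D)) {r : ℝ} (hr0 : 0 ≤ r)
    (hr : r * (q / (q - 1)) < 2) :
    ∃ M : ℝ, ∀ z, IntegrableOn (fun ζ => ‖f ζ‖ * ‖ζ - z‖ ^ (-r)) D ∧
      ∫ ζ in D, ‖f ζ‖ * ‖ζ - z‖ ^ (-r) ≤ M := by
  have hconj : q.HolderConjugate (q / (q - 1)) := Real.HolderConjugate.conjExponent (by linarith)
  set p := q / (q - 1) with hp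
  have hp0 : 0 < p := hconj.symm.pos
  obtain ⟨M, hM⟩ := exists_setIntegral_norm_sub_rpow_le hD' (r := r * p) (by positivity) hr
  have hfq : IntegrableOn (fun ζ => ‖f ζ‖ ^ q) D := by
    have := hf.integrable_norm_rpow (by simpa using by linarith) (by simp)
    rwa [ENNReal.toReal_ofReal (by linarith)] at this
  -- Young's inequality with the conjugate exponent p; the condition r p < 2 keeps the second term
  -- integrable in the plane.
  have hle : ∀ z ζ, ‖f ζ‖ * ‖ζ - z‖ ^ (-r) ≤ ‖f ζ‖ ^ q / q + ‖ζ - z‖ ^ (-(r * p)) / p := by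
    intro z ζ
    have := Real.young_inequality_of_nonneg (norm_nonneg (f ζ))
      (Real.rpow_nonneg (norm_nonneg (ζ - z)) (-r)) hconj
    rwa [← Real.rpow_mul (norm_nonneg _), neg_mul] at this
  have hint : ∀ z, IntegrableOn (fun ζ => ‖f ζ‖ ^ q / q + ‖ζ - z‖ ^ (-(r * p)) / p) D :=
    fun z => (hfq.div_const q).add ((hM z).1.div_const p)
  have hint' : ∀ z, IntegrableOn (fun ζ => ‖f ζ‖ * ‖ζ - z‖ ^ (-r)) D := fun z => by
    refine Integrable.mono' (hint z) ?_ ?_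
    · exact hf.1.norm.mul
        ((measurable_norm.comp (measurable_id.sub_const z)).pow_const _).aestronglyMeasurable
    · refine Eventually.of_forall fun ζ => ?_
      rw [Real.norm_of_nonneg (by positivity)]
      exact hle z ζ
  refine ⟨(∫ ζ in D, ‖f ζ‖ ^ q) / q + M / p, fun z => ⟨hint' z, ?_⟩⟩
  refine (setIntegral_mono (hint' z) (hint z) (hle z)).trans ?_
  rw [integral_add (hfq.div_const q) ((hM z).1.div_const p), integral_div, integral_div]
  gcongr
  exact (hM z).2

/-- The case r = 1 of the preceding estimate: for q > 2 the conjugate exponent q/(q-1) is below 2.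
-/
theorem BoundedPotential.of_memLp {D : Set ℂ} (hD : MeasurableSet D)
    (hD' : volume D ≠ ⊤) {q : ℝ} (hq : 2 < q) {f : ℂ → ℂ}
    (hf : MemLp f (ENNReal.ofReal q) (volume.restrict D)) :
    BoundedPotential (D.indicator f) := by
  obtain ⟨M, hM⟩ := exists_integral_norm_mul_rpow_le hD' hq hf (r := 1) zero_le_one (by
    rw [one_mul, div_lt_iff₀ (by linarith)]; linarith)
  have h0 : ∀ z ζ, ‖D.indicator f ζ / (ζ - z)‖ =
      D.indicator (fun ζ => ‖f ζ‖ * ‖ζ - z‖ ^ (-1 : ℝ)) ζ := by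
    intro z ζ
    by_cases h : ζ ∈ D
    · simp [h, Real.rpow_neg_one, div_eq_mul_inv]
    · simp [h]
  have hm : AEStronglyMeasurable (D.indicator f) volume :=
    (aestronglyMeasurable_indicator_iff hD).2 hf.1
  refine ⟨hm, M, fun z => ⟨?_, ?_⟩⟩
  · rw [← integrable_norm_iff]
    · simp_rw [h0]
      exact (integrable_indicator_iff hD).2 (hM z).1
    · exact hm.div₀ (measurable_id.sub_const z).aestronglyMeasurable
  · simp_rw [h0]
    rw [integral_indicator hD]
    exact (hM z).2

theorem BoundedPotential.mul_bounded {f g : ℂ → ℂ} (hf : BoundedPotential f)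
    (hg : AEStronglyMeasurable g volume) {C : ℝ} (hC : ∀ z, ‖g z‖ ≤ C) :
    BoundedPotential fun z => f z * g z := by
  obtain ⟨M, hM⟩ := hf.exists_bound
  have hint : ∀ z, Integrable fun ζ => f ζ * g ζ / (ζ - z) := fun z => by
    have := (hM z).1.mul_bdd hg (Eventually.of_forall hC)
    exact this.congr (Eventually.of_forall fun ζ => by simp only; ring)
  refine ⟨hf.aestronglyMeasurable.mul hg, M * C, fun z => ⟨hint z, ?_⟩⟩
  have hC0 : 0 ≤ C := (norm_nonneg _).trans (hC 0)
  calc ∫ ζ, ‖f ζ * g ζ / (ζ - z)‖ ≤ ∫ ζ, ‖f ζ / (ζ - z)‖ * C := by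
        refine integral_mono (hint z).norm ((hM z).1.norm.mul_const C) fun ζ => ?_
        simp only [norm_mul, norm_div]
        rw [mul_div_right_comm]
        exact mul_le_mul_of_nonneg_left (hC ζ) (by positivity)
    _ ≤ M * C := by
        rw [integral_mul_const]
        exact mul_le_mul_of_nonneg_right (hM z).2 hC0

theorem BoundedPotential.of_bounded {D : Set ℂ} (hD : MeasurableSet D)
    (hD' : volume D ≠ ⊤) {f : ℂ → ℂ} (hf : AEStronglyMeasurable f volume) {C : ℝ}
    (hC : ∀ z, ‖f z‖ ≤ C) : BoundedPotential (D.indicator f) := by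
  have : IsFiniteMeasure (volume.restrict D) := ⟨by simpa using hD'.lt_top⟩
  exact .of_memLp hD hD' (q := 3) (by norm_num)
    (MemLp.of_bound hf.restrict C (Eventually.of_forall hC))

theorem BoundedPotential.of_continuous {f : ℂ → ℂ} (hf : Continuous f)
    (hc : HasCompactSupport f) : BoundedPotential f := by
  obtain ⟨C, hC⟩ := hf.bounded_above_of_compact_support hc
  have h := BoundedPotential.of_bounded (isClosed_tsupport f).measurableSet
    hc.isCompact.measure_ne_top hf.aestronglyMeasurable hC
  rwa [indicator_eq_self.2 (subset_tsupport f)] at h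

/-! ### The Cauchy transform: duality, continuity, holomorphy -/

/-- The Cauchy transform `T f(z) = -(1/π) ∬ f(ζ) / (ζ - z)`. -/
def cauchyTransform (f : ℂ → ℂ) (z : ℂ) : ℂ := -(1 / (Real.pi : ℂ)) * ∫ ζ, f ζ / (ζ - z)

theorem measurable_cauchyKernel : Measurable fun p : ℂ × ℂ => (p.2 - p.1)⁻¹ :=
  (measurable_snd.sub measurable_fst).inv

/-- Tonelli: the inner integral of |a(ζ)|/|ζ - z| is bounded uniformly in z, so the outer factor
need only be integrable. This is what justifies every exchange of integrals between a bounded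
potential and an L¹ density. -/
theorem BoundedPotential.integrable_prod {a b : ℂ → ℂ} (ha : BoundedPotential a)
    (hb : Integrable b) :
    Integrable (fun p : ℂ × ℂ => b p.1 * (a p.2 / (p.2 - p.1))) (volume.prod volume) := by
  obtain ⟨M, hM⟩ := ha.exists_bound
  have hm : AEStronglyMeasurable (fun p : ℂ × ℂ => b p.1 * (a p.2 / (p.2 - p.1)))
      (volume.prod volume) := by
    simp_rw [div_eq_mul_inv]
    exact hb.1.comp_fst.mul
      (ha.aestronglyMeasurable.comp_snd.mul measurable_cauchyKernel.aestronglyMeasurable)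
  rw [integrable_prod_iff hm]
  refine ⟨Eventually.of_forall fun x => (hM x).1.const_mul (b x), ?_⟩
  simp_rw [norm_mul, integral_const_mul]
  refine hb.norm.mul_bdd (c := M) ?_ (Eventually.of_forall fun x => ?_)
  · have h2 : AEStronglyMeasurable (fun p : ℂ × ℂ => ‖a p.2 / (p.2 - p.1)‖)
        (volume.prod volume) := by
      simp_rw [div_eq_mul_inv]
      exact (ha.aestronglyMeasurable.comp_snd.mul
        measurable_cauchyKernel.aestronglyMeasurable).norm
    exact h2.integral_prod_right'
  · rw [Real.norm_of_nonneg (integral_nonneg fun _ => norm_nonneg _)]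
    exact (hM x).2

theorem BoundedPotential.aestronglyMeasurable_cauchyTransform {f : ℂ → ℂ}
    (hf : AEStronglyMeasurable f volume) : AEStronglyMeasurable (cauchyTransform f) volume := by
  have h2 : AEStronglyMeasurable (fun p : ℂ × ℂ => f p.2 / (p.2 - p.1))
      (volume.prod volume) := by
    simp_rw [div_eq_mul_inv]
    exact hf.comp_snd.mul measurable_cauchyKernel.aestronglyMeasurable
  exact h2.integral_prod_right'.const_mul _

theorem BoundedPotential.exists_norm_cauchyTransform_le {f : ℂ → ℂ} (hf : BoundedPotential f) :
    ∃ C : ℝ, ∀ z, ‖cauchyTransform f z‖ ≤ C := by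
  obtain ⟨M, hM⟩ := hf.exists_bound
  refine ⟨‖-(1 / (Real.pi : ℂ))‖ * M, fun z => ?_⟩
  rw [cauchyTransform, norm_mul]
  exact mul_le_mul_of_nonneg_left ((norm_integral_le_integral_norm _).trans (hM z).2)
    (norm_nonneg _)

theorem integrable_swap_kernel {a b : ℂ → ℂ} (ha : BoundedPotential a) (hb : Integrable b) :
    Integrable (fun p : ℂ × ℂ => a p.1 * (b p.2 / (p.2 - p.1))) (volume.prod volume) := by
  have h := (ha.integrable_prod hb).swap.neg
  refine h.congr (Eventually.of_forall fun p => ?_)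
  simp only [Pi.neg_apply, Function.comp, Prod.fst_swap, Prod.snd_swap]
  rw [← neg_sub p.2 p.1, div_neg]
  ring

/-- The Cauchy transform is antisymmetric for the bilinear integral pairing. -/
theorem integral_mul_cauchyTransform {a b : ℂ → ℂ} (ha : BoundedPotential a)
    (hb : Integrable b) :
    ∫ z, a z * cauchyTransform b z = -∫ z, b z * cauchyTransform a z := by
  have h1 := ha.integrable_prod hb
  have h2 := integrable_swap_kernel ha hb
  have e1 : ∫ z, b z * cauchyTransform a z =
      -(1 / (Real.pi : ℂ)) * ∫ z, ∫ ζ, b z * (a ζ / (ζ - z)) := by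
    rw [← integral_const_mul]
    congr 1 with z
    rw [integral_const_mul, cauchyTransform]
    ring
  have e2 : ∫ z, a z * cauchyTransform b z =
      -(1 / (Real.pi : ℂ)) * ∫ z, ∫ ζ, a z * (b ζ / (ζ - z)) := by
    rw [← integral_const_mul]
    congr 1 with z
    rw [integral_const_mul, cauchyTransform]
    ring
  rw [e1, e2, integral_integral_swap h2, ← mul_neg, ← integral_neg]
  congr 2 with z
  rw [← integral_neg]
  congr 1 with ζ
  rw [← neg_sub ζ z, div_neg]
  ring

theorem integrable_mul_cauchyTransform {a b : ℂ → ℂ} (ha : BoundedPotential a)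
    (hb : Integrable b) : Integrable fun z => a z * cauchyTransform b z := by
  have h := (integrable_swap_kernel ha hb).integral_prod_left.const_mul (-(1 / (Real.pi : ℂ)))
  refine h.congr (Eventually.of_forall fun z => ?_)
  simp only [integral_const_mul, cauchyTransform]
  ring

/-- The potential of an L¹ density may diverge at some points. Pairing it with the indicator of a
ball, which has bounded potential, shows that it is finite almost everywhere in that ball. -/
theorem Integrable.ae_integrable_div_sub {b : ℂ → ℂ} (hb : Integrable b) :
    ∀ᵐ z, Integrable fun ζ => b ζ / (ζ - z) := by
  have h : ∀ n : ℕ, ∀ᵐ z : ℂ, z ∈ ball (0 : ℂ) n → Integrable fun ζ => b ζ / (ζ - z) := by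
    intro n
    have ha : BoundedPotential ((ball (0 : ℂ) n).indicator fun _ => 1) :=
      .of_bounded measurableSet_ball measure_ball_lt_top.ne aestronglyMeasurable_const
        (C := 1) (by simp)
    have h1 := (integrable_swap_kernel ha hb).prod_right_ae
    filter_upwards [h1] with z hz hzn
    simpa [hzn] using hz
  filter_upwards [ae_all_iff.2 h] with z hz
  obtain ⟨n, hn⟩ := exists_nat_gt ‖z‖
  exact hz n (by simpa using hn)

theorem Integrable.locallyIntegrable_cauchyTransform {b : ℂ → ℂ} (hb : Integrable b) :
    LocallyIntegrable (cauchyTransform b) := by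
  intro z
  refine ⟨ball z 1, ball_mem_nhds z one_pos, ?_⟩
  have ha : BoundedPotential ((ball z 1).indicator fun _ => 1) :=
    .of_bounded measurableSet_ball measure_ball_lt_top.ne aestronglyMeasurable_const
      (C := 1) (by simp)
  have h := integrable_mul_cauchyTransform ha hb
  rw [← integrable_indicator_iff measurableSet_ball]
  refine h.congr (Eventually.of_forall fun w => ?_)
  by_cases hw : w ∈ ball z 1 <;> simp [hw]

/-- The Cauchy transform of an `L^q` density, `q > 2`, on a set of finite measure is continuous. -/
theorem continuous_cauchyTransform_indicator {D : Set ℂ} (hD : MeasurableSet D)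
    (hD' : volume D ≠ ⊤) {q : ℝ} (hq : 2 < q) {f : ℂ → ℂ}
    (hf : MemLp f (ENNReal.ofReal q) (volume.restrict D)) :
    Continuous (cauchyTransform (D.indicator f)) := by
  have : IsFiniteMeasure (volume.restrict D) := ⟨by simpa using hD'.lt_top⟩
  set F := D.indicator f with hF
  have hFi : Integrable F := (integrable_indicator_iff hD).2
    (hf.integrable (by simpa using by linarith))
  set p := q / (q - 1) with hp
  have hp1 : 1 < p := by rw [hp, lt_div_iff₀ (by linarith)]; linarith
  have hp2 : p < 2 := by rw [hp, div_lt_iff₀ (by linarith)]; linarith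
  -- The midpoint of 1 and 2/p, an interval that is non-empty because p < 2. Here r > 1 yields the
  -- gain δ^(r-1) below, and r p < 2 keeps the potential of order r bounded.
  set r : ℝ := 1 / 2 + 1 / p with hr
  have hr1 : 1 < r := by
    have : 1 / 2 < 1 / p := one_div_lt_one_div_of_lt (by linarith) hp2
    linarith
  have hrp : r * p < 2 := by
    rw [hr, add_mul, one_div_mul_cancel (by linarith)]
    linarith
  obtain ⟨M, hM⟩ := exists_integral_norm_mul_rpow_le hD' hq hf (r := r) (by linarith) hrp
  have hbp : BoundedPotential F := .of_memLp hD hD' hq hf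
  obtain ⟨M', hM'⟩ := hbp.exists_bound
  -- A regularised kernel: continuous, bounded by 1/δ, and equal to 1/w for |w| ≥ δ. The regularised
  -- transforms are continuous by domination and converge uniformly at rate δ^(r-1).
  set k : ℝ → ℂ → ℂ := fun δ w => (starRingEnd ℂ) w / ((max ‖w‖ δ : ℝ) : ℂ) ^ 2 with hk
  have hkc : ∀ δ > 0, Continuous (k δ) := by
    intro δ hδ
    refine Complex.continuous_conj.div (by fun_prop) fun w => ?_
    have : 0 < max ‖w‖ δ := lt_max_of_lt_right hδ
    exact pow_ne_zero 2 (by exact_mod_cast this.ne')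
  have hkb : ∀ δ > 0, ∀ w, ‖k δ w‖ ≤ δ⁻¹ := by
    intro δ hδ w
    have h1 : 0 < max ‖w‖ δ := lt_max_of_lt_right hδ
    simp only [hk, norm_div, norm_pow, Complex.norm_real, RCLike.norm_conj]
    rw [Real.norm_of_nonneg h1.le, div_le_iff₀ (by positivity), inv_mul_eq_div, le_div_iff₀ hδ, sq]
    exact mul_le_mul (le_max_left _ _) (le_max_right _ _) hδ.le h1.le
  have hkeq : ∀ δ > 0, ∀ w, δ ≤ ‖w‖ → k δ w = w⁻¹ := by
    intro δ hδ w hw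
    simp only [hk, max_eq_left hw]
    rw [Complex.inv_def, Complex.normSq_eq_norm_sq]
    push_cast
    rfl
  have hkd : ∀ δ > 0, ∀ w, ‖w⁻¹ - k δ w‖ ≤ 2 * (δ ^ (r - 1) * ‖w‖ ^ (-r)) := by
    intro δ hδ w
    by_cases hw : δ ≤ ‖w‖
    · rw [hkeq δ hδ w hw, sub_self, norm_zero]
      positivity
    · rcases eq_or_ne w 0 with rfl | hw0
      · simp [hk]; positivity
      have hw' := not_le.1 hw
      have hwp : 0 < ‖w‖ := norm_pos_iff.2 hw0
      have h1 : ‖k δ w‖ ≤ ‖w‖⁻¹ := by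
        simp only [hk, max_eq_right hw'.le, norm_div, norm_pow, Complex.norm_real,
          RCLike.norm_conj, Real.norm_of_nonneg hδ.le]
        rw [div_le_iff₀ (by positivity), inv_mul_eq_div, le_div_iff₀ hwp, sq]
        exact mul_le_mul hw'.le hw'.le hwp.le hδ.le
      have h2 : ‖w‖⁻¹ ≤ δ ^ (r - 1) * ‖w‖ ^ (-r) := by
        have h3 : ‖w‖⁻¹ = ‖w‖ ^ (r - 1) * ‖w‖ ^ (-r) := by
          rw [← Real.rpow_add hwp, ← Real.rpow_neg_one]
          ring_nf
        rw [h3]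
        gcongr
      calc ‖w⁻¹ - k δ w‖ ≤ ‖w⁻¹‖ + ‖k δ w‖ := norm_sub_le _ _
        _ ≤ 2 * (δ ^ (r - 1) * ‖w‖ ^ (-r)) := by rw [norm_inv]; linarith
  have hint : ∀ δ > 0, ∀ z, Integrable fun ζ => F ζ * k δ (ζ - z) := fun δ hδ z =>
    hFi.mul_bdd ((hkc δ hδ).comp (continuous_id.sub continuous_const)).aestronglyMeasurable
      (Eventually.of_forall fun ζ => hkb δ hδ _)
  have hcont : ∀ δ > 0, Continuous fun z => ∫ ζ, F ζ * k δ (ζ - z) := by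
    intro δ hδ
    refine continuous_of_dominated (bound := fun ζ => ‖F ζ‖ * δ⁻¹) (fun z => (hint δ hδ z).1)
      (fun z => Eventually.of_forall fun ζ => ?_) (hFi.norm.mul_const _)
      (Eventually.of_forall fun ζ => ?_)
    · rw [norm_mul]
      exact mul_le_mul_of_nonneg_left (hkb δ hδ _) (norm_nonneg _)
    · exact continuous_const.mul ((hkc δ hδ).comp (continuous_const.sub continuous_id))
  have hdiff : ∀ δ > 0, ∀ z, ‖(∫ ζ, F ζ / (ζ - z)) - ∫ ζ, F ζ * k δ (ζ - z)‖ ≤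
      2 * δ ^ (r - 1) * M := by
    intro δ hδ z
    rw [← integral_sub (hM' z).1 (hint δ hδ z)]
    have hI := (integrable_indicator_iff hD).2 (hM z).1
    calc _ ≤ ∫ ζ, ‖F ζ / (ζ - z) - F ζ * k δ (ζ - z)‖ := norm_integral_le_integral_norm _
      _ ≤ ∫ ζ, 2 * δ ^ (r - 1) * D.indicator (fun ζ => ‖f ζ‖ * ‖ζ - z‖ ^ (-r)) ζ := by
          refine integral_mono ((hM' z).1.sub (hint δ hδ z)).norm (hI.const_mul _) fun ζ => ?_
          have h1 : F ζ / (ζ - z) - F ζ * k δ (ζ - z) = F ζ * ((ζ - z)⁻¹ - k δ (ζ - z)) := by ring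
          simp only [h1, norm_mul]
          by_cases hζ : ζ ∈ D
          · simp only [hF, indicator_of_mem hζ]
            calc _ ≤ ‖f ζ‖ * (2 * (δ ^ (r - 1) * ‖ζ - z‖ ^ (-r))) :=
                  mul_le_mul_of_nonneg_left (hkd δ hδ _) (norm_nonneg _)
              _ = _ := by ring
          · simp [hF, hζ]
      _ ≤ _ := by
          rw [integral_const_mul, integral_indicator hD]
          exact mul_le_mul_of_nonneg_left (hM z).2 (by positivity)
  have hlim : TendstoUniformly (fun δ z => ∫ ζ, F ζ * k δ (ζ - z))
      (fun z => ∫ ζ, F ζ / (ζ - z)) (𝓝[>] (0 : ℝ)) := by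
    rw [Metric.tendstoUniformly_iff]
    intro ε hε
    have ht : Tendsto (fun δ : ℝ => 2 * δ ^ (r - 1) * M) (𝓝[>] 0) (𝓝 0) := by
      have h1 : Tendsto (fun δ : ℝ => δ ^ (r - 1)) (𝓝 0) (𝓝 (0 ^ (r - 1))) :=
        (Real.continuousAt_rpow_const 0 (r - 1) (Or.inr (by linarith))).tendsto
      rw [Real.zero_rpow (by linarith)] at h1
      simpa using ((h1.const_mul 2).mul_const M).mono_left nhdsWithin_le_nhds
    filter_upwards [ht.eventually (gt_mem_nhds hε), self_mem_nhdsWithin] with δ h1 h2 z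
    rw [dist_eq_norm]
    exact (hdiff δ h2 z).trans_lt h1
  refine continuous_const.mul (hlim.continuous (Eventually.frequently ?_))
  filter_upwards [self_mem_nhdsWithin] with δ h2 using hcont δ h2

/-- The Cauchy transform is holomorphic on a ball which carries no density. -/
theorem differentiableOn_cauchyTransform {m : ℂ → ℂ} (hm : Integrable m) {z₀ : ℂ} {r : ℝ}
    (h0 : ∀ᵐ ζ, ζ ∈ ball z₀ r → m ζ = 0) :
    DifferentiableOn ℂ (cauchyTransform m) (ball z₀ r) := by
  intro z hz
  obtain ⟨ε, hε, hεb⟩ : ∃ ε > 0, ball z (2 * ε) ⊆ ball z₀ r := by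
    obtain ⟨ε, hε, h⟩ := Metric.isOpen_iff.1 isOpen_ball z hz
    exact ⟨ε / 2, by positivity, by rwa [mul_div_cancel₀ _ two_ne_zero]⟩
  -- For almost every ζ either the density vanishes or the kernel stays bounded for all w near z,
  -- which dominates differentiation under the integral.
  have hfar : ∀ᵐ ζ, ∀ w ∈ ball z ε, m ζ = 0 ∨ ε ≤ ‖ζ - w‖ := by
    filter_upwards [h0] with ζ hζ w hw
    by_contra! h
    refine h.1 (hζ (hεb ?_))
    rw [mem_ball, dist_eq_norm] at hw ⊢
    calc ‖ζ - z‖ ≤ ‖ζ - w‖ + ‖w - z‖ := norm_sub_le_norm_sub_add_norm_sub _ _ _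
      _ < 2 * ε := by linarith [h.2]
  have hmeas : ∀ w : ℂ, AEStronglyMeasurable (fun ζ => m ζ / (ζ - w)) volume := fun w =>
    hm.1.div₀ (measurable_id.sub_const w).aestronglyMeasurable
  have key := hasDerivAt_integral_of_dominated_loc_of_deriv_le (μ := volume) (𝕜 := ℂ)
    (F := fun w ζ => m ζ / (ζ - w)) (F' := fun w ζ => m ζ / (ζ - w) ^ 2) (x₀ := z)
    (s := ball z ε) (bound := fun ζ => ‖m ζ‖ * (ε ^ 2)⁻¹) (ball_mem_nhds z hε)
    (Eventually.of_forall hmeas) ?_ ?_ ?_ (hm.norm.mul_const _) ?_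
  · exact (key.2.const_mul _).differentiableAt.differentiableWithinAt
  · refine Integrable.mono' (hm.norm.mul_const ε⁻¹) (hmeas z) ?_
    filter_upwards [hfar] with ζ hζ
    rcases hζ z (mem_ball_self hε) with h | h
    · simp [h]
    · rw [norm_div, div_eq_mul_inv]
      gcongr
  · exact hm.1.div₀ ((measurable_id.sub_const z).pow_const 2).aestronglyMeasurable
  · filter_upwards [hfar] with ζ hζ w hw
    rcases hζ w hw with h | h
    · simp [h]
    · rw [norm_div, div_eq_mul_inv, norm_pow]
      gcongr
  · filter_upwards [hfar] with ζ hζ w hw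
    rcases hζ w hw with h | h
    · simpa [h] using hasDerivAt_const w (0 : ℂ)
    · have hne : ζ - w ≠ 0 := norm_pos_iff.1 (hε.trans_le h)
      have h1 : HasDerivAt (fun w : ℂ => ζ - w) (-1) w := by
        simpa using (hasDerivAt_id w).const_sub ζ
      have h2 := (h1.inv hne).const_mul (m ζ)
      convert! h2 using 1
      field_simp

/-! ### Product formula and exponential of a Cauchy transform -/

theorem BoundedPotential.integrable_div_sub {f : ℂ → ℂ} (hf : BoundedPotential f) (z : ℂ) :
    Integrable fun ζ => f ζ / (ζ - z) :=
  let ⟨_, hM⟩ := hf.exists_bound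
  (hM z).1

theorem integral_div_sub_eq (f : ℂ → ℂ) (z : ℂ) :
    ∫ ζ, f ζ / (ζ - z) = -Real.pi * cauchyTransform f z := by
  have : (Real.pi : ℂ) ≠ 0 := by exact_mod_cast Real.pi_ne_zero
  rw [cauchyTransform]
  field_simp

theorem ae_ne (z : ℂ) : ∀ᵐ ζ : ℂ, ζ ≠ z := by
  simp [ae_iff]

/-- `T f · T μ = T (f · T μ) + T (μ · T f)`, with the integrability it needs. -/
theorem cauchyTransform_mul_aux {f μ : ℂ → ℂ} (hf : BoundedPotential f) {z : ℂ}
    (hz : Integrable fun ζ => μ ζ / (ζ - z)) :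
    Integrable (fun ζ => f ζ * cauchyTransform μ ζ / (ζ - z)) ∧
    Integrable (fun ζ => μ ζ * cauchyTransform f ζ / (ζ - z)) ∧
    cauchyTransform f z * cauchyTransform μ z =
      cauchyTransform (fun ζ => f ζ * cauchyTransform μ ζ) z +
      cauchyTransform (fun ζ => μ ζ * cauchyTransform f ζ) z := by
  have hpi : (Real.pi : ℂ) ≠ 0 := by exact_mod_cast Real.pi_ne_zero
  have hF := hz.mul_prod (hf.integrable_div_sub z)
  have hF2 := hf.integrable_prod hz
  -- The kernel f(ζ) μ(η) / ((ζ - z)(η - ζ)) is not controlled directly, μ being subject only to an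
  -- integrability condition; its integrability comes from being almost everywhere a difference of
  -- two integrable kernels.
  have hF1 := hF.sub hF2
  have hI2 : ∀ η, ∫ ζ, μ η / (η - z) * (f ζ / (ζ - η)) =
      -Real.pi * (μ η * cauchyTransform f η / (η - z)) := fun η => by
    rw [integral_const_mul, integral_div_sub_eq]; ring
  have hi2 : Integrable fun ζ => μ ζ * cauchyTransform f ζ / (ζ - z) := by
    have := hF2.integral_prod_left
    simp only [hI2] at this
    refine (this.const_mul (-(Real.pi : ℂ))⁻¹).congr (Eventually.of_forall fun ζ => ?_)
    simp only
    field_simp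
  have hI1 : ∀ᵐ ζ, ∫ η, (μ η / (η - z) * (f ζ / (ζ - z)) - μ η / (η - z) * (f ζ / (ζ - η))) =
      -Real.pi * (f ζ * cauchyTransform μ ζ / (ζ - z)) := by
    filter_upwards [ae_ne z] with ζ hζ
    -- Partial fractions: 1/((η-z)(ζ-z)) - 1/((η-z)(ζ-η)) = 1/((ζ-z)(η-ζ)), off the diagonal and
    -- away from z.
    have h1 : ∫ η, (μ η / (η - z) * (f ζ / (ζ - z)) - μ η / (η - z) * (f ζ / (ζ - η))) =
        ∫ η, f ζ / (ζ - z) * (μ η / (η - ζ)) := by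
      refine integral_congr_ae ?_
      filter_upwards [ae_ne z, ae_ne ζ] with η h2 h3
      have e1 := sub_ne_zero.2 hζ
      have e2 := sub_ne_zero.2 h2
      have e3 := sub_ne_zero.2 h3
      have e4 := sub_ne_zero.2 h3.symm
      field_simp
      ring
    rw [h1, integral_const_mul, integral_div_sub_eq]
    ring
  have hi1 : Integrable fun ζ => f ζ * cauchyTransform μ ζ / (ζ - z) := by
    have h2 := (hF1.integral_prod_right.congr hI1).const_mul (-(Real.pi : ℂ))⁻¹
    refine h2.congr (Eventually.of_forall fun ζ => ?_)
    simp only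
    field_simp
  refine ⟨hi1, hi2, ?_⟩
  have e1 : ∫ p, (μ p.1 / (p.1 - z) * (f p.2 / (p.2 - z)) -
      μ p.1 / (p.1 - z) * (f p.2 / (p.2 - p.1))) ∂(volume.prod volume) =
      -Real.pi * ∫ ζ, f ζ * cauchyTransform μ ζ / (ζ - z) := by
    rw [← integral_const_mul, ← integral_congr_ae hI1]
    exact integral_prod_symm _ hF1
  have e2 : ∫ p, μ p.1 / (p.1 - z) * (f p.2 / (p.2 - p.1)) ∂(volume.prod volume) =
      -Real.pi * ∫ ζ, μ ζ * cauchyTransform f ζ / (ζ - z) := by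
    rw [← integral_const_mul]
    simp only [← hI2]
    exact integral_prod _ hF2
  have e3 : ∫ p, μ p.1 / (p.1 - z) * (f p.2 / (p.2 - z)) ∂(volume.prod volume) =
      (∫ ζ, μ ζ / (ζ - z)) * ∫ ζ, f ζ / (ζ - z) :=
    integral_prod_mul (fun η => μ η / (η - z)) fun ζ => f ζ / (ζ - z)
  rw [integral_sub hF hF2, e2, e3] at e1
  simp only [integral_div_sub_eq] at e1
  have h4 : (Real.pi : ℂ) ^ 2 * (cauchyTransform f z * cauchyTransform μ z) =
      Real.pi ^ 2 * (cauchyTransform (fun ζ => f ζ * cauchyTransform μ ζ) z +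
      cauchyTransform (fun ζ => μ ζ * cauchyTransform f ζ) z) := by
    linear_combination e1
  exact mul_left_cancel₀ (pow_ne_zero 2 hpi) h4

theorem cauchyTransform_add {f g : ℂ → ℂ} {z : ℂ} (hf : Integrable fun ζ => f ζ / (ζ - z))
    (hg : Integrable fun ζ => g ζ / (ζ - z)) :
    cauchyTransform (fun ζ => f ζ + g ζ) z = cauchyTransform f z + cauchyTransform g z := by
  simp only [cauchyTransform, add_div]
  rw [integral_add hf hg]
  ring

theorem cauchyTransform_const_mul (c : ℂ) (f : ℂ → ℂ) (z : ℂ) :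
    cauchyTransform (fun ζ => c * f ζ) z = c * cauchyTransform f z := by
  simp only [cauchyTransform, mul_div_assoc]
  rw [integral_const_mul]
  ring

theorem cauchyTransform_congr_ae {f g : ℂ → ℂ} (h : f =ᵐ[volume] g) (z : ℂ) :
    cauchyTransform f z = cauchyTransform g z := by
  simp only [cauchyTransform]
  rw [integral_congr_ae]
  filter_upwards [h] with ζ hζ
  rw [hζ]

theorem BoundedPotential.mul_cauchyTransform_pow {f : ℂ → ℂ} (hf : BoundedPotential f) (n : ℕ) :
    BoundedPotential fun z => f z * cauchyTransform f z ^ n := by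
  obtain ⟨C, hC⟩ := hf.exists_norm_cauchyTransform_le
  refine hf.mul_bounded (C := C ^ n)
    ((aestronglyMeasurable_cauchyTransform hf.1).pow n) fun z => ?_
  rw [norm_pow]
  gcongr
  exact hC z

/-- An integrated chain rule for powers of u = Tf, obtained without differentiating. In the
induction the product formula gives u · T(f uⁿ) = (1/(n+1) + 1) T(f uⁿ⁺¹). -/
theorem cauchyTransform_pow_succ {f : ℂ → ℂ} (hf : BoundedPotential f) (n : ℕ) (z : ℂ) :
    cauchyTransform f z ^ (n + 1) =
      (n + 1) * cauchyTransform (fun ζ => f ζ * cauchyTransform f ζ ^ n) z := by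
  induction n generalizing z with
  | zero => simp
  | succ n ih =>
    have h := (cauchyTransform_mul_aux hf
      ((hf.mul_cauchyTransform_pow n).integrable_div_sub z)).2.2
    have h1 : (fun ζ => f ζ * cauchyTransform (fun ζ => f ζ * cauchyTransform f ζ ^ n) ζ) =
        fun ζ => ((n : ℂ) + 1)⁻¹ * (f ζ * cauchyTransform f ζ ^ (n + 1)) := by
      ext ζ
      rw [ih ζ]
      have : (n : ℂ) + 1 ≠ 0 := by exact_mod_cast n.succ_ne_zero
      field_simp
    have h2 : (fun ζ => f ζ * cauchyTransform f ζ ^ n * cauchyTransform f ζ) =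
        fun ζ => f ζ * cauchyTransform f ζ ^ (n + 1) := by
      ext ζ; ring
    rw [h1, h2, cauchyTransform_const_mul] at h
    rw [pow_succ, ih z]
    have : (n : ℂ) + 1 ≠ 0 := by exact_mod_cast n.succ_ne_zero
    push_cast
    have h3 : ((n : ℂ) + 1) * (cauchyTransform f z *
        cauchyTransform (fun ζ => f ζ * cauchyTransform f ζ ^ n) z) =
        (n + 1 + 1) * cauchyTransform (fun ζ => f ζ * cauchyTransform f ζ ^ (n + 1)) z := by
      rw [h]
      field_simp
      ring
    linear_combination h3

theorem BoundedPotential.mul_exp {f g : ℂ → ℂ} (hf : BoundedPotential f)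
    (hg : BoundedPotential g) :
    BoundedPotential fun z => f z * Complex.exp (cauchyTransform g z) := by
  obtain ⟨C, hC⟩ := hg.exists_norm_cauchyTransform_le
  refine hf.mul_bounded (C := Real.exp C)
    (Complex.continuous_exp.comp_aestronglyMeasurable
      (aestronglyMeasurable_cauchyTransform hg.1)) fun z => ?_
  rw [Complex.norm_exp]
  exact Real.exp_le_exp.2 ((Complex.re_le_norm _).trans (hC z))

/-- `exp (T f) = 1 + T (f exp (T f))`. -/
theorem exp_cauchyTransform {f : ℂ → ℂ} (hf : BoundedPotential f) (z : ℂ) :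
    Complex.exp (cauchyTransform f z) =
      1 + cauchyTransform (fun ζ => f ζ * Complex.exp (cauchyTransform f ζ)) z := by
  obtain ⟨C, hC⟩ := hf.exists_norm_cauchyTransform_le
  obtain ⟨M, hM⟩ := hf.exists_bound
  have hC0 : 0 ≤ C := (norm_nonneg _).trans (hC 0)
  -- Terms of the exponential series under the integral; their L¹ norms are at most M Cⁿ/n!, so sum
  -- and integral commute.
  set F : ℕ → ℂ → ℂ := fun n ζ => (f ζ * cauchyTransform f ζ ^ n / n.factorial) / (ζ - z) with hF
  have hFi : ∀ n, Integrable (F n) := fun n =>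
    (((hf.mul_cauchyTransform_pow n).integrable_div_sub z).div_const (n.factorial : ℂ)).congr
      (Eventually.of_forall fun ζ => by simp only [hF]; ring)
  have hFn : ∀ n, ∫ ζ, ‖F n ζ‖ ≤ M * (C ^ n / n.factorial) := by
    intro n
    calc ∫ ζ, ‖F n ζ‖ ≤ ∫ ζ, ‖f ζ / (ζ - z)‖ * (C ^ n / n.factorial) := by
          refine integral_mono (hFi n).norm ((hM z).1.norm.mul_const _) fun ζ => ?_
          have h1 : F n ζ = f ζ / (ζ - z) * (cauchyTransform f ζ ^ n / n.factorial) := by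
            simp only [hF]; ring
          simp only [h1]
          rw [norm_mul, norm_div (_ ^ n), norm_pow, Complex.norm_natCast]
          gcongr
          exact hC ζ
      _ ≤ _ := by
          rw [integral_mul_const]
          gcongr
          exact (hM z).2
  have hsum : Summable fun n => ∫ ζ, ‖F n ζ‖ :=
    Summable.of_nonneg_of_le (fun n => integral_nonneg fun ζ => norm_nonneg _) hFn
      ((Real.summable_pow_div_factorial C).mul_left M)
  have h1 := hasSum_integral_of_summable_integral_norm hFi hsum
  have h2 : ∀ ζ, ∑' n, F n ζ = f ζ * Complex.exp (cauchyTransform f ζ) / (ζ - z) := by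
    intro ζ
    have h3 : HasSum (fun n : ℕ => cauchyTransform f ζ ^ n / n.factorial)
        (Complex.exp (cauchyTransform f ζ)) := by
      rw [Complex.exp_eq_exp_ℂ]
      exact NormedSpace.expSeries_div_hasSum_exp _
    have h4 := (h3.mul_left (f ζ / (ζ - z))).tsum_eq
    rw [mul_div_right_comm, ← h4]
    congr 1 with n
    simp only [hF]
    ring
  simp only [h2] at h1
  have h5 : ∀ n : ℕ, -(1 / (Real.pi : ℂ)) * ∫ ζ, F n ζ =
      cauchyTransform f z ^ (n + 1) / (n + 1).factorial := by
    intro n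
    have h6 : ∫ ζ, F n ζ = (n.factorial : ℂ)⁻¹ *
        ∫ ζ, f ζ * cauchyTransform f ζ ^ n / (ζ - z) := by
      rw [← integral_const_mul]
      congr 1 with ζ
      simp only [hF]
      ring
    have h7 : (n : ℂ) + 1 ≠ 0 := by exact_mod_cast n.succ_ne_zero
    have h8 : (n.factorial : ℂ) ≠ 0 := by exact_mod_cast n.factorial_ne_zero
    rw [h6, cauchyTransform_pow_succ hf, Nat.factorial_succ, cauchyTransform]
    push_cast
    field_simp
  have h9 := h1.mul_left (-(1 / (Real.pi : ℂ)))
  simp only [h5] at h9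
  have h10 : HasSum (fun n : ℕ => cauchyTransform f z ^ n / n.factorial)
      (Complex.exp (cauchyTransform f z)) := by
    rw [Complex.exp_eq_exp_ℂ]
    exact NormedSpace.expSeries_div_hasSum_exp _
  -- Integration raises each power by one, so the resulting series lacks the constant term; this is
  -- the 1 in the formula.
  have h11 := (hasSum_nat_add_iff' 1).2 h10
  have h12 := h9.unique h11
  simp only [Finset.range_one, Finset.sum_singleton, pow_zero, Nat.factorial_zero, Nat.cast_one,
    div_one] at h12
  have h13 : cauchyTransform (fun ζ => f ζ * Complex.exp (cauchyTransform f ζ)) z =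
      Complex.exp (cauchyTransform f z) - 1 := h12
  rw [h13]
  ring

/-- With `E = exp (-T A)`: `E · T μ = T (μ E - A E T μ)` almost everywhere. -/
theorem exp_mul_cauchyTransform {A μ : ℂ → ℂ} (hA : BoundedPotential A) (hμ : Integrable μ) :
    ∀ᵐ z, Complex.exp (-cauchyTransform A z) * cauchyTransform μ z =
      cauchyTransform (fun ζ => Complex.exp (-cauchyTransform A ζ) *
        (μ ζ - A ζ * cauchyTransform μ ζ)) z := by
  have hA' : BoundedPotential fun z => (-1 : ℂ) * A z := by
    have := hA.mul_bounded (g := fun _ => -1) aestronglyMeasurable_const (C := 1) (by simp)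
    simpa using this
  have hT : ∀ ζ, cauchyTransform (fun z => (-1 : ℂ) * A z) ζ = -cauchyTransform A ζ := fun ζ => by
    rw [cauchyTransform_const_mul]; ring
  have hf := hA'.mul_exp hA'
  have hexp := exp_cauchyTransform hA'
  simp only [hT] at hf hexp
  filter_upwards [Integrable.ae_integrable_div_sub hμ] with z hz
  obtain ⟨h1, h2, h3⟩ := cauchyTransform_mul_aux hf hz
  -- With E = 1 + TF and F = -A E, the product formula gives E Tμ = Tμ + T(F Tμ) + T(μ TF), and μ (1
  -- + TF) is again μ E.
  rw [hexp z, add_mul, one_mul, h3]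
  rw [add_left_comm, ← cauchyTransform_add hz h2, ← cauchyTransform_add h1]
  · congr 1 with ζ
    rw [hexp ζ]
    rw [← hexp ζ]
    have h4 := hexp ζ
    linear_combination (-μ ζ) * h4
  · exact (hz.add h2).congr (Eventually.of_forall fun ζ => by simp only [Pi.add_apply]; ring)

/-! ### Calculus of the Cauchy-Riemann operator on smooth functions -/

theorem ContDiff.dbar_smooth {f : ℂ → ℂ} (hf : ContDiff ℝ ∞ f) : ContDiff ℝ ∞ (dbar f) := by
  have h : ContDiff ℝ ∞ (fderiv ℝ f) := hf.fderiv_right (by simp)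
  unfold dbar
  exact contDiff_const.mul ((h.clm_apply contDiff_const).add
    (contDiff_const.mul (h.clm_apply contDiff_const)))

theorem dbar_mul {f g : ℂ → ℂ} {z : ℂ} (hf : DifferentiableAt ℝ f z)
    (hg : DifferentiableAt ℝ g z) :
    dbar (fun z => f z * g z) z = f z * dbar g z + dbar f z * g z := by
  simp only [dbar]
  rw [fderiv_fun_mul hf hg]
  simp only [add_apply, smul_apply, smul_eq_mul]
  ring

theorem dbar_eq_zero_of_differentiableAt {f : ℂ → ℂ} {z : ℂ} (hf : DifferentiableAt ℂ f z) :
    dbar f z = 0 := by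
  rw [dbar, hf.fderiv_restrictScalars ℝ]
  have h : fderiv ℂ f z Complex.I = Complex.I * fderiv ℂ f z 1 := by
    rw [← smul_eq_mul, ← map_smul]; simp
  simp only [ContinuousLinearMap.coe_restrictScalars', h]
  linear_combination (1 / 2) * fderiv ℂ f z 1 * Complex.I_sq

theorem dbar_conj (z : ℂ) : dbar (starRingEnd ℂ) z = 1 := by
  have h : fderiv ℝ (starRingEnd ℂ) z = Complex.conjCLE.toContinuousLinearMap :=
    Complex.conjCLE.toContinuousLinearMap.fderiv
  simp only [dbar, h]
  simp
  norm_num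

/-- The Cauchy-Pompeiu formula: `T (∂̄ ψ) = ψ` for compactly supported `ψ`. -/
theorem cauchyTransform_dbar {ψ : ℂ → ℂ} (hψ : ContDiff ℝ 1 ψ) (hc : HasCompactSupport ψ) :
    cauchyTransform (dbar ψ) = ψ := by
  ext z
  have h1 : ∀ t, dbar (fun t => ψ (t + z)) t = dbar ψ (t + z) := fun t => by
    simp only [dbar, fderiv_comp_add_right]
  have h2 := integral_dbar_div (ψ := fun t => ψ (t + z))
    (hψ.comp (contDiff_id.add contDiff_const)) (hc.comp_homeomorph (Homeomorph.addRight z))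
  simp only [h1, zero_add] at h2
  rw [cauchyTransform, ← integral_add_right_eq_self _ z]
  simp only [add_sub_cancel_right]
  rw [h2]
  have : (Real.pi : ℂ) ≠ 0 := by exact_mod_cast Real.pi_ne_zero
  field_simp

theorem locallyIntegrable_inv : LocallyIntegrable fun t : ℂ => t⁻¹ := by
  refine locallyIntegrable_of_norm_le_rpow (C := 1) (α := 1) (by simp) (by simp) ?_
    measurable_inv.aestronglyMeasurable
  refine Eventually.of_forall fun t => ?_
  rw [Real.rpow_neg_one, norm_inv, one_mul]

theorem cauchyTransform_eq_convolution (ψ : ℂ → ℂ) :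
    cauchyTransform ψ = fun z => (1 / (Real.pi : ℂ)) *
      (convolution (fun t : ℂ => t⁻¹) ψ (ContinuousLinearMap.mul ℝ ℂ) volume) z := by
  ext z
  rw [cauchyTransform, convolution_def, ← integral_sub_left_eq_self _ _ z]
  simp only [ContinuousLinearMap.mul_apply']
  rw [neg_mul, ← mul_neg, ← integral_neg]
  congr 2 with t
  rw [sub_sub_cancel_left, div_neg, neg_neg]
  ring

/-- The Cauchy transform of a test function is smooth and solves `∂̄ u = ψ`. -/
theorem contDiff_cauchyTransform {ψ : ℂ → ℂ} (hψ : ContDiff ℝ ∞ ψ) (hc : HasCompactSupport ψ) :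
    ContDiff ℝ ∞ (cauchyTransform ψ) := by
  rw [cauchyTransform_eq_convolution]
  exact contDiff_const.mul (hc.contDiff_convolution_right _ locallyIntegrable_inv hψ)

/-- T is convolution with 1/(πt), so the derivatives can be put on ψ; the Cauchy-Pompeiu formula at
the origin for t ↦ ψ(z - t) then evaluates the integral. -/
theorem dbar_cauchyTransform {ψ : ℂ → ℂ} (hψ : ContDiff ℝ 1 ψ) (hc : HasCompactSupport ψ)
    (z : ℂ) : dbar (cauchyTransform ψ) z = ψ z := by
  have hd := (hc.hasFDerivAt_convolution_right (ContinuousLinearMap.mul ℝ ℂ)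
    locallyIntegrable_inv hψ z).const_mul (1 / (Real.pi : ℂ))
  have hint : ∀ v : ℂ, Integrable fun t => t⁻¹ * fderiv ℝ ψ (z - t) v := by
    intro v
    have hcv : HasCompactSupport fun x => fderiv ℝ ψ x v := (hc.fderiv (𝕜 := ℝ)).mono fun x hx => by
      contrapose! hx
      simp only [Function.mem_support, not_not] at hx
      simp [hx]
    exact hcv.convolutionExists_right (ContinuousLinearMap.mul ℝ ℂ) locallyIntegrable_inv
      ((hψ.continuous_fderiv one_ne_zero).clm_apply continuous_const) z
  have hv : ∀ v : ℂ, fderiv ℝ (cauchyTransform ψ) z v =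
      (1 / (Real.pi : ℂ)) * ∫ t, t⁻¹ * fderiv ℝ ψ (z - t) v := by
    intro v
    rw [cauchyTransform_eq_convolution, hd.fderiv]
    rw [smul_apply, convolution_precompR_apply _ locallyIntegrable_inv
      (hc.fderiv (𝕜 := ℝ)) (hψ.continuous_fderiv one_ne_zero)]
    rfl
  have h1 : ∀ t, dbar (fun t => ψ (z - t)) t = -dbar ψ (z - t) := fun t => by
    simp only [dbar]
    have h2 : ∀ v, fderiv ℝ (fun t => ψ (z - t)) t v = -fderiv ℝ ψ (z - t) v := fun v => by
      have h3 := ((hψ.differentiable one_ne_zero (z - t)).hasFDerivAt).comp t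
        ((hasFDerivAt_id (𝕜 := ℝ) t).const_sub z)
      have h4 := h3.fderiv
      simp only [Function.comp_def] at h4
      rw [h4]
      simp
    rw [h2, h2]
    ring
  have h2 := integral_dbar_div (ψ := fun t => ψ (z - t))
    (hψ.comp (contDiff_const.sub contDiff_id)) (hc.comp_homeomorph (Homeomorph.subLeft z))
  simp only [h1, sub_zero] at h2
  have h3 : ∫ t, -dbar ψ (z - t) / t = -(1 / 2) * ((∫ t, t⁻¹ * fderiv ℝ ψ (z - t) 1) +
      Complex.I * ∫ t, t⁻¹ * fderiv ℝ ψ (z - t) Complex.I) := by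
    rw [← integral_const_mul, ← integral_add (hint 1) ((hint _).const_mul _),
      ← integral_const_mul]
    congr 1 with t
    simp only [dbar]
    ring
  have : (Real.pi : ℂ) ≠ 0 := by exact_mod_cast Real.pi_ne_zero
  rw [h3] at h2
  rw [dbar, hv, hv]
  generalize ∫ t, t⁻¹ * fderiv ℝ ψ (z - t) 1 = a at h2 ⊢
  generalize ∫ t, t⁻¹ * fderiv ℝ ψ (z - t) Complex.I = b at h2 ⊢
  field_simp
  linear_combination (-2) * h2

theorem integral_dbar_eq_zero {ψ : ℂ → ℂ} (hψ : ContDiff ℝ 1 ψ) (hc : HasCompactSupport ψ) :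
    ∫ z, dbar ψ z = 0 := by
  have hint : ∀ v : ℂ, Integrable fun z => fderiv ℝ ψ z v := by
    intro v
    have hcv : HasCompactSupport fun x => fderiv ℝ ψ x v := (hc.fderiv (𝕜 := ℝ)).mono fun x hx => by
      contrapose! hx
      simp only [Function.mem_support, not_not] at hx
      simp [hx]
    exact ((hψ.continuous_fderiv one_ne_zero).clm_apply
      continuous_const).integrable_of_hasCompactSupport hcv
  have h0 : ∀ v : ℂ, ∫ z, fderiv ℝ ψ z v = 0 := by
    intro v
    have := integral_mul_fderiv_eq_neg_fderiv_mul_of_integrable (μ := volume) (𝕜 := ℂ)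
      (f := fun _ => (1 : ℂ)) (g := ψ) (v := v) (by simp) (by simpa using hint v)
      (by simpa using hψ.continuous.integrable_of_hasCompactSupport hc)
      (fun _ _ => differentiableAt_const _) fun x _ => hψ.differentiable one_ne_zero x
    simpa using this
  simp only [dbar]
  rw [integral_const_mul, integral_add (hint 1) ((hint _).const_mul _), integral_const_mul, h0, h0]
  simp

/-! ### Weak solutions and their holomorphic factors -/

/-- `∂̄ w = g` on `D` in the sense of distributions, for complex-valued functions. -/
def HasWeakComplexDbar (D : Set ℂ) (w g : ℂ → ℂ) : Prop :=
  LocallyIntegrableOn w D volume ∧ LocallyIntegrableOn g D volume ∧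
  ∀ φ : ℂ → ℝ, IsTestFunction D φ →
    ∫ z in D, dbar (fun z => (φ z : ℂ)) z * w z = -∫ z in D, (φ z : ℂ) * g z

theorem integrable_mul_of_tsupport_subset {D : Set ℂ}
    {w Ψ : ℂ → ℂ} (hw : LocallyIntegrableOn w D volume) (hΨ : Continuous Ψ)
    (hc : HasCompactSupport Ψ) (hs : tsupport Ψ ⊆ D) : Integrable fun z => Ψ z * w z := by
  have h1 : IntegrableOn w (tsupport Ψ) :=
    hw.integrableOn_compact_subset hs hc.isCompact
  have h2 := h1.continuousOn_mul hΨ.continuousOn hc.isCompact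
  refine (integrableOn_iff_integrable_of_support_subset ?_).1 h2
  intro z hz
  exact subset_tsupport Ψ fun h => hz (by simp [h])

theorem tsupport_dbar_subset (f : ℂ → ℂ) : tsupport (dbar f) ⊆ tsupport f := by
  refine closure_minimal (fun z hz => ?_) (isClosed_tsupport f)
  refine support_fderiv_subset ℝ fun h => hz ?_
  simp [dbar, h]

/-- The weak equation may be tested against complex-valued functions. -/
theorem HasWeakComplexDbar.integral_eq {D : Set ℂ} {w g : ℂ → ℂ}
    (h : HasWeakComplexDbar D w g) {Φ : ℂ → ℂ} (hΦ : ContDiff ℝ ∞ Φ)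
    (hc : HasCompactSupport Φ) (hs : tsupport Φ ⊆ D) :
    ∫ z, dbar Φ z * w z = -∫ z, Φ z * g z := by
  obtain ⟨hw, hg, h⟩ := h
  have key : ∀ φ : ℂ → ℝ, IsTestFunction D φ →
      (∫ z, dbar (fun z => (φ z : ℂ)) z * w z = -∫ z, (φ z : ℂ) * g z) ∧
      Integrable (fun z => dbar (fun z => (φ z : ℂ)) z * w z) ∧
      Integrable (fun z => (φ z : ℂ) * g z) := by
    intro φ hφ
    have h0 : tsupport (fun z => (φ z : ℂ)) ⊆ tsupport φ :=
      closure_mono fun z hz => by simpa using hz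
    have h1 : ContDiff ℝ ∞ fun z => (φ z : ℂ) := Complex.ofRealCLM.contDiff.comp hφ.contDiff
    have h2 : HasCompactSupport fun z => (φ z : ℂ) :=
      hφ.hasCompactSupport.of_isClosed_subset (isClosed_tsupport _) h0
    refine ⟨?_, ?_, ?_⟩
    · have h3 := h φ hφ
      rwa [setIntegral_eq_integral_of_forall_compl_eq_zero,
        setIntegral_eq_integral_of_forall_compl_eq_zero] at h3
      · intro z hz
        rw [image_eq_zero_of_notMem_tsupport fun h4 => hz (hφ.tsupport_subset h4)]
        simp
      · intro z hz
        rw [image_eq_zero_of_notMem_tsupport fun h4 =>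
          hz (hφ.tsupport_subset (h0 (tsupport_dbar_subset _ h4))), zero_mul]
    · exact integrable_mul_of_tsupport_subset hw h1.dbar_smooth.continuous
        (hasCompactSupport_dbar h2)
        ((tsupport_dbar_subset _).trans (h0.trans hφ.tsupport_subset))
    · exact integrable_mul_of_tsupport_subset hg h1.continuous h2
        (h0.trans hφ.tsupport_subset)
  have hre : IsTestFunction D fun z => (Φ z).re := by
    have h0 : tsupport (fun z => (Φ z).re) ⊆ tsupport Φ :=
      closure_mono fun z hz h => hz (by simp [h])
    exact ⟨Complex.reCLM.contDiff.comp hΦ,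
      hc.of_isClosed_subset (isClosed_tsupport _) h0, h0.trans hs⟩
  have him : IsTestFunction D fun z => (Φ z).im := by
    have h0 : tsupport (fun z => (Φ z).im) ⊆ tsupport Φ :=
      closure_mono fun z hz h => hz (by simp [h])
    exact ⟨Complex.imCLM.contDiff.comp hΦ,
      hc.of_isClosed_subset (isClosed_tsupport _) h0, h0.trans hs⟩
  obtain ⟨a1, a2, a3⟩ := key _ hre
  obtain ⟨b1, b2, b3⟩ := key _ him
  have e1 : ∀ z, dbar Φ z = dbar (fun z => ((Φ z).re : ℂ)) z +
      Complex.I * dbar (fun z => ((Φ z).im : ℂ)) z := by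
    intro z
    have hd := (hΦ.differentiable (by simp) z).hasFDerivAt
    have hr : HasFDerivAt (fun z => ((Φ z).re : ℂ))
        ((Complex.ofRealCLM.comp Complex.reCLM).comp (fderiv ℝ Φ z)) z :=
      (Complex.ofRealCLM.comp Complex.reCLM).hasFDerivAt.comp z hd
    have hi : HasFDerivAt (fun z => ((Φ z).im : ℂ))
        ((Complex.ofRealCLM.comp Complex.imCLM).comp (fderiv ℝ Φ z)) z :=
      (Complex.ofRealCLM.comp Complex.imCLM).hasFDerivAt.comp z hd
    simp only [dbar, hr.fderiv, hi.fderiv, ContinuousLinearMap.comp_apply,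
      Complex.ofRealCLM_apply, Complex.reCLM_apply, Complex.imCLM_apply]
    have c1 := Complex.re_add_im (fderiv ℝ Φ z 1)
    have c2 := Complex.re_add_im (fderiv ℝ Φ z Complex.I)
    linear_combination (-1 / 2) * c1 - (1 / 2) * Complex.I * c2
  have e2 : ∀ z, Φ z = (Φ z).re + Complex.I * (Φ z).im := fun z => by
    rw [mul_comm]; exact (Complex.re_add_im _).symm
  calc ∫ z, dbar Φ z * w z = ∫ z, (dbar (fun z => ((Φ z).re : ℂ)) z * w z +
        Complex.I * (dbar (fun z => ((Φ z).im : ℂ)) z * w z)) := by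
        congr 1 with z; rw [e1]; ring
    _ = -∫ z, ((Φ z).re * g z + Complex.I * ((Φ z).im * g z)) := by
        rw [integral_add a2 (b2.const_mul _), integral_const_mul, a1, b1,
          integral_add a3 (b3.const_mul _), integral_const_mul]
        ring
    _ = _ := by
        congr 2 with z
        nth_rewrite 3 [e2 z]
        ring

theorem ContDiff.one_of_smooth {f : ℂ → ℂ} (hf : ContDiff ℝ ∞ f) : ContDiff ℝ 1 f :=
  hf.of_le (by exact_mod_cast le_top)

theorem HasWeakComplexDbar.integrable_density {D : Set ℂ} {u h χ : ℂ → ℂ}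
    (hu : HasWeakComplexDbar D u h) (hχ : ContDiff ℝ ∞ χ) (hc : HasCompactSupport χ)
    (hs : tsupport χ ⊆ D) : Integrable fun z => dbar χ z * u z + χ z * h z :=
  (integrable_mul_of_tsupport_subset hu.1 hχ.dbar_smooth.continuous
    (hasCompactSupport_dbar hc) ((tsupport_dbar_subset χ).trans hs)).add
    (integrable_mul_of_tsupport_subset hu.2.1 hχ.continuous hc hs)

/-- Local representation of a weak solution of `∂̄ u = h` by a Cauchy transform. -/
theorem HasWeakComplexDbar.cutoff_ae_eq {D : Set ℂ} {u h χ : ℂ → ℂ}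
    (hu : HasWeakComplexDbar D u h) (hχ : ContDiff ℝ ∞ χ) (hc : HasCompactSupport χ)
    (hs : tsupport χ ⊆ D) :
    ∀ᵐ z, χ z * u z = cauchyTransform (fun z => dbar χ z * u z + χ z * h z) z := by
  have hμ := hu.integrable_density hχ hc hs
  have hi1 := integrable_mul_of_tsupport_subset hu.1 hχ.continuous hc hs
  refine ae_eq_of_integral_contDiff_smul_eq hi1.locallyIntegrable
    (Integrable.locallyIntegrable_cauchyTransform hμ) fun g hg hgc => ?_
  set ψ : ℂ → ℂ := fun z => (g z : ℂ) with hψ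
  have hψs : ContDiff ℝ ∞ ψ := Complex.ofRealCLM.contDiff.comp hg
  have hψc : HasCompactSupport ψ := hgc.mono fun z hz => by simpa [hψ] using hz
  -- The equation is tested against χ Tψ: the factor χ supplies compact support in D, and `∂̄`(χ Tψ)
  -- = χ ψ + `∂̄`χ Tψ isolates the pairing of χ u with ψ. Antisymmetry then moves T onto the
  -- density.
  have hT := contDiff_cauchyTransform hψs hψc
  have h1 : HasCompactSupport fun z => χ z * cauchyTransform ψ z := hc.mul_right
  have h2 : tsupport (fun z => χ z * cauchyTransform ψ z) ⊆ D :=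
    (tsupport_mul_subset_left).trans hs
  have key := hu.integral_eq (hχ.mul hT) h1 h2
  have h3 : ∀ z, dbar (fun z => χ z * cauchyTransform ψ z) z =
      χ z * ψ z + dbar χ z * cauchyTransform ψ z := fun z => by
    rw [dbar_mul (hχ.differentiable (by simp) z) (hT.differentiable (by simp) z),
      dbar_cauchyTransform hψs.one_of_smooth hψc]
  simp only [h3] at key
  have hsub : tsupport (fun z => χ z * ψ z) ⊆ D := (tsupport_mul_subset_left).trans hs
  have hi2 : Integrable fun z => χ z * ψ z * u z :=
    integrable_mul_of_tsupport_subset hu.1 (hχ.continuous.mul hψs.continuous)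
      hc.mul_right hsub
  have hi3 : Integrable fun z => dbar χ z * cauchyTransform ψ z * u z :=
    integrable_mul_of_tsupport_subset hu.1 (hχ.dbar_smooth.continuous.mul hT.continuous)
      (hasCompactSupport_dbar hc).mul_right
      ((tsupport_mul_subset_left).trans ((tsupport_dbar_subset χ).trans hs))
  have hi4 : Integrable fun z => χ z * cauchyTransform ψ z * h z :=
    integrable_mul_of_tsupport_subset hu.2.1 (hχ.continuous.mul hT.continuous) h1 h2
  have hanti := integral_mul_cauchyTransform
    (BoundedPotential.of_continuous hψs.continuous hψc) hμ
  calc ∫ z, g z • (χ z * u z) = ∫ z, χ z * ψ z * u z := by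
        congr 1 with z; simp only [hψ, Complex.real_smul]; ring
    _ = (∫ z, (χ z * ψ z + dbar χ z * cauchyTransform ψ z) * u z) -
          ∫ z, dbar χ z * cauchyTransform ψ z * u z := by
        simp only [add_mul]
        rw [integral_add hi2 hi3]
        ring
    _ = -∫ z, (dbar χ z * u z + χ z * h z) * cauchyTransform ψ z := by
        rw [key, ← neg_add', ← integral_add hi4 hi3]
        congr 2 with z
        ring
    _ = ∫ z, g z • cauchyTransform (fun z => dbar χ z * u z + χ z * h z) z := by
        rw [← hanti]
        simp only [hψ, Complex.real_smul]

/-- If `∂̄ u = A u + h` weakly and `E = exp (-T A)`, then `E u` is locally represented by the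
Cauchy transform of `E h` up to a density supported where the cut-off is not constant. -/
theorem HasWeakComplexDbar.exp_mul_cutoff_ae_eq {D : Set ℂ} {A u h χ : ℂ → ℂ}
    (hA : BoundedPotential A) (hu : HasWeakComplexDbar D u fun z => A z * u z + h z)
    (hχ : ContDiff ℝ ∞ χ) (hc : HasCompactSupport χ) (hs : tsupport χ ⊆ D) :
    ∀ᵐ z, χ z * (Complex.exp (-cauchyTransform A z) * u z) =
      cauchyTransform (fun ζ => Complex.exp (-cauchyTransform A ζ) *
        (dbar χ ζ * u ζ + χ ζ * h ζ)) z := by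
  have h1 := hu.cutoff_ae_eq hχ hc hs
  have h2 := exp_mul_cauchyTransform hA (hu.integrable_density hχ hc hs)
  -- For the density μ of χ u, Tμ = χ u almost everywhere, so the terms containing A cancel in μ - A
  -- Tμ.
  have h3 : (fun ζ => Complex.exp (-cauchyTransform A ζ) *
      ((dbar χ ζ * u ζ + χ ζ * (A ζ * u ζ + h ζ)) -
        A ζ * cauchyTransform (fun z => dbar χ z * u z + χ z * (A z * u z + h z)) ζ)) =ᵐ[volume]
      fun ζ => Complex.exp (-cauchyTransform A ζ) * (dbar χ ζ * u ζ + χ ζ * h ζ) := by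
    filter_upwards [h1] with ζ hζ
    rw [← hζ]
    ring
  filter_upwards [h1, h2] with z hz1 hz2
  rw [← cauchyTransform_congr_ae h3, ← hz2, ← hz1]
  ring

/-- A smooth cut-off function around a point of an open set. -/
theorem exists_cutoff {D : Set ℂ} (hD : IsOpen D) {z₀ : ℂ} (hz : z₀ ∈ D) :
    ∃ r > 0, ball z₀ r ⊆ D ∧ ∃ χ : ℂ → ℂ, ContDiff ℝ ∞ χ ∧ HasCompactSupport χ ∧
      tsupport χ ⊆ D ∧ (∀ z ∈ ball z₀ r, χ z = 1) ∧ ∀ z ∈ ball z₀ r, dbar χ z = 0 := by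
  obtain ⟨R, hR, hRD⟩ := Metric.isOpen_iff.1 hD z₀ hz
  let b : ContDiffBump z₀ := ⟨R / 4, R / 2, by positivity, by linarith⟩
  have h0 : tsupport (fun z => ((b z : ℝ) : ℂ)) ⊆ tsupport b :=
    closure_mono fun z hz => by simpa using hz
  have h1 : ∀ z ∈ ball z₀ (R / 4), ((b z : ℝ) : ℂ) = 1 := fun z hz => by
    rw [b.one_of_mem_closedBall (ball_subset_closedBall hz), Complex.ofReal_one]
  refine ⟨R / 4, by positivity, (ball_subset_ball (by linarith)).trans hRD,
    fun z => ((b z : ℝ) : ℂ), Complex.ofRealCLM.contDiff.comp b.contDiff,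
    b.hasCompactSupport.of_isClosed_subset (isClosed_tsupport _) h0, ?_, h1, ?_⟩
  · refine h0.trans ?_
    rw [b.tsupport_eq]
    exact (closedBall_subset_ball (by change R / 2 < R; linarith)).trans hRD
  · intro z hz
    have h2 : (fun z => ((b z : ℝ) : ℂ)) =ᶠ[𝓝 z] fun _ => 1 := by
      filter_upwards [isOpen_ball.mem_nhds hz] with w hw using h1 w hw
    simp [dbar, h2.fderiv_eq]

/-- Local holomorphic representatives of `u` glue to a global one. -/
theorem exists_differentiableOn_ae_eq {D : Set ℂ} {u : ℂ → ℂ}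
    (h : ∀ z₀ ∈ D, ∃ r > 0, ball z₀ r ⊆ D ∧ ∃ f : ℂ → ℂ, DifferentiableOn ℂ f (ball z₀ r) ∧
      ∀ᵐ z, z ∈ ball z₀ r → u z = f z) :
    ∃ f : ℂ → ℂ, DifferentiableOn ℂ f D ∧ ∀ᵐ z, z ∈ D → u z = f z := by
  choose! r hr hrD f hf hfu using h
  -- Continuous functions agreeing almost everywhere on an open overlap agree there, so the diagonal
  -- choice z ↦ f z z coincides near each point with a single holomorphic representative.
  have heq : ∀ z₀ ∈ D, ∀ z ∈ ball z₀ (r z₀), f z z = f z₀ z := by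
    intro z₀ hz₀ z hz
    have hzD := hrD z₀ hz₀ hz
    refine Measure.eqOn_open_of_ae_eq (μ := volume)
      (U := ball z₀ (r z₀) ∩ ball z (r z)) (f := f z) (g := f z₀) ?_
      (isOpen_ball.inter isOpen_ball)
      ((hf z hzD).continuousOn.mono inter_subset_right)
      ((hf z₀ hz₀).continuousOn.mono inter_subset_left) ⟨hz, mem_ball_self (hr z hzD)⟩
    refine (ae_restrict_iff' (isOpen_ball.inter isOpen_ball).measurableSet).2 ?_
    filter_upwards [hfu z₀ hz₀, hfu z hzD] with w h1 h2 hw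
    rw [← h1 hw.1, ← h2 hw.2]
  refine ⟨fun z => f z z, fun z hz => ?_, ?_⟩
  · have h1 : (fun z => f z z) =ᶠ[𝓝 z] f z := by
      filter_upwards [isOpen_ball.mem_nhds (mem_ball_self (hr z hz))] with w hw
        using heq z hz w hw
    exact (((hf z hz).differentiableAt (isOpen_ball.mem_nhds
      (mem_ball_self (hr z hz)))).congr_of_eventuallyEq h1).differentiableWithinAt
  · rw [ae_iff]
    refine measure_null_of_locally_null _ fun z hz => ?_
    have hzD : z ∈ D := by
      by_contra h1
      exact hz fun h2 => absurd h2 h1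
    refine ⟨_, inter_mem_nhdsWithin _ (isOpen_ball.mem_nhds (mem_ball_self (hr z hzD))), ?_⟩
    refine measure_mono_null (fun w hw => ?_) (ae_iff.1 (hfu z hzD))
    simp only [mem_inter_iff, mem_ofPred_eq] at hw ⊢
    intro h2
    exact hw.1 fun _ => (h2 hw.2).trans (heq z hzD w hw.2).symm

/-- Weak solutions of `∂̄ v = A v` are `exp (T A)` times a holomorphic function. -/
theorem HasWeakComplexDbar.exists_holomorphic {D : Set ℂ} (hD : IsOpen D) {A v : ℂ → ℂ}
    (hA : BoundedPotential A) (hv : HasWeakComplexDbar D v fun z => A z * v z) :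
    ∃ f : ℂ → ℂ, DifferentiableOn ℂ f D ∧
      ∀ᵐ z, z ∈ D → Complex.exp (-cauchyTransform A z) * v z = f z := by
  refine exists_differentiableOn_ae_eq fun z₀ hz₀ => ?_
  obtain ⟨r, hr, hrD, χ, hχ, hc, hs, h1, h2⟩ := exists_cutoff hD hz₀
  have hv' : HasWeakComplexDbar D v fun z => A z * v z + 0 := by simpa using hv
  have key := hv'.exp_mul_cutoff_ae_eq (h := fun _ => 0) hA hχ hc hs
  refine ⟨r, hr, hrD, _, differentiableOn_cauchyTransform (m := fun ζ =>
    Complex.exp (-cauchyTransform A ζ) * (dbar χ ζ * v ζ + χ ζ * 0)) ?_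
    (Eventually.of_forall fun ζ hζ => by simp [h2 ζ hζ]), ?_⟩
  · obtain ⟨C, hC⟩ := hA.exists_norm_cauchyTransform_le
    have hi := integrable_mul_of_tsupport_subset hv.1 hχ.dbar_smooth.continuous
      (hasCompactSupport_dbar hc) ((tsupport_dbar_subset χ).trans hs)
    simp only [mul_zero, add_zero]
    refine hi.bdd_mul (c := Real.exp C) ?_ (Eventually.of_forall fun z => ?_)
    · exact Complex.continuous_exp.comp_aestronglyMeasurable
        (BoundedPotential.aestronglyMeasurable_cauchyTransform hA.1).neg
    · rw [Complex.norm_exp]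
      refine Real.exp_le_exp.2 ((Complex.re_le_norm _).trans ?_)
      rw [norm_neg]
      exact hC z
  · filter_upwards [key] with z hz hzb
    rw [← hz, h1 z hzb, one_mul]

theorem contDiff_cutoff_mul {D : Set ℂ} (hD : IsOpen D) {χ F : ℂ → ℂ} (hχ : ContDiff ℝ ∞ χ)
    (hs : tsupport χ ⊆ D) (hF : ContDiffOn ℝ ∞ F D) : ContDiff ℝ ∞ fun z => χ z * F z := by
  refine contDiff_iff_contDiffAt.2 fun z => ?_
  by_cases hz : z ∈ tsupport χ
  · exact hχ.contDiffAt.mul (hF.contDiffAt (hD.mem_nhds (hs hz)))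
  · refine contDiffAt_const (c := (0 : ℂ)) |>.congr_of_eventuallyEq ?_
    filter_upwards [notMem_tsupport_iff_eventuallyEq.1 hz] with w hw
    rw [hw, Pi.zero_apply, zero_mul]

/-- A continuous weak solution of `(∂̄ - A)² w = 0` is `exp (T A)` times a bianalytic function. -/
theorem HasWeakComplexDbar.exists_bianalytic {D : Set ℂ} (hD : IsOpen D) {A v w : ℂ → ℂ}
    (hA : BoundedPotential A) (hTA : Continuous (cauchyTransform A)) (hwc : ContinuousOn w D)
    (hw : HasWeakComplexDbar D w fun z => A z * w z + v z)
    (hv : HasWeakComplexDbar D v fun z => A z * v z) :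
    ∃ f g : ℂ → ℂ, DifferentiableOn ℂ f D ∧ DifferentiableOn ℂ g D ∧
      ∀ z ∈ D, Complex.exp (-cauchyTransform A z) * w z = (starRingEnd ℂ) z * f z + g z := by
  obtain ⟨f, hf, hfv⟩ := hv.exists_holomorphic hD hA
  set E : ℂ → ℂ := fun z => Complex.exp (-cauchyTransform A z) with hE
  have hEc : Continuous E := Complex.continuous_exp.comp hTA.neg
  have hfD : ContDiffOn ℝ ∞ f D :=
    (hf.contDiffOn hD : ContDiffOn ℂ ∞ f D).restrict_scalars ℝ
  have hzf : ContDiffOn ℝ ∞ (fun z => (starRingEnd ℂ) z * f z) D :=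
    (Complex.conjCLE.contDiff.contDiffOn).mul hfD
  have hgc : ContinuousOn (fun z => E z * w z - (starRingEnd ℂ) z * f z) D :=
    (hEc.continuousOn.mul hwc).sub hzf.continuousOn
  refine ⟨f, fun z => E z * w z - (starRingEnd ℂ) z * f z, hf, fun z₀ hz₀ => ?_,
    fun z _ => by ring⟩
  obtain ⟨r, hr, hrD, χ, hχ, hc, hs, h1, h2⟩ := exists_cutoff hD hz₀
  have key := hw.exp_mul_cutoff_ae_eq hA hχ hc hs
  have hχzf := contDiff_cutoff_mul hD hχ hs hzf
  have hχf := contDiff_cutoff_mul hD hχ hs hfD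
  have hCP := cauchyTransform_dbar hχzf.one_of_smooth hc.mul_right
  have hdz : ∀ z, dbar (fun z => χ z * ((starRingEnd ℂ) z * f z)) z =
      dbar χ z * ((starRingEnd ℂ) z * f z) + χ z * f z := by
    intro z
    by_cases hz : z ∈ D
    · have hfz := (hf.differentiableAt (hD.mem_nhds hz))
      have hfr := hfz.restrictScalars ℝ
      have hcd : DifferentiableAt ℝ (starRingEnd ℂ) z := Complex.conjCLE.differentiableAt
      rw [dbar_mul (g := fun z => (starRingEnd ℂ) z * f z) (hχ.differentiable (by simp) z)
        (hcd.mul hfr), dbar_mul hcd hfr,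
        dbar_eq_zero_of_differentiableAt hfz]
      have := dbar_conj z
      simp only [this, mul_zero, zero_add, one_mul]
      ring
    · have hz1 : z ∉ tsupport χ := fun h => hz (hs h)
      have hz2 : z ∉ tsupport (dbar fun z => χ z * ((starRingEnd ℂ) z * f z)) := fun h =>
        hz1 (tsupport_mul_subset_left (tsupport_dbar_subset _ h))
      rw [image_eq_zero_of_notMem_tsupport hz2, image_eq_zero_of_notMem_tsupport hz1,
        image_eq_zero_of_notMem_tsupport fun h => hz1 (tsupport_dbar_subset _ h)]
      ring
  -- Since E v = f almost everywhere on D, the density of χ E w is m + `∂̄`(χ z̄ f), and T sends the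
  -- second summand to χ z̄ f. What remains is Tm, holomorphic near z₀ because `∂̄` χ vanishes
  -- there.
  set m : ℂ → ℂ := fun ζ => dbar χ ζ * (E ζ * w ζ - (starRingEnd ℂ) ζ * f ζ) with hm
  have hmi : Integrable m :=
    integrable_mul_of_tsupport_subset (hgc.locallyIntegrableOn hD.measurableSet)
      hχ.dbar_smooth.continuous
      (hasCompactSupport_dbar hc) ((tsupport_dbar_subset χ).trans hs)
  have h3 : (fun ζ => E ζ * (dbar χ ζ * w ζ + χ ζ * v ζ)) =ᵐ[volume]
      fun ζ => m ζ + dbar (fun z => χ z * ((starRingEnd ℂ) z * f z)) ζ := by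
    filter_upwards [hfv] with ζ hζ
    rw [hdz]
    by_cases hζD : ζ ∈ D
    · rw [← hζ hζD]
      simp only [hm, hE]
      rw [← hζ hζD]
      ring
    · have hz1 : ζ ∉ tsupport χ := fun h => hζD (hs h)
      simp only [hm]
      rw [image_eq_zero_of_notMem_tsupport hz1,
        image_eq_zero_of_notMem_tsupport fun h => hz1 (tsupport_dbar_subset _ h)]
      ring
  have hdc : BoundedPotential (dbar fun z => χ z * ((starRingEnd ℂ) z * f z)) :=
    .of_continuous hχzf.dbar_smooth.continuous (hasCompactSupport_dbar hc.mul_right)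
  have hT := differentiableOn_cauchyTransform hmi (z₀ := z₀) (r := r)
    (Eventually.of_forall fun ζ hζ => by simp [hm, h2 ζ hζ])
  have hae : ∀ᵐ z, z ∈ ball z₀ r →
      E z * w z - (starRingEnd ℂ) z * f z = cauchyTransform m z := by
    filter_upwards [key, Integrable.ae_integrable_div_sub hmi] with z hz hzi hzb
    have h4 := cauchyTransform_congr_ae h3 z
    rw [cauchyTransform_add hzi (hdc.integrable_div_sub z), hCP] at h4
    rw [h4] at hz
    simp only [h1 z hzb, one_mul] at hz
    simp only [hE]
    linear_combination hz
  have heq : EqOn (fun z => E z * w z - (starRingEnd ℂ) z * f z) (cauchyTransform m)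
      (ball z₀ r) :=
    Measure.eqOn_open_of_ae_eq (μ := volume)
      ((ae_restrict_iff' measurableSet_ball).2 hae) isOpen_ball (hgc.mono hrD) hT.continuousOn
  have hz0 : ball z₀ r ∈ 𝓝 z₀ := ball_mem_nhds z₀ hr
  exact ((hT.differentiableAt hz0).congr_of_eventuallyEq
    (heq.eventuallyEq_of_mem hz0)).differentiableWithinAt

/-- `exp (T A) Φ` solves `∂̄ w = A w + exp (T A) ∂̄ Φ` for smooth `Φ`. -/
theorem hasWeakComplexDbar_exp_mul {D : Set ℂ} {A Φ : ℂ → ℂ}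
    (hA : BoundedPotential A) (hAi : Integrable A) (hTA : Continuous (cauchyTransform A))
    (hΦ : ContDiff ℝ ∞ Φ) :
    HasWeakComplexDbar D (fun z => Complex.exp (cauchyTransform A z) * Φ z)
      fun z => A z * (Complex.exp (cauchyTransform A z) * Φ z) +
        Complex.exp (cauchyTransform A z) * dbar Φ z := by
  set E : ℂ → ℂ := fun z => Complex.exp (cauchyTransform A z) with hE
  have hEc : Continuous E := Complex.continuous_exp.comp hTA
  have hEΦ : Continuous fun z => E z * Φ z := hEc.mul hΦ.continuous
  have hEd : Continuous fun z => E z * dbar Φ z := hEc.mul hΦ.dbar_smooth.continuous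
  have hAE : LocallyIntegrable fun z => A z * (E z * Φ z) := by
    have h := (hAi.locallyIntegrable.locallyIntegrableOn univ).continuousOn_mul
      hEΦ.continuousOn isClosed_univ.isLocallyClosed
    rw [locallyIntegrableOn_univ] at h
    exact h.congr (Eventually.of_forall fun z => by simp only; ring)
  refine ⟨hEΦ.locallyIntegrable.locallyIntegrableOn D,
    (hAE.add hEd.locallyIntegrable).locallyIntegrableOn D, fun φ hφ => ?_⟩
  set ψ : ℂ → ℂ := fun z => (φ z : ℂ) with hψ
  have h0 : tsupport ψ ⊆ tsupport φ := closure_mono fun z hz => by simpa [hψ] using hz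
  have hψs : ContDiff ℝ ∞ ψ := Complex.ofRealCLM.contDiff.comp hφ.contDiff
  have hψc : HasCompactSupport ψ :=
    hφ.hasCompactSupport.of_isClosed_subset (isClosed_tsupport _) h0
  rw [setIntegral_eq_integral_of_forall_compl_eq_zero,
    setIntegral_eq_integral_of_forall_compl_eq_zero]
  rotate_left
  · intro z hz
    rw [image_eq_zero_of_notMem_tsupport fun h4 => hz (hφ.tsupport_subset h4)]
    simp
  · intro z hz
    rw [image_eq_zero_of_notMem_tsupport fun h4 =>
      hz (hφ.tsupport_subset (h0 (tsupport_dbar_subset _ h4))), zero_mul]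
  set Ψ : ℂ → ℂ := fun z => ψ z * Φ z with hΨ
  have hΨs : ContDiff ℝ ∞ Ψ := hψs.mul hΦ
  have hΨc : HasCompactSupport Ψ := hψc.mul_right
  have hdΨ : ∀ z, dbar Ψ z = ψ z * dbar Φ z + dbar ψ z * Φ z := fun z =>
    dbar_mul (hψs.differentiable (by simp) z) (hΦ.differentiable (by simp) z)
  have hAEi : Integrable fun z => A z * E z := by
    obtain ⟨C, hC⟩ := hA.exists_norm_cauchyTransform_le
    refine hAi.mul_bdd (c := Real.exp C) hEc.aestronglyMeasurable
      (Eventually.of_forall fun z => ?_)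
    rw [hE, Complex.norm_exp]
    exact Real.exp_le_exp.2 ((Complex.re_le_norm _).trans (hC z))
  have hdb : BoundedPotential (dbar Ψ) :=
    .of_continuous hΨs.dbar_smooth.continuous (hasCompactSupport_dbar hΨc)
  -- Insert E = 1 + T(A E): the constant contributes ∫ `∂̄` Ψ = 0, and antisymmetry turns the rest
  -- into T(`∂̄` Ψ) = Ψ paired with A E.
  have key : ∫ z, dbar Ψ z * E z = -∫ z, A z * E z * Ψ z := by
    have h1 := integral_mul_cauchyTransform hdb hAEi
    have h2 := integrable_mul_cauchyTransform hdb hAEi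
    rw [cauchyTransform_dbar hΨs.one_of_smooth hΨc] at h1
    rw [← h1]
    have h3 : ∀ z, dbar Ψ z * E z =
        dbar Ψ z + dbar Ψ z * cauchyTransform (fun z => A z * E z) z := fun z => by
      simp only [hE]
      nth_rewrite 1 [exp_cauchyTransform hA z]
      ring
    simp only [h3]
    rw [integral_add (hΨs.dbar_smooth.continuous.integrable_of_hasCompactSupport
      (hasCompactSupport_dbar hΨc)) h2, integral_dbar_eq_zero hΨs.one_of_smooth hΨc, zero_add]
  have hi1 : Integrable fun z => dbar Ψ z * E z :=
    (hΨs.dbar_smooth.continuous.mul hEc).integrable_of_hasCompactSupport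
      (hasCompactSupport_dbar hΨc).mul_right
  have hi2 : Integrable fun z => ψ z * dbar Φ z * E z :=
    ((hψs.continuous.mul hΦ.dbar_smooth.continuous).mul hEc).integrable_of_hasCompactSupport
      hψc.mul_right.mul_right
  have hi3 : Integrable fun z => A z * E z * Ψ z := by
    obtain ⟨C, hC⟩ := hΨs.continuous.bounded_above_of_compact_support hΨc
    exact hAEi.mul_bdd hΨs.continuous.aestronglyMeasurable (Eventually.of_forall hC)
  calc ∫ z, dbar ψ z * (E z * Φ z) = ∫ z, (dbar Ψ z * E z - ψ z * dbar Φ z * E z) := by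
        congr 1 with z
        rw [hdΨ]; ring
    _ = -∫ z, (A z * E z * Ψ z + ψ z * dbar Φ z * E z) := by
        rw [integral_sub hi1 hi2, key, integral_add hi3 hi2]
        ring
    _ = _ := by
        congr 2 with z
        simp only [hΨ]
        ring

/-! ### Bianalytic functions vanishing on an ellipse -/

/-- For 2πi-periodic functions this replaces a vertical strip by a compact rectangle. -/
theorem exists_exp_eq_im_mem_Icc (s : ℂ) :
    ∃ t : ℂ, t.re = s.re ∧ t.im ∈ Icc 0 (2 * Real.pi) ∧ Complex.exp t = Complex.exp s := by
  have hp : Function.Periodic (fun τ : ℝ => Complex.exp (s.re + τ * Complex.I))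
      (2 * Real.pi) := by
    intro τ
    simp only
    have : (s.re : ℂ) + ((τ + 2 * Real.pi : ℝ) : ℂ) * Complex.I =
        (s.re + τ * Complex.I) + 2 * Real.pi * Complex.I := by push_cast; ring
    rw [this, Complex.exp_periodic]
  obtain ⟨y, hy, hxy⟩ := hp.exists_mem_Ico₀ (by positivity) s.im
  refine ⟨s.re + y * Complex.I, by simp, ?_, ?_⟩
  · simpa using Ico_subset_Icc_self hy
  · have hxy' : Complex.exp (s.re + s.im * Complex.I) = Complex.exp (s.re + y * Complex.I) := hxy
    rw [← hxy', Complex.re_add_im]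

theorem cosh_sub_eq_of_exp_eq {s t : ℂ} (h : Complex.exp t = Complex.exp s) (c : ℂ) :
    Complex.cosh (c - t) = Complex.cosh (c - s) := by
  simp only [Complex.cosh, neg_sub, Complex.exp_sub, h]

theorem cosh_eq_of_exp_eq {s t : ℂ} (h : Complex.exp t = Complex.exp s) :
    Complex.cosh t = Complex.cosh s := by
  simp only [Complex.cosh, Complex.exp_neg, h]

/-- On Re s = σ the reflection conj s = 2σ - s is holomorphic in s, so conjugation on this line
extends holomorphically. This is the Schwarz function of the ellipse, in the coordinate s. -/
theorem conj_cosh_eq {s : ℂ} {σ : ℝ} (hs : s.re = σ) :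
    (starRingEnd ℂ) (Complex.cosh s) = Complex.cosh (2 * σ - s) := by
  rw [← Complex.cosh_conj]
  congr 1
  apply Complex.ext
  · simp [hs]; ring
  · simp

theorem tendsto_rpow_interp {a ε x s₀ : ℝ} (ha : 0 < a) (hε : 0 < ε) (hs₀ : s₀ ≠ 0) :
    Tendsto (fun σ : ℝ => a ^ (1 - x / σ) * ε ^ (x / σ)) (𝓝[<] s₀)
      (𝓝 (a ^ (1 - x / s₀) * ε ^ (x / s₀))) := by
  have h2 : Tendsto (fun σ : ℝ => x / σ) (𝓝[<] s₀) (𝓝 (x / s₀)) :=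
    (tendsto_const_nhds.div tendsto_id hs₀).mono_left nhdsWithin_le_nhds
  exact (((Real.continuousAt_const_rpow ha.ne').tendsto.comp (tendsto_const_nhds.sub h2))).mul
    ((Real.continuousAt_const_rpow hε.ne').tendsto.comp h2)

/-- A family of `2πi`-periodic holomorphic functions on a strip, bounded on the axis `Re s = 0` and
small on the lines `Re s = σ` as `σ → s₀`, has limit zero. -/
theorem eq_zero_of_three_lines {s₀ a : ℝ} (hs₀ : 0 < s₀) (ha0 : 0 < a) {H : ℝ → ℂ → ℂ}
    (hHd : ∀ σ, DifferentiableOn ℂ (H σ) {s : ℂ | |s.re| < s₀})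
    (hHc : ∀ s, ContinuousAt (fun σ => H σ s) s₀)
    (hper : ∀ (σ : ℝ) {s t : ℂ}, Complex.exp t = Complex.exp s → H σ t = H σ s)
    (ha : ∀ σ ∈ Icc 0 s₀, ∀ s : ℂ, s.re = 0 → ‖H σ s‖ ≤ a)
    (hb : ∀ ε > 0, ∀ᶠ σ in 𝓝[<] s₀, ∀ s : ℂ, s.re = σ → ‖H σ s‖ ≤ ε) :
    ∀ s : ℂ, 0 < s.re → s.re < s₀ → H s₀ s = 0 := by
  intro s hs1 hs2
  have hlim : Tendsto (fun σ => ‖H σ s‖) (𝓝[<] s₀) (𝓝 ‖H s₀ s‖) :=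
    ((hHc s).norm.tendsto).mono_left nhdsWithin_le_nhds
  -- Interpolate between Re s = 0 and Re s = σ < s₀, where H σ is holomorphic up to both lines; then
  -- let σ → s₀ with ε fixed, and only afterwards ε → 0.
  have hle : ∀ ε > 0, ‖H s₀ s‖ ≤ a ^ (1 - s.re / s₀) * ε ^ (s.re / s₀) := by
    intro ε hε
    have h1 : Tendsto (fun σ : ℝ => a ^ (1 - s.re / σ) * ε ^ (s.re / σ)) (𝓝[<] s₀)
        (𝓝 (a ^ (1 - s.re / s₀) * ε ^ (s.re / s₀))) :=
      tendsto_rpow_interp ha0 hε hs₀.ne'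
    refine le_of_tendsto_of_tendsto hlim h1 ?_
    have h2 : ∀ᶠ σ in 𝓝[<] s₀, s.re < σ := nhdsWithin_le_nhds (lt_mem_nhds hs2)
    filter_upwards [hb ε hε, h2, self_mem_nhdsWithin] with σ h3 h4 h5
    simp only [mem_Iio] at h5
    have hσ0 : 0 < σ := hs1.trans h4
    have hsub : Complex.HadamardThreeLines.verticalClosedStrip 0 σ ⊆ {s : ℂ | |s.re| < s₀} := by
      rintro t ⟨h6, h7⟩
      simp only [mem_ofPred_eq, abs_of_nonneg h6]
      linarith
    have hcl : closure (Complex.HadamardThreeLines.verticalStrip 0 σ) ⊆ {s : ℂ | |s.re| < s₀} := by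
      refine (closure_minimal ?_ ?_).trans hsub
      · exact preimage_mono Ioo_subset_Icc_self
      · exact isClosed_Icc.preimage Complex.continuous_re
    have hbdd : BddAbove ((norm ∘ H σ) ''
        Complex.HadamardThreeLines.verticalClosedStrip 0 σ) := by
      have hKc : IsCompact (Icc 0 σ ×ℂ Icc 0 (2 * Real.pi)) :=
        isCompact_Icc.reProdIm isCompact_Icc
      have hKU : Icc 0 σ ×ℂ Icc 0 (2 * Real.pi) ⊆ {s : ℂ | |s.re| < s₀} := fun t ht => hsub ht.1
      obtain ⟨C, hC⟩ := hKc.exists_bound_of_continuousOn ((hHd σ).continuousOn.mono hKU)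
      refine ⟨C, ?_⟩
      rintro _ ⟨t, ht, rfl⟩
      obtain ⟨t', ht1, ht2, ht3⟩ := exists_exp_eq_im_mem_Icc t
      simp only [Function.comp]
      rw [← hper σ ht3]
      refine hC t' ⟨?_, ht2⟩
      simp only [mem_preimage, ht1]
      exact ht
    have h6 := Complex.HadamardThreeLines.norm_le_interp_of_mem_verticalClosedStrip' hσ0
      (f := H σ) (z := s) (a := a) (b := ε) ⟨hs1.le, h4.le⟩
      ((hHd σ).mono hcl).diffContOnCl hbdd (fun t ht => ha σ ⟨hσ0.le, h5.le⟩ t ht)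
      (fun t ht => h3 t ht)
    simpa using h6
  have hx : 0 < s.re / s₀ := by positivity
  have h1 : Tendsto (fun ε : ℝ => a ^ (1 - s.re / s₀) * ε ^ (s.re / s₀)) (𝓝[>] 0) (𝓝 0) := by
    have h2 : Tendsto (fun ε : ℝ => ε ^ (s.re / s₀)) (𝓝 0) (𝓝 (0 ^ (s.re / s₀))) :=
      (Real.continuousAt_rpow_const 0 _ (Or.inr hx.le)).tendsto
    rw [Real.zero_rpow hx.ne'] at h2
    simpa using (h2.const_mul (a ^ (1 - s.re / s₀))).mono_left nhdsWithin_le_nhds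
  have h2 : ‖H s₀ s‖ ≤ 0 := by
    refine ge_of_tendsto h1 ?_
    filter_upwards [self_mem_nhdsWithin] with ε hε using hle ε hε
  exact norm_le_zero_iff.1 h2

/-- A bianalytic function on a filled ellipse (parametrised by `s ↦ m + κ cosh s`, `|Re s| < s₀`)
which vanishes on the boundary ellipse is zero. -/
theorem bianalytic_eq_zero {D Γ : Set ℂ} (hDo : IsOpen D) {m κ : ℂ} (hκ : κ ≠ 0) {s₀ : ℝ}
    (hs₀ : 0 < s₀) (hDm : ∀ s : ℂ, |s.re| < s₀ → m + κ * Complex.cosh s ∈ D)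
    (hDs : ∀ z ∈ D, ∃ s : ℂ, |s.re| < s₀ ∧ m + κ * Complex.cosh s = z)
    (hΓ : ∀ s : ℂ, s.re = s₀ → m + κ * Complex.cosh s ∈ Γ)
    {f g φ : ℂ → ℂ} (hf : DifferentiableOn ℂ f D) (hg : DifferentiableOn ℂ g D)
    (hφc : ContinuousOn φ (D ∪ Γ)) (hφ : ∀ z ∈ D, φ z = (starRingEnd ℂ) z * f z + g z)
    (hφΓ : ∀ z ∈ Γ, φ z = 0) : ∀ z ∈ D, f z = 0 ∧ g z = 0 := by
  set ψ : ℂ → ℂ := fun s => m + κ * Complex.cosh s with hψ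
  have hψd : Differentiable ℂ ψ := by fun_prop
  set U : Set ℂ := {s | |s.re| < s₀} with hU
  have hUo : IsOpen U := isOpen_lt (by fun_prop) continuous_const
  have hUc : Convex ℝ U := by
    have : U = Complex.reLm ⁻¹' Ioo (-s₀) s₀ := by
      ext s; simp [hU, abs_lt]
    rw [this]
    exact (convex_Ioo _ _).linear_preimage _
  have hF : DifferentiableOn ℂ (fun s => f (ψ s)) U :=
    hf.comp hψd.differentiableOn fun s hs => hDm s hs
  have hG : DifferentiableOn ℂ (fun s => g (ψ s)) U :=
    hg.comp hψd.differentiableOn fun s hs => hDm s hs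
  -- S σ is entire and equals the conjugate of ψ on Re s = σ; accordingly H σ below is the
  -- holomorphic extension of φ ∘ ψ from that line.
  set S : ℝ → ℂ → ℂ := fun σ s =>
    (starRingEnd ℂ) m + (starRingEnd ℂ) κ * Complex.cosh (2 * σ - s) with hS
  have hSc : Continuous fun p : ℝ × ℂ => S p.1 p.2 := by
    have : Continuous fun p : ℝ × ℂ => Complex.cosh (2 * p.1 - p.2) :=
      Complex.continuous_cosh.comp (by fun_prop)
    exact continuous_const.add (continuous_const.mul this)
  set H : ℝ → ℂ → ℂ := fun σ s => S σ s * f (ψ s) + g (ψ s) with hH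
  have hHd : ∀ σ, DifferentiableOn ℂ (H σ) U := fun σ => by
    refine DifferentiableOn.add (DifferentiableOn.mul ?_ hF) hG
    simp only [hS]
    fun_prop
  have hHφ : ∀ σ : ℝ, ∀ s ∈ U, s.re = σ → H σ s = φ (ψ s) := by
    intro σ s hs hσ
    rw [hφ _ (hDm s hs)]
    simp only [hH, hS, hψ, map_add, map_mul, conj_cosh_eq hσ]
  have hper : ∀ {s t : ℂ}, Complex.exp t = Complex.exp s → ψ t = ψ s ∧ ∀ σ, H σ t = H σ s := by
    intro s t h
    have h1 : ψ t = ψ s := by simp only [hψ, cosh_eq_of_exp_eq h]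
    exact ⟨h1, fun σ => by simp only [hH, hS, h1, cosh_sub_eq_of_exp_eq h]⟩
  -- bound on the imaginary axis
  obtain ⟨a, ha0, ha⟩ : ∃ a : ℝ, 0 < a ∧ ∀ σ ∈ Icc 0 s₀, ∀ s : ℂ, s.re = 0 → ‖H σ s‖ ≤ a := by
    have hK : IsCompact (Icc (0 : ℝ) s₀ ×ˢ (({0} : Set ℝ) ×ℂ Icc 0 (2 * Real.pi))) :=
      isCompact_Icc.prod (isCompact_singleton.reProdIm isCompact_Icc)
    have hKU : ∀ p ∈ Icc (0 : ℝ) s₀ ×ˢ (({0} : Set ℝ) ×ℂ Icc 0 (2 * Real.pi)), p.2 ∈ U := by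
      rintro ⟨σ, s⟩ ⟨-, h1, -⟩
      simp only [mem_preimage, mem_singleton_iff] at h1
      simp [hU, h1, hs₀]
    have hc : ContinuousOn (fun p : ℝ × ℂ => H p.1 p.2)
        (Icc (0 : ℝ) s₀ ×ˢ (({0} : Set ℝ) ×ℂ Icc 0 (2 * Real.pi))) :=
      (hSc.continuousOn.mul (hF.continuousOn.comp continuous_snd.continuousOn hKU)).add
        (hG.continuousOn.comp continuous_snd.continuousOn hKU)
    obtain ⟨C, hC⟩ := hK.exists_bound_of_continuousOn hc
    refine ⟨max C 1, by positivity, fun σ hσ s hs => ?_⟩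
    obtain ⟨t, ht1, ht2, ht3⟩ := exists_exp_eq_im_mem_Icc s
    rw [← (hper ht3).2 σ]
    exact (hC (σ, t) ⟨hσ, by simp [ht1, hs], ht2⟩).trans (le_max_left _ _)
  -- smallness near the boundary
  have hb : ∀ ε > 0, ∀ᶠ σ in 𝓝[<] s₀, ∀ s : ℂ, s.re = σ → ‖H σ s‖ ≤ ε := by
    intro ε hε
    set K : Set ℂ := Icc 0 s₀ ×ℂ Icc 0 (2 * Real.pi) with hK
    have hKc : IsCompact K := isCompact_Icc.reProdIm isCompact_Icc
    have hmaps : MapsTo ψ K (D ∪ Γ) := by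
      rintro s ⟨⟨h1, h2⟩, -⟩
      rcases h2.lt_or_eq with h3 | h3
      · exact Or.inl (hDm s (by rw [abs_of_nonneg h1]; exact h3))
      · exact Or.inr (hΓ s h3)
    have huc := hKc.uniformContinuousOn_of_continuous
      (hφc.comp hψd.continuous.continuousOn hmaps)
    obtain ⟨δ, hδ, hδ'⟩ := Metric.uniformContinuousOn_iff.1 huc ε hε
    have h1 : ∀ᶠ σ in 𝓝[<] s₀, s₀ - δ < σ :=
      nhdsWithin_le_nhds (lt_mem_nhds (by linarith))
    have h2 : ∀ᶠ σ in 𝓝[<] s₀, 0 < σ := nhdsWithin_le_nhds (lt_mem_nhds hs₀)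
    filter_upwards [h1, h2, self_mem_nhdsWithin] with σ h1 h2 h3 s hs
    simp only [mem_Iio] at h3
    obtain ⟨t, ht1, ht2, ht3⟩ := exists_exp_eq_im_mem_Icc s
    have hσ : t.re = σ := ht1.trans hs
    rw [← (hper ht3).2 σ, hHφ σ t (by simp only [hU, mem_ofPred_eq, hσ]; rwa [abs_of_pos h2]) hσ]
    -- The boundary point with the same imaginary part, at distance s₀ - σ < δ, where φ ∘ ψ is zero.
    set t' : ℂ := ⟨s₀, t.im⟩ with ht'
    have h4 := hδ' t ⟨⟨by rw [hσ]; exact h2.le, by rw [hσ]; exact h3.le⟩, ht2⟩ t'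
      ⟨⟨hs₀.le, le_rfl⟩, ht2⟩ (by
        have : t - t' = ((σ - s₀ : ℝ) : ℂ) := by
          apply Complex.ext <;> simp [ht', hσ]
        rw [dist_eq_norm, this, Complex.norm_real, Real.norm_eq_abs, abs_lt]
        constructor <;> linarith)
    have h5 : φ (ψ t') = 0 := hφΓ _ (hΓ _ rfl)
    simp only [Function.comp, h5, dist_zero_right] at h4
    exact h4.le
  have hzero : ∀ s : ℂ, 0 < s.re → s.re < s₀ → H s₀ s = 0 := by
    refine eq_zero_of_three_lines hs₀ ha0 hHd (fun s => Continuous.continuousAt ?_)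
      (fun σ s t h => (hper h).2 σ) ha hb
    have h1 : Continuous fun σ : ℝ => S σ s :=
      continuous_const.add (continuous_const.mul (Complex.continuous_cosh.comp (by fun_prop)))
    exact (h1.mul continuous_const).add continuous_const
  -- identity theorem
  have hHU : EqOn (H s₀) 0 U := by
    refine ((hHd s₀).analyticOnNhd hUo).eqOn_zero_of_preconnected_of_eventuallyEq_zero
      hUc.isPreconnected (z₀ := ((s₀ / 2 : ℝ) : ℂ)) ?_ ?_
    · simp only [hU, mem_ofPred_eq, Complex.ofReal_re]
      rw [abs_of_pos (by positivity)]
      linarith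
    · have h1 : ∀ᶠ s : ℂ in 𝓝 ((s₀ / 2 : ℝ) : ℂ), 0 < s.re ∧ s.re < s₀ := by
        refine IsOpen.mem_nhds (s := {s : ℂ | 0 < s.re ∧ s.re < s₀}) ?_ ?_
        · exact (isOpen_lt continuous_const Complex.continuous_re).inter
            (isOpen_lt Complex.continuous_re continuous_const)
        · constructor <;> simp <;> linarith
      filter_upwards [h1] with s hs using hzero s hs.1 hs.2
  -- ψ is even but S s₀ is not, so s and -s give two linear equations for f(z) and g(z). Their
  -- difference has coefficient -2 conj κ sinh(2s₀) sinh s, which is nonzero away from the foci m ±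
  -- κ.
  have hgen : ∀ z ∈ D, z ∉ ({m + κ, m - κ} : Set ℂ) → f z = 0 ∧ g z = 0 := by
    intro z hz hne
    obtain ⟨s, hs, hsz⟩ := hDs z hz
    have h1 : H s₀ s = 0 := hHU hs
    have h2 : H s₀ (-s) = 0 := hHU (by simpa [hU] using hs)
    have hψs : ψ s = z := hsz
    have hψs' : ψ (-s) = z := by simpa [hψ] using hsz
    simp only [hH, hψs, hψs'] at h1 h2
    have hsinh : Complex.sinh s ≠ 0 := by
      intro h
      have h3 := Complex.cosh_sq_sub_sinh_sq s
      rw [h] at h3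
      have h4 : (Complex.cosh s - 1) * (Complex.cosh s + 1) = 0 := by linear_combination h3
      rcases mul_eq_zero.1 h4 with h5 | h5
      · exact hne (Or.inl (by rw [← hsz]; linear_combination κ * h5))
      · exact hne (Or.inr (by rw [mem_singleton_iff, ← hsz]; linear_combination κ * h5))
    have hsinh2 : Complex.sinh (2 * s₀) ≠ 0 := by
      have : Complex.sinh (2 * s₀) = ((Real.sinh (2 * s₀) : ℝ) : ℂ) := by push_cast; rfl
      rw [this]
      exact_mod_cast (Real.sinh_pos_iff.2 (by positivity)).ne'
    have hdiff : (-2 * (starRingEnd ℂ) κ * Complex.sinh (2 * s₀) * Complex.sinh s) * f z = 0 := by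
      have h3 : S s₀ s - S s₀ (-s) =
          -2 * (starRingEnd ℂ) κ * Complex.sinh (2 * s₀) * Complex.sinh s := by
        simp only [hS, Complex.cosh_sub, Complex.cosh_neg, Complex.sinh_neg]
        ring
      rw [← h3]
      linear_combination h1 - h2
    have hfz : f z = 0 := by
      refine (mul_eq_zero.1 hdiff).resolve_left ?_
      have : (starRingEnd ℂ) κ ≠ 0 := by simpa using hκ
      simp [this, hsinh, hsinh2]
    refine ⟨hfz, ?_⟩
    rw [hfz] at h1
    simpa using h1
  intro z hz
  -- The foci are isolated, so the values there follow by continuity.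
  have hev : ∀ᶠ w in 𝓝[≠] z, f w = 0 ∧ g w = 0 := by
    have hfin : (({m + κ, m - κ} : Set ℂ) \ {z}).Finite :=
      ((finite_singleton _).insert _).subset sdiff_subset
    have h1 : ∀ᶠ w in 𝓝[≠] z, w ∈ (({m + κ, m - κ} : Set ℂ) \ {z})ᶜ :=
      nhdsWithin_le_nhds (hfin.isClosed.isOpen_compl.mem_nhds (by simp))
    filter_upwards [h1, self_mem_nhdsWithin, nhdsWithin_le_nhds (hDo.mem_nhds hz)]
      with w h2 h3 h4
    exact hgen w h4 fun h5 => h2 ⟨h5, h3⟩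
  have hcf := ((hf.differentiableAt (hDo.mem_nhds hz)).continuousAt.tendsto).mono_left
    (nhdsWithin_le_nhds (s := {z}ᶜ))
  have hcg := ((hg.differentiableAt (hDo.mem_nhds hz)).continuousAt.tendsto).mono_left
    (nhdsWithin_le_nhds (s := {z}ᶜ))
  exact ⟨tendsto_nhds_unique hcf (tendsto_const_nhds.congr' (hev.mono fun w h => h.1.symm)),
    tendsto_nhds_unique hcg (tendsto_const_nhds.congr' (hev.mono fun w h => h.2.symm))⟩

/-! ### Geometry of a conic that encloses a region -/

namespace Conic

theorem continuous_eval (Q : Conic) : Continuous fun z : ℂ => Q.eval z.re z.im := by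
  unfold eval
  fun_prop

/-- A point which escapes to infinity along a line, without crossing the conic, is not enclosed. -/
theorem notMem_enclosedRegion_of_form (Q : Conic) {z : ℂ} {p r : ℝ} (hpr : p ≠ 0 ∨ r ≠ 0)
    (h : 0 ≤ Q.eval z.re z.im * (Q.a * p ^ 2 + Q.b * p * r + Q.c * r ^ 2)) :
    z ∉ enclosedRegion Q.locus := by
  rintro ⟨hz, hb⟩
  have hz0 : Q.eval z.re z.im ≠ 0 := hz
  set L : ℝ := 2 * Q.a * z.re * p + Q.b * (z.re * r + z.im * p) + 2 * Q.c * z.im * r +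
    Q.d * p + Q.e * r with hL
  -- Reversing the direction changes the sign of L and keeps the quadratic coefficient. Then Q(z)
  -- Q(γ t) ≥ Q(z)² > 0 along the whole ray.
  wlog hL0 : 0 ≤ Q.eval z.re z.im * L generalizing p r
  · refine this (p := -p) (r := -r) (by simpa using hpr) (by convert! h using 2; ring) rfl ?_
    have : 0 ≤ -(Q.eval z.re z.im * L) := by linarith
    convert! this using 1
    rw [hL]
    ring
  set u : ℂ := ⟨p, r⟩ with hu
  have hu0 : u ≠ 0 := by
    intro h0
    have h1 := congrArg Complex.re h0
    have h2 := congrArg Complex.im h0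
    simp only [hu, Complex.zero_re, Complex.zero_im] at h1 h2
    rcases hpr with h3 | h3
    · exact h3 h1
    · exact h3 h2
  set γ : ℝ → ℂ := fun t => z + t * u with hγ
  have hsub : γ '' Ici 0 ⊆ connectedComponentIn Q.locusᶜ z := by
    refine IsPreconnected.subset_connectedComponentIn ?_ ⟨0, by simp, by simp [hγ]⟩ ?_
    · exact isPreconnected_Ici.image _ (by fun_prop)
    · rintro _ ⟨t, ht, rfl⟩
      simp only [mem_Ici] at ht
      change Q.eval (γ t).re (γ t).im ≠ 0
      intro h0
      have h1 : Q.eval (γ t).re (γ t).im = Q.eval z.re z.im + t * L +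
          t ^ 2 * (Q.a * p ^ 2 + Q.b * p * r + Q.c * r ^ 2) := by
        simp [hγ, hu, eval, hL]
        ring
      have h2 : 0 < Q.eval z.re z.im ^ 2 := by positivity
      have h3 := mul_nonneg ht hL0
      have h4 := mul_nonneg (sq_nonneg t) h
      have h5 : Q.eval z.re z.im * (Q.eval z.re z.im + t * L +
          t ^ 2 * (Q.a * p ^ 2 + Q.b * p * r + Q.c * r ^ 2)) = 0 := by rw [← h1, h0, mul_zero]
      nlinarith
  obtain ⟨R, hR⟩ := (hb.subset hsub).exists_norm_le
  have hR0 : 0 ≤ R := (norm_nonneg _).trans (hR _ ⟨0, by simp, rfl⟩)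
  have hun : 0 < ‖u‖ := norm_pos_iff.2 hu0
  have h1 := hR _ ⟨(R + ‖z‖ + 1) / ‖u‖, mem_Ici.2 (by positivity), rfl⟩
  have h2 : ‖((((R + ‖z‖ + 1) / ‖u‖ : ℝ)) : ℂ) * u‖ = R + ‖z‖ + 1 := by
    rw [norm_mul, Complex.norm_real, Real.norm_of_nonneg (by positivity)]
    field_simp
  have h3 := norm_sub_le (γ ((R + ‖z‖ + 1) / ‖u‖)) z
  have h4 : γ ((R + ‖z‖ + 1) / ‖u‖) - z = (((R + ‖z‖ + 1) / ‖u‖ : ℝ) : ℂ) * u := by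
    simp [hγ]
  rw [h4, h2] at h3
  linarith

/-- Otherwise the quadratic part has a nonzero isotropic direction, along which every point off the
conic escapes to infinity. -/
theorem discrim_pos_of_nonempty (Q : Conic) (hD : (enclosedRegion Q.locus).Nonempty) :
    0 < 4 * Q.a * Q.c - Q.b ^ 2 := by
  obtain ⟨z, hz⟩ := hD
  by_contra! h
  by_cases ha : Q.a = 0
  · exact Q.notMem_enclosedRegion_of_form (z := z) (p := 1) (r := 0) (by simp) (by simp [ha]) hz
  · have hs := Real.sq_sqrt (show 0 ≤ Q.b ^ 2 - 4 * Q.a * Q.c by linarith)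
    set s := √(Q.b ^ 2 - 4 * Q.a * Q.c)
    refine Q.notMem_enclosedRegion_of_form (z := z) (p := -Q.b + s) (r := 2 * Q.a)
      (Or.inr (by simpa using ha)) (le_of_eq ?_) hz
    linear_combination (-Q.eval z.re z.im * Q.a) * hs

/-- The quadratic part equals a in the direction (1, 0), so a point off the conic where a Q ≥ 0
escapes along a horizontal line. -/
theorem eval_mul_neg_of_mem (Q : Conic) {z : ℂ} (hz : z ∈ enclosedRegion Q.locus) :
    Q.a * Q.eval z.re z.im < 0 := by
  by_contra! h
  exact Q.notMem_enclosedRegion_of_form (z := z) (p := 1) (r := 0) (by simp)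
    (by simpa [mul_comm] using h) hz

theorem exists_cosh_two_mul_eq {C : ℝ} (hC : 1 < C) : ∃ s₀ > 0, Real.cosh (2 * s₀) = C := by
  refine ⟨Real.arcosh C / 2, half_pos (Real.arcosh_pos hC), ?_⟩
  rw [mul_div_cancel₀ _ two_ne_zero, Real.cosh_arcosh hC.le]

/-- Parametrisation by `s ↦ m + κ cosh s` adapted to a non-circular ellipse. -/
theorem exists_param (Q : Conic) (hQ' : ¬ Q.IsCircumference) (ha : 0 < Q.a)
    (hdisc : 0 < 4 * Q.a * Q.c - Q.b ^ 2) {z₁ : ℂ} (hz₁ : Q.eval z₁.re z₁.im < 0) :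
    ∃ m κ : ℂ, ∃ s₀ l : ℝ, κ ≠ 0 ∧ 0 < s₀ ∧ 0 < l ∧ ∀ s : ℂ,
      Q.eval (m + κ * Complex.cosh s).re (m + κ * Complex.cosh s).im =
        l * (Real.cosh (2 * s.re) - Real.cosh (2 * s₀)) *
          (Real.cosh (2 * s₀) - Real.cos (2 * s.im)) := by
  set Δ := 4 * Q.a * Q.c - Q.b ^ 2 with hΔ
  -- The centre, where the gradient of Q vanishes; k is the (negative) value there.
  set m : ℂ := ⟨(Q.b * Q.e - 2 * Q.c * Q.d) / Δ, (Q.b * Q.d - 2 * Q.a * Q.e) / Δ⟩ with hm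
  set k := Q.eval m.re m.im with hk
  have hm1 : 2 * Q.a * m.re + Q.b * m.im + Q.d = 0 := by
    simp only [hm]
    field_simp
    rw [hΔ]
    ring
  have hm2 : Q.b * m.re + 2 * Q.c * m.im + Q.e = 0 := by
    simp only [hm]
    field_simp
    rw [hΔ]
    ring
  have hform : ∀ u : ℂ, Q.eval (m + u).re (m + u).im =
      Q.a * u.re ^ 2 + Q.b * u.re * u.im + Q.c * u.im ^ 2 + k := by
    intro u
    simp only [hk, eval, Complex.add_re, Complex.add_im]
    linear_combination u.re * hm1 + u.im * hm2
  have hk0 : k < 0 := by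
    have h1 := hform (z₁ - m)
    rw [add_sub_cancel] at h1
    set p := (z₁ - m).re
    set r := (z₁ - m).im
    have h2 : 0 ≤ Q.a * (Q.a * p ^ 2 + Q.b * p * r + Q.c * r ^ 2) := by
      nlinarith [sq_nonneg (2 * Q.a * p + Q.b * r), mul_nonneg hdisc.le (sq_nonneg r)]
    have h3 := nonneg_of_mul_nonneg_right h2 ha
    linarith
  -- Complex form of the quadratic part: 2 Re(α u²) + β |u|². Here α = 0 exactly for a
  -- circumference.
  set α : ℂ := ⟨(Q.a - Q.c) / 4, -Q.b / 4⟩ with hα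
  have hα0 : α ≠ 0 := by
    intro h0
    have h1 := congrArg Complex.re h0
    have h2 := congrArg Complex.im h0
    simp only [hα, Complex.zero_re, Complex.zero_im] at h1 h2
    exact hQ' ⟨by linarith, by linarith⟩
  set ρ := ‖α‖ with hρ
  have hρ0 : 0 < ρ := norm_pos_iff.2 hα0
  have hρ2 : ρ ^ 2 = ((Q.a - Q.c) / 4) ^ 2 + (Q.b / 4) ^ 2 := by
    rw [hρ, ← Complex.normSq_eq_norm_sq, Complex.normSq_apply]
    simp only [hα]
    ring
  set β := (Q.a + Q.c) / 2 with hβ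
  have hc : 0 < Q.c := by
    by_contra! h
    nlinarith [mul_nonneg ha.le (neg_nonneg.2 h), sq_nonneg Q.b]
  have hβρ : 2 * ρ < β := by
    refine lt_of_pow_lt_pow_left₀ 2 (by positivity) ?_
    rw [mul_pow, hρ2, hβ]
    nlinarith
  -- This will be cosh(2s₀); it exceeds 1 because the discriminant is positive.
  set C := β / (2 * ρ) with hC
  have hC1 : 1 < C := by rw [hC, lt_div_iff₀ (by positivity)]; linarith
  obtain ⟨s₀, hs₀, hs₀C⟩ := exists_cosh_two_mul_eq hC1
  have hC2 : 0 < C ^ 2 - 1 := by nlinarith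
  set l := -k / (C ^ 2 - 1) with hl
  have hl0 : 0 < l := div_pos (by linarith) hC2
  have hkl : k = -l * (C ^ 2 - 1) := by rw [hl]; field_simp
  -- The choice α κ² = -l aligns κ with the focal axis, and k = -l (C² - 1) is the normalisation for
  -- which Q factors as l (cosh 2σ - C)(C - cos 2τ), s = σ + iτ.
  obtain ⟨κ, hκ⟩ := IsAlgClosed.exists_pow_nat_eq (-(l : ℂ) / α) (n := 2) two_pos
  have hκ0 : κ ≠ 0 := by
    rintro rfl
    have h1 : (l : ℂ) ≠ 0 := by exact_mod_cast hl0.ne'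
    have h2 : -(l : ℂ) / α ≠ 0 := div_ne_zero (neg_ne_zero.2 h1) hα0
    exact h2 (by rw [← hκ]; simp)
  have hακ : α * κ ^ 2 = -(l : ℂ) := by rw [hκ]; field_simp
  have hκn : Complex.normSq κ = l / ρ := by
    rw [Complex.normSq_eq_norm_sq, ← norm_pow, hκ, norm_div, norm_neg, Complex.norm_real,
      Real.norm_of_nonneg hl0.le]
  refine ⟨m, κ, s₀, l, hκ0, hs₀, hl0, fun s => ?_⟩
  have hform2 : ∀ u : ℂ, Q.a * u.re ^ 2 + Q.b * u.re * u.im + Q.c * u.im ^ 2 =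
      2 * (α * u ^ 2).re + β * Complex.normSq u := by
    intro u
    simp only [hα, hβ, pow_two, Complex.mul_re, Complex.mul_im, Complex.normSq_apply]
    ring
  rw [hform, hform2, hkl, hs₀C]
  have h1 : α * (κ * Complex.cosh s) ^ 2 = -(l : ℂ) * Complex.cosh s ^ 2 := by
    rw [← hακ]; ring
  have h2 : β * Complex.normSq (κ * Complex.cosh s) =
      2 * l * C * Complex.normSq (Complex.cosh s) := by
    rw [map_mul, hκn, hC]
    field_simp
  have hre : (Complex.cosh s).re = Real.cosh s.re * Real.cos s.im := by
    conv_lhs => rw [← Complex.re_add_im s, Complex.cosh_add, Complex.cosh_mul_I,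
      Complex.sinh_mul_I]
    simp [← Complex.ofReal_cosh,
      ← Complex.ofReal_sinh, ← Complex.ofReal_cos, ← Complex.ofReal_sin]
  have him : (Complex.cosh s).im = Real.sinh s.re * Real.sin s.im := by
    conv_lhs => rw [← Complex.re_add_im s, Complex.cosh_add, Complex.cosh_mul_I,
      Complex.sinh_mul_I]
    simp [← Complex.ofReal_cosh,
      ← Complex.ofReal_sinh, ← Complex.ofReal_cos, ← Complex.ofReal_sin]
  have h3 : (-(l : ℂ) * Complex.cosh s ^ 2).re =
      -l * ((Real.cosh s.re * Real.cos s.im) ^ 2 - (Real.sinh s.re * Real.sin s.im) ^ 2) := by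
    rw [← hre, ← him, ← Complex.ofReal_neg, Complex.re_ofReal_mul, pow_two, Complex.mul_re]
    ring
  have h4 : Complex.normSq (Complex.cosh s) =
      (Real.cosh s.re * Real.cos s.im) ^ 2 + (Real.sinh s.re * Real.sin s.im) ^ 2 := by
    rw [Complex.normSq_apply, hre, him]; ring
  rw [h1, h2, h3, h4, Real.cosh_two_mul, Real.cos_two_mul]
  simp only [mul_pow, Real.sinh_sq, Real.sin_sq]
  ring

/-- The region enclosed by a conic which is not a circumference, when non-empty, is a filled
ellipse. -/
theorem exists_ellipse (Q : Conic) (hQ' : ¬ Q.IsCircumference)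
    (hD : (enclosedRegion Q.locus).Nonempty) :
    IsOpen (enclosedRegion Q.locus) ∧ Bornology.IsBounded (enclosedRegion Q.locus) ∧
    ∃ m κ : ℂ, ∃ s₀ : ℝ, κ ≠ 0 ∧ 0 < s₀ ∧
      (∀ s : ℂ, |s.re| < s₀ → m + κ * Complex.cosh s ∈ enclosedRegion Q.locus) ∧
      (∀ z ∈ enclosedRegion Q.locus, ∃ s : ℂ, |s.re| < s₀ ∧ m + κ * Complex.cosh s = z) ∧
      ∀ s : ℂ, s.re = s₀ → m + κ * Complex.cosh s ∈ Q.locus := by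
  have hdisc := Q.discrim_pos_of_nonempty hD
  have ha : Q.a ≠ 0 := by
    intro h
    rw [h] at hdisc
    nlinarith [sq_nonneg Q.b]
  obtain ⟨z₁, hz₁⟩ := hD
  -- Multiplying by a makes the leading coefficient a² positive without changing the locus; the
  -- interior becomes a Q < 0.
  set Q' : Conic := ⟨Q.a * Q.a, Q.a * Q.b, Q.a * Q.c, Q.a * Q.d, Q.a * Q.e, Q.a * Q.f⟩ with hQdef
  have hQe : ∀ x y, Q'.eval x y = Q.a * Q.eval x y := fun x y => by
    simp only [hQdef, eval]; ring
  obtain ⟨m, κ, s₀, l, hκ, hs₀, hl, hpar⟩ := Q'.exists_param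
    (fun h => hQ' ⟨mul_left_cancel₀ ha h.1, (mul_eq_zero.1 h.2).resolve_left ha⟩)
    (by simp only [hQdef]; exact mul_self_pos.2 ha)
    (by
      have : 0 < Q.a ^ 2 * (4 * Q.a * Q.c - Q.b ^ 2) := by positivity
      simp only [hQdef]
      linarith)
    (z₁ := z₁) (by rw [hQe]; exact Q.eval_mul_neg_of_mem hz₁)
  simp only [hQe] at hpar
  have hC : ∀ τ : ℝ, 0 < Real.cosh (2 * s₀) - Real.cos τ := fun τ => by
    have h1 : 1 < Real.cosh (2 * s₀) := Real.one_lt_cosh.2 (by positivity)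
    linarith [Real.cos_le_one τ]
  have hlt : ∀ s : ℂ, Real.cosh (2 * s.re) < Real.cosh (2 * s₀) ↔ |s.re| < s₀ := fun s => by
    rw [Real.cosh_lt_cosh, abs_mul, abs_mul, abs_of_pos hs₀]
    simp
  have hneg : ∀ s : ℂ, Q.a * Q.eval (m + κ * Complex.cosh s).re (m + κ * Complex.cosh s).im < 0 ↔
      |s.re| < s₀ := fun s => by
    rw [← hlt, hpar]
    constructor
    · intro h
      by_contra! h1
      have := mul_nonneg (mul_nonneg hl.le (sub_nonneg.2 h1)) (hC (2 * s.im)).le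
      linarith
    · intro h
      exact mul_neg_of_neg_of_pos (mul_neg_of_pos_of_neg hl (sub_neg.2 h)) (hC _)
  have hsurj : ∀ z : ℂ, ∃ s : ℂ, m + κ * Complex.cosh s = z := fun z => by
    obtain ⟨x, hx⟩ := Complex.cos_surjective ((z - m) / κ)
    refine ⟨x * Complex.I, ?_⟩
    rw [Complex.cosh_mul_I, hx]
    field_simp
    ring
  have hbdd : Bornology.IsBounded {z : ℂ | Q.a * Q.eval z.re z.im < 0} := by
    refine isBounded_iff_forall_norm_le.2 ⟨‖m‖ + ‖κ‖ * Real.exp s₀, fun z hz => ?_⟩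
    obtain ⟨s, rfl⟩ := hsurj z
    have hs := abs_lt.1 ((hneg s).1 hz)
    refine (norm_add_le _ _).trans ?_
    rw [norm_mul]
    gcongr
    have h1 : ‖Complex.exp s‖ ≤ Real.exp s₀ := by
      rw [Complex.norm_exp]; exact Real.exp_le_exp.2 hs.2.le
    have h2 : ‖Complex.exp (-s)‖ ≤ Real.exp s₀ := by
      rw [Complex.norm_exp]; exact Real.exp_le_exp.2 (by rw [Complex.neg_re]; linarith)
    rw [Complex.cosh, norm_div, Complex.norm_ofNat]
    linarith [norm_add_le (Complex.exp s) (Complex.exp (-s))]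
  have hmem : enclosedRegion Q.locus = {z : ℂ | Q.a * Q.eval z.re z.im < 0} := by
    ext z
    refine ⟨Q.eval_mul_neg_of_mem, fun hz => ?_⟩
    simp only [mem_ofPred_eq] at hz
    have hzc : z ∈ Q.locusᶜ := fun h => by
      have : Q.eval z.re z.im = 0 := h
      rw [this, mul_zero] at hz
      exact lt_irrefl _ hz
    refine ⟨hzc, hbdd.subset fun y hy => ?_⟩
    simp only [mem_ofPred_eq]
    by_contra! h
    -- A component that left the bounded set a Q < 0 would meet the conic, by the intermediate value
    -- theorem.
    have hcont : ContinuousOn (fun z : ℂ => Q.a * Q.eval z.re z.im)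
        (connectedComponentIn Q.locusᶜ z) := (continuous_const.mul Q.continuous_eval).continuousOn
    obtain ⟨t, ht, ht0⟩ := isPreconnected_connectedComponentIn.intermediate_value
      (mem_connectedComponentIn hzc) hy hcont ⟨hz.le, h⟩
    have h1 : Q.eval t.re t.im = 0 := (mul_eq_zero.1 ht0).resolve_left ha
    exact connectedComponentIn_subset _ _ ht h1
  rw [hmem]
  refine ⟨isOpen_lt (continuous_const.mul Q.continuous_eval) continuous_const, hbdd, m, κ, s₀,
    hκ, hs₀, fun s hs => (hneg s).2 hs, fun z hz => ?_, fun s hs => ?_⟩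
  · obtain ⟨s, rfl⟩ := hsurj z
    exact ⟨s, (hneg s).1 hz, rfl⟩
  · have h1 := hpar s
    rw [hs, sub_self, mul_zero, zero_mul] at h1
    exact (mul_eq_zero.1 h1).resolve_left ha

end Conic

/-! ### Bianalytic polynomials with prescribed values on the conic -/

/-- Bivariate complex polynomials of total degree at most `n`. -/
def bivariateDegreeLE (n : ℕ) : Submodule ℂ (Polynomial (Polynomial ℂ)) where
  carrier := {p | ∀ k l, n < k + l → (p.coeff k).coeff l = 0}
  add_mem' := fun {p q} hp hq k l h => by simp [hp k l h, hq k l h]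
  zero_mem' := fun k l _ => by simp
  smul_mem' := fun c p hp k l h => by simp [hp k l h]

theorem bivariateDegreeLE_mono {m n : ℕ} (h : m ≤ n) :
    bivariateDegreeLE m ≤ bivariateDegreeLE n := fun _ hp k l hkl => hp k l (by omega)

theorem mul_mem_bivariateDegreeLE {m n : ℕ} {p q : Polynomial (Polynomial ℂ)}
    (hp : p ∈ bivariateDegreeLE m) (hq : q ∈ bivariateDegreeLE n) :
    p * q ∈ bivariateDegreeLE (m + n) := by
  intro k l hkl
  rw [Polynomial.coeff_mul, Polynomial.finsetSum_coeff]
  refine Finset.sum_eq_zero fun x hx => ?_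
  rw [Polynomial.coeff_mul]
  refine Finset.sum_eq_zero fun y hy => ?_
  rw [Finset.HasAntidiagonal.mem_antidiagonal] at hx hy
  by_cases h : m < x.1 + y.1
  · rw [hp _ _ h, zero_mul]
  · rw [hq x.2 y.2 (by omega), mul_zero]

theorem CC_mem_bivariateDegreeLE (c : ℂ) :
    Polynomial.C (Polynomial.C c) ∈ bivariateDegreeLE 0 := by
  intro k l hkl
  rw [Polynomial.coeff_C]
  split_ifs with h
  · rw [Polynomial.coeff_C, if_neg (by omega)]
  · simp

theorem CX_mem_bivariateDegreeLE :
    (Polynomial.C Polynomial.X : Polynomial (Polynomial ℂ)) ∈ bivariateDegreeLE 1 := by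
  intro k l hkl
  rw [Polynomial.coeff_C]
  split_ifs with h
  · rw [Polynomial.coeff_X, if_neg (by omega)]
  · simp

theorem X_mem_bivariateDegreeLE :
    (Polynomial.X : Polynomial (Polynomial ℂ)) ∈ bivariateDegreeLE 1 := by
  intro k l hkl
  rw [Polynomial.coeff_X]
  split_ifs with h
  · rw [Polynomial.coeff_one, if_neg (by omega)]
  · simp

theorem derivative_mem_bivariateDegreeLE {n : ℕ} {p : Polynomial (Polynomial ℂ)}
    (hp : p ∈ bivariateDegreeLE (n + 1)) : Polynomial.derivative p ∈ bivariateDegreeLE n := by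
  intro k l hkl
  have h : ((k : Polynomial ℂ) + 1) = Polynomial.C ((k : ℂ) + 1) := by simp
  rw [Polynomial.coeff_derivative, h, Polynomial.coeff_mul_C, hp (k + 1) l (by omega), zero_mul]

theorem exists_mem_bivariateDegreeLE (p : Polynomial (Polynomial ℂ)) :
    ∃ n, p ∈ bivariateDegreeLE n := by
  refine ⟨p.natDegree + ∑ k ∈ Finset.range (p.natDegree + 1), (p.coeff k).natDegree,
    fun k l hkl => ?_⟩
  by_cases hk : p.natDegree < k
  · rw [Polynomial.coeff_eq_zero_of_natDegree_lt hk, Polynomial.coeff_zero]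
  · refine Polynomial.coeff_eq_zero_of_natDegree_lt ?_
    have := Finset.single_le_sum (f := fun k => (p.coeff k).natDegree) (fun i _ => Nat.zero_le _)
      (Finset.mem_range.2 (by omega : k < p.natDegree + 1))
    omega

instance (n : ℕ) : FiniteDimensional ℂ (bivariateDegreeLE n) := by
  let F : bivariateDegreeLE n →ₗ[ℂ] (Fin (n + 1) → Fin (n + 1) → ℂ) :=
    { toFun := fun p i j => (p.1.coeff i).coeff j
      map_add' := fun p q => by ext; simp
      map_smul' := fun c p => by ext; simp }
  refine Module.Finite.of_injective F fun p q hpq => ?_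
  ext k l
  by_cases h : n < k + l
  · rw [p.2 k l h, q.2 k l h]
  · exact congrFun (congrFun hpq ⟨k, by omega⟩) ⟨l, by omega⟩

/-- The outer variable stands for z̄, so `derivative` is `∂̄`; in characteristic zero the kernel of
its square is the polynomials of degree at most one in z̄. -/
theorem exists_eq_of_derivative_derivative_eq_zero {p : Polynomial (Polynomial ℂ)}
    (hp : Polynomial.derivative (Polynomial.derivative p) = 0) :
    ∃ f g : Polynomial ℂ, p = Polynomial.C f * Polynomial.X + Polynomial.C g := by
  have h1 := Polynomial.eq_C_of_natDegree_eq_zero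
    (Polynomial.derivative_eq_zero.1 hp)
  set f := (Polynomial.derivative p).coeff 0
  have h2 : Polynomial.derivative (p - Polynomial.C f * Polynomial.X) = 0 := by
    rw [Polynomial.derivative_sub, h1]; simp
  have h3 := Polynomial.eq_C_of_natDegree_eq_zero
    (Polynomial.derivative_eq_zero.1 h2)
  exact ⟨f, _, sub_eq_iff_eq_add'.1 h3⟩

theorem exists_apply_eq_of_injOn {V : Type*} [AddCommGroup V] [Module ℂ V] {W : Submodule ℂ V}
    [FiniteDimensional ℂ W] (L : V →ₗ[ℂ] V) (hmaps : ∀ r ∈ W, L r ∈ W)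
    (hinj : ∀ r ∈ W, L r = 0 → r = 0) {y : V} (hy : y ∈ W) : ∃ r, L r = y := by
  have h : Function.Injective (L.restrict hmaps) := by
    rw [← LinearMap.ker_eq_bot, LinearMap.ker_eq_bot']
    exact fun r h0 => Subtype.ext (hinj r.1 r.2 (congrArg Subtype.val h0))
  obtain ⟨r, hr⟩ := LinearMap.injective_iff_surjective.1 h ⟨y, hy⟩
  exact ⟨r, congrArg Subtype.val hr⟩

/-- The operator `r ↦ ∂̄² (q r)` on polynomials in `z` and `z̄`. -/
def fischerOperator (q : Polynomial (Polynomial ℂ)) :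
    Polynomial (Polynomial ℂ) →ₗ[ℂ] Polynomial (Polynomial ℂ) where
  toFun r := Polynomial.derivative (Polynomial.derivative (q * r))
  map_add' r s := by simp only [mul_add, Polynomial.derivative_add]
  map_smul' c r := by simp only [mul_smul_comm, Polynomial.derivative_smul, RingHom.id_apply]

/-- If bianalytic polynomials are determined by their values on the quadratic curve `q = 0`, then
every polynomial agrees on that curve with a bianalytic one. -/
theorem exists_bianalytic_polynomial {Γ : Set ℂ} {q : Polynomial (Polynomial ℂ)} (hq0 : q ≠ 0)
    (hq : q ∈ bivariateDegreeLE 2) (hqΓ : ∀ z ∈ Γ, q.evalEval z ((starRingEnd ℂ) z) = 0)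
    (huniq : ∀ f g : Polynomial ℂ, (∀ z ∈ Γ, (starRingEnd ℂ) z * f.eval z + g.eval z = 0) →
      f = 0 ∧ g = 0) (p : Polynomial (Polynomial ℂ)) :
    ∃ f g : Polynomial ℂ, ∀ z ∈ Γ,
      p.evalEval z ((starRingEnd ℂ) z) = (starRingEnd ℂ) z * f.eval z + g.eval z := by
  have hev : ∀ (f g : Polynomial ℂ) (z : ℂ),
      (Polynomial.C f * Polynomial.X + Polynomial.C g).evalEval z ((starRingEnd ℂ) z) =
        (starRingEnd ℂ) z * f.eval z + g.eval z := fun f g z => by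
    rw [Polynomial.evalEval_add, Polynomial.evalEval_mul, Polynomial.evalEval_C,
      Polynomial.evalEval_C, Polynomial.evalEval_X, mul_comm]
  obtain ⟨n, hn⟩ := exists_mem_bivariateDegreeLE p
  set L0 := fischerOperator q
  have hL0 : ∀ r, L0 r = Polynomial.derivative (Polynomial.derivative (q * r)) := fun r => rfl
  -- Multiplication by q raises the degree by at most two and `∂̄`² lowers it by two.
  have hmaps : ∀ r ∈ bivariateDegreeLE n, L0 r ∈ bivariateDegreeLE n := fun r hr => by
    have h1 : q * r ∈ bivariateDegreeLE (n + 1 + 1) :=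
      bivariateDegreeLE_mono (by omega) (mul_mem_bivariateDegreeLE hq hr)
    rw [hL0]
    exact derivative_mem_bivariateDegreeLE (derivative_mem_bivariateDegreeLE h1)
  -- An r in the kernel makes q r bianalytic; it vanishes on Γ together with q, hence identically.
  have hinj : ∀ r ∈ bivariateDegreeLE n, L0 r = 0 → r = 0 := by
    intro r _ h1
    obtain ⟨f, g, hfg⟩ := exists_eq_of_derivative_derivative_eq_zero ((hL0 r).symm.trans h1)
    obtain ⟨rfl, rfl⟩ := huniq f g fun z hz => by
      rw [← hev, ← hfg, Polynomial.evalEval_mul, hqΓ z hz, zero_mul]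
    have h2 : q * r = 0 := by rw [hfg]; simp
    exact (mul_eq_zero.1 h2).resolve_left hq0
  have hp : Polynomial.derivative (Polynomial.derivative p) ∈ bivariateDegreeLE n :=
    derivative_mem_bivariateDegreeLE (bivariateDegreeLE_mono (Nat.le_succ n)
      (derivative_mem_bivariateDegreeLE (bivariateDegreeLE_mono (Nat.le_succ n) hn)))
  obtain ⟨r, h1⟩ := exists_apply_eq_of_injOn L0 hmaps hinj hp
  have h2 : Polynomial.derivative (Polynomial.derivative (p - q * r)) = 0 := by
    rw [Polynomial.derivative_sub, Polynomial.derivative_sub, ← hL0, h1]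
    exact sub_self _
  obtain ⟨f, g, hfg⟩ := exists_eq_of_derivative_derivative_eq_zero h2
  refine ⟨f, g, fun z hz => ?_⟩
  rw [← hev, ← hfg, Polynomial.evalEval_sub, Polynomial.evalEval_mul, hqΓ z hz]
  ring

/-- The polynomial `x = (z + z̄) / 2` in the variables `z` and `z̄`. -/
def bivariateRe : Polynomial (Polynomial ℂ) :=
  Polynomial.C (Polynomial.C (1 / 2)) * (Polynomial.C Polynomial.X + Polynomial.X)

/-- The polynomial `y = (z - z̄) / (2i)` in the variables `z` and `z̄`. -/
def bivariateIm : Polynomial (Polynomial ℂ) :=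
  Polynomial.C (Polynomial.C (-Complex.I / 2)) * (Polynomial.C Polynomial.X - Polynomial.X)

theorem evalEval_bivariateRe (z : ℂ) : bivariateRe.evalEval z ((starRingEnd ℂ) z) = z.re := by
  rw [bivariateRe, Polynomial.evalEval_mul, Polynomial.evalEval_add, Polynomial.evalEval_C,
    Polynomial.evalEval_C, Polynomial.evalEval_X, Polynomial.eval_C, Polynomial.eval_X,
    Complex.add_conj]
  push_cast
  ring

theorem evalEval_bivariateIm (z : ℂ) : bivariateIm.evalEval z ((starRingEnd ℂ) z) = z.im := by
  rw [bivariateIm, Polynomial.evalEval_mul, Polynomial.evalEval_sub, Polynomial.evalEval_C,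
    Polynomial.evalEval_C, Polynomial.evalEval_X, Polynomial.eval_C, Polynomial.eval_X,
    Complex.sub_conj]
  push_cast
  linear_combination (-(z.im : ℂ)) * Complex.I_sq

theorem bivariateRe_mem : bivariateRe ∈ bivariateDegreeLE 1 :=
  mul_mem_bivariateDegreeLE (m := 0) (CC_mem_bivariateDegreeLE _)
    (add_mem CX_mem_bivariateDegreeLE X_mem_bivariateDegreeLE)

theorem bivariateIm_mem : bivariateIm ∈ bivariateDegreeLE 1 :=
  mul_mem_bivariateDegreeLE (m := 0) (CC_mem_bivariateDegreeLE _)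
    (sub_mem CX_mem_bivariateDegreeLE X_mem_bivariateDegreeLE)

/-- The polynomial of a conic in the variables `z` and `z̄`. -/
def Conic.bivariate (Q : Conic) : Polynomial (Polynomial ℂ) :=
  Polynomial.C (Polynomial.C (Q.a : ℂ)) * (bivariateRe * bivariateRe) +
  Polynomial.C (Polynomial.C (Q.b : ℂ)) * (bivariateRe * bivariateIm) +
  Polynomial.C (Polynomial.C (Q.c : ℂ)) * (bivariateIm * bivariateIm) +
  Polynomial.C (Polynomial.C (Q.d : ℂ)) * bivariateRe +
  Polynomial.C (Polynomial.C (Q.e : ℂ)) * bivariateIm + Polynomial.C (Polynomial.C (Q.f : ℂ))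

theorem Conic.evalEval_bivariate (Q : Conic) (z : ℂ) :
    Q.bivariate.evalEval z ((starRingEnd ℂ) z) = (Q.eval z.re z.im : ℂ) := by
  simp only [bivariate, Polynomial.evalEval_add, Polynomial.evalEval_mul, Polynomial.evalEval_C,
    Polynomial.eval_C, evalEval_bivariateRe, evalEval_bivariateIm, eval]
  push_cast
  ring

theorem Conic.bivariate_mem (Q : Conic) : Q.bivariate ∈ bivariateDegreeLE 2 := by
  have h0 : ∀ {m : ℕ} (c : ℂ) {p : Polynomial (Polynomial ℂ)}, p ∈ bivariateDegreeLE m →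
      m ≤ 2 → Polynomial.C (Polynomial.C c) * p ∈ bivariateDegreeLE 2 := fun {m} c p hp hm =>
    bivariateDegreeLE_mono (by omega : 0 + m ≤ 2)
      (mul_mem_bivariateDegreeLE (CC_mem_bivariateDegreeLE c) hp)
  refine add_mem (add_mem (add_mem (add_mem (add_mem ?_ ?_) ?_) ?_) ?_) ?_
  · exact h0 _ (mul_mem_bivariateDegreeLE bivariateRe_mem bivariateRe_mem) le_rfl
  · exact h0 _ (mul_mem_bivariateDegreeLE bivariateRe_mem bivariateIm_mem) le_rfl
  · exact h0 _ (mul_mem_bivariateDegreeLE bivariateIm_mem bivariateIm_mem) le_rfl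
  · exact h0 _ bivariateRe_mem one_le_two
  · exact h0 _ bivariateIm_mem one_le_two
  · exact bivariateDegreeLE_mono (by omega) (CC_mem_bivariateDegreeLE _)

theorem exists_bivariate_evalEval_eq (P : MvPolynomial (Fin 2) ℂ) :
    ∃ p : Polynomial (Polynomial ℂ), ∀ z : ℂ,
      p.evalEval z ((starRingEnd ℂ) z) = MvPolynomial.eval ![(z.re : ℂ), (z.im : ℂ)] P := by
  induction P using MvPolynomial.induction_on with
  | C c => exact ⟨Polynomial.C (Polynomial.C c), fun z => by simp⟩
  | add P₁ P₂ h₁ h₂ =>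
    obtain ⟨p₁, h₁⟩ := h₁
    obtain ⟨p₂, h₂⟩ := h₂
    exact ⟨p₁ + p₂, fun z => by rw [Polynomial.evalEval_add, h₁, h₂, map_add]⟩
  | mul_X P₁ i h₁ =>
    obtain ⟨p₁, h₁⟩ := h₁
    refine ⟨p₁ * ![bivariateRe, bivariateIm] i, fun z => ?_⟩
    rw [Polynomial.evalEval_mul, h₁, map_mul, MvPolynomial.eval_X]
    fin_cases i
    · simp [evalEval_bivariateRe]
    · simp [evalEval_bivariateIm]

/-- On a non-circular ellipse every polynomial in `x, y` agrees with a bianalytic polynomial. -/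
theorem Conic.exists_bianalytic_eq_on_locus (Q : Conic) (hQ' : ¬ Q.IsCircumference)
    (hD : (enclosedRegion Q.locus).Nonempty) (P : MvPolynomial (Fin 2) ℂ) :
    ∃ f g : Polynomial ℂ, ∀ z ∈ Q.locus,
      MvPolynomial.eval ![(z.re : ℂ), (z.im : ℂ)] P =
        (starRingEnd ℂ) z * f.eval z + g.eval z := by
  obtain ⟨hDo, -, m, κ, s₀, hκ, hs₀, hDm, hDs, hΓ⟩ := Q.exists_ellipse hQ' hD
  obtain ⟨p, hp⟩ := exists_bivariate_evalEval_eq P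
  obtain ⟨z₁, hz₁⟩ := hD
  have hinf : (enclosedRegion Q.locus).Infinite := infinite_of_mem_nhds z₁ (hDo.mem_nhds hz₁)
  obtain ⟨f, g, hfg⟩ := exists_bianalytic_polynomial (Γ := Q.locus) (q := Q.bivariate)
    (fun h => hz₁.1 (by
      have := Q.evalEval_bivariate z₁
      rw [h, Polynomial.evalEval_zero] at this
      exact_mod_cast this.symm)) Q.bivariate_mem
    (fun z hz => by rw [Q.evalEval_bivariate, show Q.eval z.re z.im = 0 from hz]; simp)
    (fun f g h => by
      have h1 := bianalytic_eq_zero hDo hκ hs₀ hDm hDs hΓ (f := fun z => f.eval z)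
        (g := fun z => g.eval z) (φ := fun z => (starRingEnd ℂ) z * f.eval z + g.eval z)
        f.differentiable.differentiableOn g.differentiable.differentiableOn
        (((Complex.continuous_conj.mul f.continuous).add g.continuous).continuousOn)
        (fun z _ => rfl) h
      exact ⟨Polynomial.eq_zero_of_infinite_isRoot f (hinf.mono fun z hz => (h1 z hz).1),
        Polynomial.eq_zero_of_infinite_isRoot g (hinf.mono fun z hz => (h1 z hz).2)⟩) p
  exact ⟨f, g, fun z hz => by rw [← hp, hfg z hz]⟩

/-! ### The complex Dirichlet problem -/

theorem HasWeakComplexDbar.congr_right {D : Set ℂ} (hD : MeasurableSet D) {w g g' : ℂ → ℂ}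
    (h : HasWeakComplexDbar D w g) (hg : EqOn g g' D) : HasWeakComplexDbar D w g' := by
  refine ⟨h.1, h.2.1.congr ?_, fun φ hφ => ?_⟩
  · filter_upwards [ae_restrict_mem hD] with z hz using hg hz
  · rw [h.2.2 φ hφ]
    congr 1
    refine setIntegral_congr_fun hD fun z hz => ?_
    simp only [hg hz]

theorem dbar_conj_mul_add {f g : ℂ → ℂ} (hf : Differentiable ℂ f) (hg : Differentiable ℂ g)
    (z : ℂ) : dbar (fun z => (starRingEnd ℂ) z * f z + g z) z = f z := by
  have hcd : DifferentiableAt ℝ (starRingEnd ℂ) z := Complex.conjCLE.differentiableAt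
  have hfr := (hf z).restrictScalars ℝ
  have hgr := (hg z).restrictScalars ℝ
  have h1 : dbar (fun z => (starRingEnd ℂ) z * f z + g z) z =
      dbar (fun z => (starRingEnd ℂ) z * f z) z + dbar g z := by
    have h2 : fderiv ℝ (fun z => (starRingEnd ℂ) z * f z + g z) z =
        fderiv ℝ (fun z => (starRingEnd ℂ) z * f z) z + fderiv ℝ g z :=
      fderiv_fun_add (hcd.mul hfr) hgr
    simp only [dbar, h2, add_apply]
    ring
  rw [h1, dbar_mul hcd hfr, dbar_eq_zero_of_differentiableAt (hf z),
    dbar_eq_zero_of_differentiableAt (hg z), dbar_conj]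
  ring

theorem boundedPotential_indicator {D : Set ℂ} (hDo : IsOpen D) (hDb : Bornology.IsBounded D)
    {q : ℝ} (hq : 2 < q) {A : ℂ → ℂ} (hA : MemLp A (ENNReal.ofReal q) (volume.restrict D)) :
    BoundedPotential (D.indicator A) ∧ Integrable (D.indicator A) ∧
      Continuous (cauchyTransform (D.indicator A)) := by
  have hD' : volume D ≠ ⊤ := hDb.measure_lt_top.ne
  have : IsFiniteMeasure (volume.restrict D) := ⟨by simpa using hD'.lt_top⟩
  exact ⟨.of_memLp hDo.measurableSet hD' hq hA, (integrable_indicator_iff hDo.measurableSet).2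
    (hA.integrable (by simpa using by linarith)),
    continuous_cauchyTransform_indicator hDo.measurableSet hD' hq hA⟩

/-- Existence for the complex Dirichlet problem with boundary data `exp (T A) P`. -/
theorem Conic.exists_complex_solution (Q : Conic) (hQ' : ¬ Q.IsCircumference)
    (hD : (enclosedRegion Q.locus).Nonempty) (P : MvPolynomial (Fin 2) ℂ) {q : ℝ} (hq : 2 < q)
    {A : ℂ → ℂ} (hA : MemLp A (ENNReal.ofReal q) (volume.restrict (enclosedRegion Q.locus))) :
    ∃ w v : ℂ → ℂ, Continuous w ∧
      HasWeakComplexDbar (enclosedRegion Q.locus) w (fun z => A z * w z + v z) ∧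
      HasWeakComplexDbar (enclosedRegion Q.locus) v (fun z => A z * v z) ∧
      ∀ z ∈ Q.locus, w z =
        Complex.exp (cauchyTransform ((enclosedRegion Q.locus).indicator A) z) *
          MvPolynomial.eval ![(z.re : ℂ), (z.im : ℂ)] P := by
  obtain ⟨hDo, hDb, -⟩ := Q.exists_ellipse hQ' hD
  obtain ⟨f, g, hfg⟩ := Q.exists_bianalytic_eq_on_locus hQ' hD P
  set D := enclosedRegion Q.locus
  obtain ⟨hB, hBi, hTc⟩ := boundedPotential_indicator hDo hDb hq hA
  have hfs : ContDiff ℝ ∞ fun z => f.eval z :=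
    (f.differentiable.contDiff : ContDiff ℂ ∞ fun z => f.eval z).restrict_scalars ℝ
  have hgs : ContDiff ℝ ∞ fun z => g.eval z :=
    (g.differentiable.contDiff : ContDiff ℂ ∞ fun z => g.eval z).restrict_scalars ℝ
  have hφs : ContDiff ℝ ∞ fun z => (starRingEnd ℂ) z * f.eval z + g.eval z :=
    (Complex.conjCLE.contDiff.mul hfs).add hgs
  refine ⟨fun z => Complex.exp (cauchyTransform (D.indicator A) z) *
      ((starRingEnd ℂ) z * f.eval z + g.eval z),
    fun z => Complex.exp (cauchyTransform (D.indicator A) z) * f.eval z,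
    (Complex.continuous_exp.comp hTc).mul hφs.continuous,
    (hasWeakComplexDbar_exp_mul hB hBi hTc hφs).congr_right hDo.measurableSet ?_,
    (hasWeakComplexDbar_exp_mul hB hBi hTc hfs).congr_right hDo.measurableSet ?_, ?_⟩
  · intro z hz
    simp only [indicator_of_mem hz, dbar_conj_mul_add f.differentiable
      g.differentiable]
  · intro z hz
    simp only [indicator_of_mem hz, dbar_eq_zero_of_differentiableAt (f.differentiable z)]
    ring
  · intro z hz
    rw [hfg z hz]

/-- Uniqueness for the complex Dirichlet problem. -/
theorem Conic.eqOn_of_complex_solutions (Q : Conic) (hQ' : ¬ Q.IsCircumference)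
    (hD : (enclosedRegion Q.locus).Nonempty) {q : ℝ} (hq : 2 < q) {A : ℂ → ℂ}
    (hA : MemLp A (ENNReal.ofReal q) (volume.restrict (enclosedRegion Q.locus)))
    {w₁ v₁ w₂ v₂ : ℂ → ℂ} (hc₁ : ContinuousOn w₁ (enclosedRegion Q.locus ∪ Q.locus))
    (hc₂ : ContinuousOn w₂ (enclosedRegion Q.locus ∪ Q.locus))
    (hw₁ : HasWeakComplexDbar (enclosedRegion Q.locus) w₁ fun z => A z * w₁ z + v₁ z)
    (hv₁ : HasWeakComplexDbar (enclosedRegion Q.locus) v₁ fun z => A z * v₁ z)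
    (hw₂ : HasWeakComplexDbar (enclosedRegion Q.locus) w₂ fun z => A z * w₂ z + v₂ z)
    (hv₂ : HasWeakComplexDbar (enclosedRegion Q.locus) v₂ fun z => A z * v₂ z)
    (hb : EqOn w₁ w₂ Q.locus) : EqOn w₁ w₂ (enclosedRegion Q.locus ∪ Q.locus) := by
  obtain ⟨hDo, hDb, m, κ, s₀, hκ, hs₀, hDm, hDs, hΓ⟩ := Q.exists_ellipse hQ' hD
  set D := enclosedRegion Q.locus
  obtain ⟨hB, hBi, hTc⟩ := boundedPotential_indicator hDo hDb hq hA
  have key : ∀ {w v : ℂ → ℂ}, ContinuousOn w (D ∪ Q.locus) →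
      (HasWeakComplexDbar D w fun z => A z * w z + v z) →
      (HasWeakComplexDbar D v fun z => A z * v z) →
      ∃ f g : ℂ → ℂ, DifferentiableOn ℂ f D ∧ DifferentiableOn ℂ g D ∧
        ∀ z ∈ D, Complex.exp (-cauchyTransform (D.indicator A) z) * w z =
          (starRingEnd ℂ) z * f z + g z := by
    intro w v hc hw hv
    refine HasWeakComplexDbar.exists_bianalytic (v := v) hDo hB hTc (hc.mono subset_union_left)
      (hw.congr_right hDo.measurableSet fun z hz => ?_)
      (hv.congr_right hDo.measurableSet fun z hz => ?_)
    · simp only [indicator_of_mem hz]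
    · simp only [indicator_of_mem hz]
  obtain ⟨f₁, g₁, hf₁, hg₁, h₁⟩ := key hc₁ hw₁ hv₁
  obtain ⟨f₂, g₂, hf₂, hg₂, h₂⟩ := key hc₂ hw₂ hv₂
  have hE : Continuous fun z => Complex.exp (-cauchyTransform (D.indicator A) z) :=
    Complex.continuous_exp.comp hTc.neg
  have hzero := bianalytic_eq_zero hDo hκ hs₀ hDm hDs hΓ (f := fun z => f₁ z - f₂ z)
    (g := fun z => g₁ z - g₂ z)
    (φ := fun z => Complex.exp (-cauchyTransform (D.indicator A) z) * (w₁ z - w₂ z))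
    (hf₁.sub hf₂) (hg₁.sub hg₂) (hE.continuousOn.mul (hc₁.sub hc₂))
    (fun z hz => by
      rw [mul_sub, h₁ z hz, h₂ z hz]
      ring)
    (fun z hz => by simp only [hb hz, sub_self, mul_zero])
  rintro z (hz | hz)
  · have h3 := h₁ z hz
    rw [sub_eq_zero.1 (hzero z hz).1, sub_eq_zero.1 (hzero z hz).2, ← h₂ z hz] at h3
    exact mul_left_cancel₀ (Complex.exp_ne_zero _) h3
  · exact hb hz

/-! ### Splitting the bicomplex problem into components -/

namespace Bicomplex

theorem plus_ofComplex (z : ℂ) : (ofComplex z).plus = z := by simp [plus, ofComplex]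

theorem minus_ofComplex (z : ℂ) : (ofComplex z).minus = z := by simp [minus, ofComplex]

theorem plus_mul (v w : Bicomplex) : (v * w).plus = v.plus * w.plus := by
  simp [plus]
  linear_combination (-v.im * w.im) * Complex.I_sq

theorem minus_mul (v w : Bicomplex) : (v * w).minus = v.minus * w.minus := by
  simp [minus]
  linear_combination (-v.im * w.im) * Complex.I_sq

theorem plus_one : (1 : Bicomplex).plus = 1 := by
  simpa [ofComplex] using plus_ofComplex 1

theorem minus_one : (1 : Bicomplex).minus = 1 := by
  simpa [ofComplex] using minus_ofComplex 1

/-- `w ↦ conj w⁺` as a ring homomorphism. -/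
def conjPlusHom : Bicomplex →+* ℂ where
  toFun w := (starRingEnd ℂ) w.plus
  map_one' := by rw [plus_one, map_one]
  map_mul' v w := by rw [plus_mul, map_mul]
  map_zero' := by simp [plus]
  map_add' v w := by rw [← map_add]; congr 1; simp [plus]; ring

/-- `w ↦ w⁻` as a ring homomorphism. -/
def minusHom : Bicomplex →+* ℂ where
  toFun w := w.minus
  map_one' := minus_one
  map_mul' := minus_mul
  map_zero' := by simp [minus]
  map_add' v w := by simp [minus]; ring

theorem conjPlusHom_smul (r : ℝ) (w : Bicomplex) : conjPlusHom (r • w) = r • conjPlusHom w := by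
  simp [conjPlusHom, plus]
  ring

theorem minusHom_smul (r : ℝ) (w : Bicomplex) : minusHom (r • w) = r • minusHom w := by
  simp [minusHom, minus]
  ring

instance : FiniteDimensional ℝ Bicomplex := by
  have : FiniteDimensional ℝ (EuclideanSpace ℂ (Fin 2)) := FiniteDimensional.trans ℝ ℂ _
  refine Module.Finite.of_injective toEuclidean ?_
  rw [← LinearMap.ker_eq_bot, LinearMap.ker_eq_bot']
  intro w hw
  exact eq_zero_of_norm_eq_zero w (by rw [norm_eq_norm_toEuclidean, hw, norm_zero])

/-- `w ↦ conj w⁺` as a continuous linear map. -/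
def conjPlusCLM : Bicomplex →L[ℝ] ℂ :=
  LinearMap.toContinuousLinearMap
    { toFun := conjPlusHom
      map_add' := map_add conjPlusHom
      map_smul' := conjPlusHom_smul }

/-- `w ↦ w⁻` as a continuous linear map. -/
def minusCLM : Bicomplex →L[ℝ] ℂ :=
  LinearMap.toContinuousLinearMap
    { toFun := minusHom
      map_add' := map_add minusHom
      map_smul' := minusHom_smul }

/-- The bicomplex number with `conj w⁺ = a` and `w⁻ = b`. -/
def ofComponents (p : ℂ × ℂ) : Bicomplex :=
  pPlus * ofComplex ((starRingEnd ℂ) p.1) + pMinus * ofComplex p.2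

theorem plus_pPlus : pPlus.plus = 1 := by
  have h1 : (1 : Bicomplex).re = 1 := rfl
  have h2 : (1 : Bicomplex).im = 0 := rfl
  simp [pPlus, plus, ofComplex, j, h1, h2]
  linear_combination (-1 / 2) * Complex.I_sq

theorem minus_pPlus : pPlus.minus = 0 := by
  have h1 : (1 : Bicomplex).re = 1 := rfl
  have h2 : (1 : Bicomplex).im = 0 := rfl
  simp [pPlus, minus, ofComplex, j, h1, h2]
  linear_combination (1 / 2) * Complex.I_sq

theorem plus_pMinus : pMinus.plus = 0 := by
  have h1 : (1 : Bicomplex).re = 1 := rfl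
  have h2 : (1 : Bicomplex).im = 0 := rfl
  simp [pMinus, plus, ofComplex, j, h1, h2]
  linear_combination (1 / 2) * Complex.I_sq

theorem minus_pMinus : pMinus.minus = 1 := by
  have h1 : (1 : Bicomplex).re = 1 := rfl
  have h2 : (1 : Bicomplex).im = 0 := rfl
  simp [pMinus, minus, ofComplex, j, h1, h2]
  linear_combination (-1 / 2) * Complex.I_sq

theorem plus_add (v w : Bicomplex) : (v + w).plus = v.plus + w.plus := by
  simp [plus]; ring

theorem minus_add (v w : Bicomplex) : (v + w).minus = v.minus + w.minus := by
  simp [minus]; ring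

theorem plus_idempotent_sum (a b : ℂ) :
    (pPlus * ofComplex a + pMinus * ofComplex b).plus = a := by
  rw [plus_add, plus_mul, plus_mul, plus_pPlus, plus_pMinus, plus_ofComplex]; ring

theorem minus_idempotent_sum (a b : ℂ) :
    (pPlus * ofComplex a + pMinus * ofComplex b).minus = b := by
  rw [minus_add, minus_mul, minus_mul, minus_pPlus, minus_pMinus, minus_ofComplex,
    minus_ofComplex]
  ring

theorem conjPlusHom_ofComponents (p : ℂ × ℂ) : conjPlusHom (ofComponents p) = p.1 := by
  change (starRingEnd ℂ) (ofComponents p).plus = _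
  rw [ofComponents, plus_idempotent_sum, Complex.conj_conj]

theorem minusHom_ofComponents (p : ℂ × ℂ) : minusHom (ofComponents p) = p.2 :=
  minus_idempotent_sum _ _

theorem ofComponents_components (w : Bicomplex) :
    ofComponents (conjPlusHom w, minusHom w) = w := by
  change pPlus * ofComplex ((starRingEnd ℂ) ((starRingEnd ℂ) w.plus)) +
    pMinus * ofComplex w.minus = w
  rw [Complex.conj_conj]
  exact (eq_pPlus_mul_add_pMinus_mul w).symm

theorem ext_components {v w : Bicomplex} (h₁ : conjPlusHom v = conjPlusHom w)
    (h₂ : minusHom v = minusHom w) : v = w := by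
  rw [← ofComponents_components v, h₁, h₂, ofComponents_components]

/-- `ofComponents` as a continuous linear map. -/
def ofComponentsCLM : ℂ × ℂ →L[ℝ] Bicomplex :=
  LinearMap.toContinuousLinearMap
    { toFun := ofComponents
      map_add' := fun p q => ext_components
        (by rw [map_add]; simp only [conjPlusHom_ofComponents, Prod.fst_add])
        (by rw [map_add]; simp only [minusHom_ofComponents, Prod.snd_add])
      map_smul' := fun r p => ext_components
        (by rw [RingHom.id_apply, conjPlusHom_smul]
            simp only [conjPlusHom_ofComponents, Prod.smul_fst])
        (by rw [RingHom.id_apply, minusHom_smul]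
            simp only [minusHom_ofComponents, Prod.smul_snd]) }

theorem integrable_iff_components {μ : Measure ℂ} {F : ℂ → Bicomplex} :
    Integrable F μ ↔
      Integrable (fun z => conjPlusHom (F z)) μ ∧ Integrable (fun z => minusHom (F z)) μ := by
  refine ⟨fun h => ⟨conjPlusCLM.integrable_comp h, minusCLM.integrable_comp h⟩, fun h => ?_⟩
  have h1 := ofComponentsCLM.integrable_comp (h.1.prodMk h.2)
  exact h1.congr (Eventually.of_forall fun z => ofComponents_components (F z))

theorem locallyIntegrableOn_iff_components {D : Set ℂ} {F : ℂ → Bicomplex} :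
    LocallyIntegrableOn F D volume ↔
      LocallyIntegrableOn (fun z => conjPlusHom (F z)) D volume ∧
      LocallyIntegrableOn (fun z => minusHom (F z)) D volume := by
  constructor
  · intro h
    refine ⟨fun x hx => ?_, fun x hx => ?_⟩
    · obtain ⟨s, hs, hi⟩ := h x hx
      exact ⟨s, hs, (integrable_iff_components.1 hi).1⟩
    · obtain ⟨s, hs, hi⟩ := h x hx
      exact ⟨s, hs, (integrable_iff_components.1 hi).2⟩
  · rintro ⟨h₁, h₂⟩ x hx
    obtain ⟨s, hs, hi⟩ := h₁ x hx
    obtain ⟨t, ht, hj⟩ := h₂ x hx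
    exact ⟨s ∩ t, inter_mem hs ht, integrable_iff_components.2
      ⟨hi.mono_set inter_subset_left, hj.mono_set inter_subset_right⟩⟩

theorem conjPlusHom_integral {μ : Measure ℂ} {F : ℂ → Bicomplex} (hF : Integrable F μ) :
    conjPlusHom (∫ z, F z ∂μ) = ∫ z, conjPlusHom (F z) ∂μ :=
  (conjPlusCLM.integral_comp_comm hF).symm

theorem minusHom_integral {μ : Measure ℂ} {F : ℂ → Bicomplex} (hF : Integrable F μ) :
    minusHom (∫ z, F z ∂μ) = ∫ z, minusHom (F z) ∂μ :=
  (minusCLM.integral_comp_comm hF).symm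

theorem fderiv_ofReal_apply {φ : ℂ → ℝ} {z : ℂ} (hφ : DifferentiableAt ℝ φ z) (u : ℂ) :
    fderiv ℝ (fun z => (φ z : ℂ)) z u = (fderiv ℝ φ z u : ℂ) := by
  have h : HasFDerivAt (fun z => (φ z : ℂ)) (Complex.ofRealCLM.comp (fderiv ℝ φ z)) z :=
    Complex.ofRealCLM.hasFDerivAt.comp z hφ.hasFDerivAt
  rw [h.fderiv]
  rfl

/-- The plus component of `j` is -i, and conjugation sends it to i, so the conjugated plus part
carries the same operator as the minus part. -/
theorem conjPlusHom_dbarTest {φ : ℂ → ℝ} {z : ℂ} (hφ : DifferentiableAt ℝ φ z) :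
    conjPlusHom (dbarTest φ z) = dbar (fun z => (φ z : ℂ)) z := by
  have hj : conjPlusHom j = Complex.I := by simp [conjPlusHom, plus, j]
  rw [dbarTest, conjPlusHom_smul, map_add, conjPlusHom_smul, conjPlusHom_smul,
    map_one conjPlusHom, hj, dbar,
    fderiv_ofReal_apply hφ, fderiv_ofReal_apply hφ]
  simp only [Complex.real_smul]
  push_cast
  ring

theorem minusHom_dbarTest {φ : ℂ → ℝ} {z : ℂ} (hφ : DifferentiableAt ℝ φ z) :
    minusHom (dbarTest φ z) = dbar (fun z => (φ z : ℂ)) z := by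
  have hj : minusHom j = Complex.I := by simp [minusHom, minus, j]
  rw [dbarTest, minusHom_smul, map_add, minusHom_smul, minusHom_smul, map_one minusHom, hj, dbar,
    fderiv_ofReal_apply hφ, fderiv_ofReal_apply hφ]
  simp only [Complex.real_smul]
  push_cast
  ring

/-- The bicomplex equation `∂̄ w = g` splits into two complex ones. -/
theorem hasWeakDbar_iff {D : Set ℂ} {w g : ℂ → Bicomplex} :
    HasWeakDbar D w g ↔
      HasWeakComplexDbar D (fun z => conjPlusHom (w z)) (fun z => conjPlusHom (g z)) ∧
      HasWeakComplexDbar D (fun z => minusHom (w z)) (fun z => minusHom (g z)) := by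
  have key : LocallyIntegrableOn w D volume → LocallyIntegrableOn g D volume →
      ∀ φ : ℂ → ℝ, IsTestFunction D φ →
      ((∫ z in D, dbarTest φ z * w z = -∫ z in D, φ z • g z) ↔
        (∫ z in D, dbar (fun z => (φ z : ℂ)) z * conjPlusHom (w z) =
          -∫ z in D, (φ z : ℂ) * conjPlusHom (g z)) ∧
        (∫ z in D, dbar (fun z => (φ z : ℂ)) z * minusHom (w z) =
          -∫ z in D, (φ z : ℂ) * minusHom (g z))) := by
    intro hw hg φ hφ
    obtain ⟨hw1, hw2⟩ := locallyIntegrableOn_iff_components.1 hw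
    obtain ⟨hg1, hg2⟩ := locallyIntegrableOn_iff_components.1 hg
    have hd : ∀ z, DifferentiableAt ℝ φ z := hφ.contDiff.differentiable (by simp)
    have h0 : tsupport (fun z => (φ z : ℂ)) ⊆ tsupport φ :=
      closure_mono fun z hz => by simpa using hz
    have h1 : ContDiff ℝ ∞ fun z => (φ z : ℂ) := Complex.ofRealCLM.contDiff.comp hφ.contDiff
    have h2 : HasCompactSupport fun z => (φ z : ℂ) :=
      hφ.hasCompactSupport.of_isClosed_subset (isClosed_tsupport _) h0
    have e1 : ∀ z, conjPlusHom (dbarTest φ z * w z) =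
        dbar (fun z => (φ z : ℂ)) z * conjPlusHom (w z) := fun z => by
      rw [map_mul, conjPlusHom_dbarTest (hd z)]
    have e2 : ∀ z, minusHom (dbarTest φ z * w z) =
        dbar (fun z => (φ z : ℂ)) z * minusHom (w z) := fun z => by
      rw [map_mul, minusHom_dbarTest (hd z)]
    have e3 : ∀ z, conjPlusHom (φ z • g z) = (φ z : ℂ) * conjPlusHom (g z) := fun z => by
      rw [conjPlusHom_smul, Complex.real_smul]
    have e4 : ∀ z, minusHom (φ z • g z) = (φ z : ℂ) * minusHom (g z) := fun z => by
      rw [minusHom_smul, Complex.real_smul]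
    have hsub := h0.trans hφ.tsupport_subset
    have hsub' := (tsupport_dbar_subset fun z => (φ z : ℂ)).trans hsub
    have i1 : IntegrableOn (fun z => dbarTest φ z * w z) D := by
      refine integrable_iff_components.2 ⟨?_, ?_⟩
      · simp only [e1]
        exact (integrable_mul_of_tsupport_subset hw1 h1.dbar_smooth.continuous
          (hasCompactSupport_dbar h2) hsub').integrableOn
      · simp only [e2]
        exact (integrable_mul_of_tsupport_subset hw2 h1.dbar_smooth.continuous
          (hasCompactSupport_dbar h2) hsub').integrableOn
    have i2 : IntegrableOn (fun z => φ z • g z) D := by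
      refine integrable_iff_components.2 ⟨?_, ?_⟩
      · simp only [e3]
        exact (integrable_mul_of_tsupport_subset hg1 h1.continuous h2 hsub).integrableOn
      · simp only [e4]
        exact (integrable_mul_of_tsupport_subset hg2 h1.continuous h2 hsub).integrableOn
    have c1 := conjPlusHom_integral i1
    have c2 := minusHom_integral i1
    have c3 := conjPlusHom_integral i2
    have c4 := minusHom_integral i2
    simp only [e1, e2, e3, e4] at c1 c2 c3 c4
    rw [← c1, ← c2, ← c3, ← c4, ← map_neg, ← map_neg]
    exact ⟨fun h => ⟨by rw [h], by rw [h]⟩, fun h => ext_components h.1 h.2⟩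
  constructor
  · rintro ⟨hw, hg, h⟩
    obtain ⟨hw1, hw2⟩ := locallyIntegrableOn_iff_components.1 hw
    obtain ⟨hg1, hg2⟩ := locallyIntegrableOn_iff_components.1 hg
    exact ⟨⟨hw1, hg1, fun φ hφ => ((key hw hg φ hφ).1 (h φ hφ)).1⟩,
      ⟨hw2, hg2, fun φ hφ => ((key hw hg φ hφ).1 (h φ hφ)).2⟩⟩
  · rintro ⟨⟨hw1, hg1, h1⟩, ⟨hw2, hg2, h2⟩⟩
    have hw := locallyIntegrableOn_iff_components.2 ⟨hw1, hw2⟩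
    have hg := locallyIntegrableOn_iff_components.2 ⟨hg1, hg2⟩
    exact ⟨hw, hg, fun φ hφ => (key hw hg φ hφ).2 ⟨h1 φ hφ, h2 φ hφ⟩⟩

theorem minusHom_vekuaOperator {D : Set ℂ} (hD : MeasurableSet D) (A : ℂ → Bicomplex) (z : ℂ) :
    minusHom (vekuaOperator D A z) = cauchyTransform (D.indicator fun z => minusHom (A z)) z := by
  change (vekuaOperator D A z).minus = _
  rw [vekuaOperator, minus_idempotent_sum, cauchyTransform, ← integral_indicator hD]
  congr 2 with ζ
  by_cases hζ : ζ ∈ D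
  · simp [hζ, minusHom]
  · simp [hζ]

/-- The plus kernel 1/(ζ̄ - z̄) is the conjugate of the Cauchy kernel, so conjugating the integral
gives an ordinary Cauchy transform. -/
theorem conjPlusHom_vekuaOperator {D : Set ℂ} (hD : MeasurableSet D) (A : ℂ → Bicomplex)
    (z : ℂ) : conjPlusHom (vekuaOperator D A z) =
      cauchyTransform (D.indicator fun z => conjPlusHom (A z)) z := by
  change (starRingEnd ℂ) (vekuaOperator D A z).plus = _
  rw [vekuaOperator, plus_idempotent_sum, cauchyTransform, map_mul, ← integral_conj,
    ← integral_indicator hD]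
  congr 1
  · simp
  · congr 1 with ζ
    by_cases hζ : ζ ∈ D
    · simp [hζ, conjPlusHom]
    · simp [hζ]

theorem conjPlusHom_exp (w : Bicomplex) :
    conjPlusHom (exp w) = Complex.exp (conjPlusHom w) := by
  change (starRingEnd ℂ) (exp w).plus = Complex.exp ((starRingEnd ℂ) w.plus)
  rw [exp, plus_idempotent_sum, Complex.exp_conj]

theorem minusHom_exp (w : Bicomplex) : minusHom (exp w) = Complex.exp (minusHom w) :=
  minus_idempotent_sum _ _

/-- The arguments x and y are real and fixed by σ, so only the coefficients of P change. -/
theorem map_evalPoly {σ : Bicomplex →+* ℂ} (hσ : ∀ x : ℝ, σ (ofComplex x) = x)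
    (P : MvPolynomial (Fin 2) Bicomplex) (z : ℂ) :
    σ (evalPoly P z) = MvPolynomial.eval ![(z.re : ℂ), (z.im : ℂ)] (P.map σ) := by
  rw [evalPoly, MvPolynomial.eval_map, ← MvPolynomial.eval₂_id, MvPolynomial.hom_eval₂]
  congr 1
  ext i
  fin_cases i
  · exact hσ _
  · exact hσ _

theorem conjPlusHom_ofComplex_ofReal (x : ℝ) : conjPlusHom (ofComplex x) = x := by
  change (starRingEnd ℂ) (ofComplex x).plus = _
  rw [plus_ofComplex, Complex.conj_ofReal]

theorem minusHom_ofComplex_ofReal (x : ℝ) : minusHom (ofComplex x) = x := minus_ofComplex _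

end Bicomplex

end

theorem mainTheorem2 (Q : Conic) (hQ : Q.NonDegenerate) (hQ' : ¬ Q.IsCircumference)
    (hD : (enclosedRegion Q.locus).Nonempty)
    (P : MvPolynomial (Fin 2) Bicomplex) (q : ℝ) (hq : 2 < q)
    (A : ℂ → Bicomplex) (hA : MemSobolevOne (enclosedRegion Q.locus) q A) :
    ∃ w : ℂ → Bicomplex,
      SolvesDirichlet (enclosedRegion Q.locus) Q.locus A
        (fun z => Bicomplex.exp (vekuaOperator (enclosedRegion Q.locus) A z) * evalPoly P z) w ∧
      ∀ w' : ℂ → Bicomplex,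
        SolvesDirichlet (enclosedRegion Q.locus) Q.locus A
          (fun z => Bicomplex.exp (vekuaOperator (enclosedRegion Q.locus) A z) * evalPoly P z)
          w' →
        Set.EqOn w' w (enclosedRegion Q.locus ∪ Q.locus) := by
  have hDm : MeasurableSet (enclosedRegion Q.locus) := (Q.exists_ellipse hQ' hD).1.measurableSet
  have hA₁ : MemLp (fun z => Bicomplex.conjPlusHom (A z)) (ENNReal.ofReal q)
      (volume.restrict (enclosedRegion Q.locus)) := Bicomplex.conjPlusCLM.comp_memLp' hA.1
  have hA₂ : MemLp (fun z => Bicomplex.minusHom (A z)) (ENNReal.ofReal q)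
      (volume.restrict (enclosedRegion Q.locus)) := Bicomplex.minusCLM.comp_memLp' hA.1
  obtain ⟨w₁, v₁, hc₁, hw₁, hv₁, hb₁⟩ :=
    Q.exists_complex_solution hQ' hD (P.map Bicomplex.conjPlusHom) hq hA₁
  obtain ⟨w₂, v₂, hc₂, hw₂, hv₂, hb₂⟩ :=
    Q.exists_complex_solution hQ' hD (P.map Bicomplex.minusHom) hq hA₂
  refine ⟨fun z => Bicomplex.ofComponents (w₁ z, w₂ z),
    ⟨?_, ⟨fun z => Bicomplex.ofComponents (v₁ z, v₂ z), ?_, ?_⟩,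
    fun z hz => ?_⟩, fun w' hw' => ?_⟩
  · exact (Bicomplex.ofComponentsCLM.continuous.comp (hc₁.prodMk hc₂)).continuousOn
  · rw [Bicomplex.hasWeakDbar_iff]
    simpa only [map_add, map_mul, Bicomplex.conjPlusHom_ofComponents,
      Bicomplex.minusHom_ofComponents]
      using And.intro hw₁ hw₂
  · rw [Bicomplex.hasWeakDbar_iff]
    simpa only [map_mul, Bicomplex.conjPlusHom_ofComponents,
      Bicomplex.minusHom_ofComponents]
      using And.intro hv₁ hv₂
  · refine Bicomplex.ext_components ?_ ?_
    · rw [Bicomplex.conjPlusHom_ofComponents, hb₁ z hz, map_mul, Bicomplex.conjPlusHom_exp,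
        Bicomplex.conjPlusHom_vekuaOperator hDm,
          Bicomplex.map_evalPoly Bicomplex.conjPlusHom_ofComplex_ofReal]
    · rw [Bicomplex.minusHom_ofComponents, hb₂ z hz, map_mul, Bicomplex.minusHom_exp,
        Bicomplex.minusHom_vekuaOperator hDm,
          Bicomplex.map_evalPoly Bicomplex.minusHom_ofComplex_ofReal]
  · obtain ⟨hc, ⟨v', hwv, hvv⟩, hb⟩ := hw'
    rw [Bicomplex.hasWeakDbar_iff] at hwv hvv
    simp only [map_add, map_mul] at hwv hvv
    have e₁ := Q.eqOn_of_complex_solutions hQ' hD hq hA₁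
      (Bicomplex.conjPlusCLM.continuous.comp_continuousOn hc) hc₁.continuousOn hwv.1 hvv.1 hw₁ hv₁
      (fun z hz => by
        change Bicomplex.conjPlusHom (w' z) = w₁ z
        rw [hb z hz, hb₁ z hz, map_mul, Bicomplex.conjPlusHom_exp,
          Bicomplex.conjPlusHom_vekuaOperator hDm,
          Bicomplex.map_evalPoly Bicomplex.conjPlusHom_ofComplex_ofReal])
    have e₂ := Q.eqOn_of_complex_solutions hQ' hD hq hA₂
      (Bicomplex.minusCLM.continuous.comp_continuousOn hc) hc₂.continuousOn hwv.2 hvv.2 hw₂ hv₂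
      (fun z hz => by
        change Bicomplex.minusHom (w' z) = w₂ z
        rw [hb z hz, hb₂ z hz, map_mul, Bicomplex.minusHom_exp,
          Bicomplex.minusHom_vekuaOperator hDm,
          Bicomplex.map_evalPoly Bicomplex.minusHom_ofComplex_ofReal])
    intro z hz
    refine Bicomplex.ext_components ?_ ?_
    · rw [Bicomplex.conjPlusHom_ofComponents]
      exact e₁ hz
    · rw [Bicomplex.minusHom_ofComponents]
      exact e₂ hz
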